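/- All logarithms are to base $2$. For integers $k\ge 2$ and $n\ge 2$ put $m=\lceil \log k+\log\log(k+1)+5\rceil$ and $d=\lfloor 20000\,k(\log k)^2\log n\rfloor$. A string $s\in\{0,1\}^n$ is called $k$-mixed if every block of $d$ consecutive symbols of $s$ contains every pattern $p\in\{0,1\}^m$ as a block of consecutive symbols; let $\mathcal M_n$ be the set of $k$-mixed strings of length $n$. For $s\in\{0,1\}^n$ let $\sigma_k(s)\subseteq\{0,1\}^{n-k}$ be the set of all subsequences of $s$ of length $n-k$. Theorem. Fix an integer $k\ge 2$. Then for all large enough $n$ there exist $b=O(k^2\log k\log n)$ (with an absolute implied constant), a hash function $H_{\mathsf{mixed}}:\mathcal M_n\to\{0,1\}^b$ and a deletion correction function $G_{\mathsf{mixed}}:\{0,1\}^{n-k}\times\{0,1\}^b\to\{0,1\}^n\cup\{\mathsf{Fail}\}$, both computable in $O_k(n(\log n)^4)$ time (for each $k$, by two programs for a random access machine with logarithmic cost that serve all large $n$, the implied constant depending on $k$ only), such that for every $k$-mixed $s\in\{0,1\}^n$ and every $s'\in\sigma_k(s)$, $$G_{\mathsf{mixed}}(s',H_{\mathsf{mixed}}(s))=s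 .$$ -/

import Mathlib

/-! ### A random access machine with logarithmic cost

The control flow of a program is structured (sequencing, branching, loops) and its data live in
registers and in random access arrays, all initially `0` outside the input. A program mentions only
finitely many registers and arrays. Every value that is read or computed, array indices included, is
charged its bit length. -/

namespace RAM

/-- Arithmetic on natural numbers: `sub` is truncated and `div` rounds down. -/
inductive Op where
  | add | sub | mul | div

def Op.eval : Op → ℕ → ℕ → ℕ
  | .add, x, y => x + y
  | .sub, x, y => x - y
  | .mul, x, y => x * y
  | .div, x, y => x / y

/-- Expressions: constants, the register `r`, the cell of the array `a` at a computed index, and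
arithmetic. -/
inductive Expr where
  | const (c : ℕ)
  | reg (r : ℕ)
  | get (a : ℕ) (i : Expr)
  | bin (o : Op) (e f : Expr)

/-- The contents of all registers and of all cells of all arrays. -/
structure State where
  reg : ℕ → ℕ
  mem : ℕ → ℕ → ℕ

/-- The charge for handling the number `x`: its bit length plus one (so that `0` is not free). -/
def len (x : ℕ) : ℕ := Nat.size x + 1

def Expr.eval (σ : State) : Expr → ℕ
  | .const c => c
  | .reg r => σ.reg r
  | .get a i => σ.mem a (i.eval σ)
  | .bin o e f => o.eval (e.eval σ) (f.eval σ)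

/-- The cost of evaluating an expression: the charges of the values of all its subexpressions. -/
def Expr.cost (σ : State) : Expr → ℕ
  | .const c => len c
  | .reg r => len (σ.reg r)
  | .get a i => i.cost σ + len (σ.mem a (i.eval σ))
  | .bin o e f => e.cost σ + f.cost σ + len (o.eval (e.eval σ) (f.eval σ))

/-- Programs. `set r e` writes the value of `e` to the register `r`; `put a i e` writes the value of
`e` to the cell `i` of the array `a`; `ite e f c d` and `loop e f c` test whether `e < f`. -/
inductive Prog where
  | skip
  | set (r : ℕ) (e : Expr)
  | put (a : ℕ) (i e : Expr)
  | seq (c d : Prog)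
  | ite (e f : Expr) (c d : Prog)
  | loop (e f : Expr) (c : Prog)

/-- `Exec c σ t τ`: the program `c`, started in the state `σ`, halts in the state `τ` at total
cost `t`. -/
inductive Exec : Prog → State → ℕ → State → Prop where
  | skip (σ : State) : Exec .skip σ 1 σ
  | set (σ : State) (r : ℕ) (e : Expr) :
      Exec (.set r e) σ (e.cost σ) ⟨Function.update σ.reg r (e.eval σ), σ.mem⟩
  | put (σ : State) (a : ℕ) (i e : Expr) :
      Exec (.put a i e) σ (i.cost σ + e.cost σ)
        ⟨σ.reg, Function.update σ.mem a (Function.update (σ.mem a) (i.eval σ) (e.eval σ))⟩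
  | seq {c d : Prog} {σ τ υ : State} {t u : ℕ} (hc : Exec c σ t τ) (hd : Exec d τ u υ) :
      Exec (.seq c d) σ (t + u) υ
  | ite_true {e f : Expr} {c d : Prog} {σ τ : State} {t : ℕ} (h : e.eval σ < f.eval σ)
      (hc : Exec c σ t τ) : Exec (.ite e f c d) σ (e.cost σ + f.cost σ + t) τ
  | ite_false {e f : Expr} {c d : Prog} {σ τ : State} {t : ℕ} (h : ¬ e.eval σ < f.eval σ)
      (hd : Exec d σ t τ) : Exec (.ite e f c d) σ (e.cost σ + f.cost σ + t) τ
  | loop_true {e f : Expr} {c : Prog} {σ τ υ : State} {t u : ℕ} (h : e.eval σ < f.eval σ)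
      (hc : Exec c σ t τ) (hl : Exec (.loop e f c) τ u υ) :
      Exec (.loop e f c) σ (e.cost σ + f.cost σ + t + u) υ
  | loop_false {e f : Expr} {c : Prog} {σ : State} (h : ¬ e.eval σ < f.eval σ) :
      Exec (.loop e f c) σ (e.cost σ + f.cost σ) σ

/-- The initial state on a list of input bit strings: the bits of the `a`-th string are in the array
`a` and its length is in the register `a`; everything else is `0`. -/
def State.init (xs : List (List Bool)) : State where
  reg a := (xs.getD a []).length
  mem a i := ((xs.getD a []).getD i false).toNat

/-- The output of a halting state is the bit string `y`: its length is in the register `0` and its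
bits are the first cells of the array `0`. -/
def State.HasOutput (τ : State) (y : List Bool) : Prop :=
  τ.reg 0 = y.length ∧ ∀ i, (hi : i < y.length) → τ.mem 0 i = (y[i]).toNat

/-- On the input strings `xs`, the program halts with output `y` at cost at most `T`. -/
def Prog.ComputesWithin (c : Prog) (xs : List (List Bool)) (y : List Bool) (T : ℝ) : Prop :=
  ∃ (t : ℕ) (τ : State), Exec c (State.init xs) t τ ∧ τ.HasOutput y ∧ (t : ℝ) ≤ T

end RAM

/-! ### Mixed strings and deletions -/

/-- The pattern length `m = ⌈log k + log log (k + 1) + 5⌉` (logarithms to base two). -/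
noncomputable def patternLength (k : ℕ) : ℕ :=
  ⌈Real.logb 2 k + Real.logb 2 (Real.logb 2 (k + 1)) + 5⌉₊

/-- The window length `d = ⌊20000 k (log k)² log n⌋` (logarithms to base two). -/
noncomputable def windowLength (k n : ℕ) : ℕ :=
  ⌊20000 * (k : ℝ) * Real.logb 2 k ^ 2 * Real.logb 2 n⌋₊

/-- `i` (counted from `0`) is a `p`-split point of `s`: an occurrence of `p` in `s` starts there. -/
def IsSplitPoint (p s : List Bool) (i : ℕ) : Prop :=
  (s.drop i).take p.length = p

/-- `s` is `k`-mixed: each of its substrings (blocks of consecutive symbols) of length `d` has a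
`p`-split point, for every pattern `p` of length `m`. -/
def IsMixed (k : ℕ) (s : List Bool) : Prop :=
  ∀ p : List Bool, p.length = patternLength k →
    ∀ w : List Bool, w <:+: s → w.length = windowLength k s.length → ∃ i, IsSplitPoint p w i

/-- The set `M_n` of the `k`-mixed strings of length `n`. -/
def mixedStrings (k n : ℕ) : Set (List.Vector Bool n) := {s | IsMixed k s.toList}

/-- `σ_k(s)`: the subsequences of `s` of length `n - k`. -/
def deletions (k : ℕ) {n : ℕ} (s : List.Vector Bool n) : Set (List.Vector Bool (n - k)) :=
  {s' | s'.toList.Sublist s.toList}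

/-- The bit string by which a program outputs an element of `{0,1}^n ∪ {Fail}`: a flag (`false`
for Fail, which is `none`), followed by the string if there is one. -/
def encodeOrFail {n : ℕ} : Option (List.Vector Bool n) → List Bool
  | none => [false]
  | some s => true :: s.toList

/-! Fix a pattern of `m` bits with code `P` and cut `s` behind the first symbol of each of its
occurrences. As `s` is mixed, all segments have length `O_k(log n)`. A segment is hashed to its
length together with one colour for each of its blocks of a constant length `B`. Blocks with a
common subsequence of length `B - k` receive different colours, so that a colour and `B - k`
surviving symbols determine the block (`Block.exists_tables`). A colour takes only `O(k log B)`
bits, so for a large constant `B` the whole segment hash is at most `n` (`Params.exists_hash_bound`)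
and is an element of the prime field with `q` elements, where `n < q ≤ 2n`. For every `P` the
published hash contains the `2k + 1` power sums `∑ h_j j^r`, `r ≤ 2k`, of the segment hashes `h_j`.
These are `2^m (2k + 1)` numbers of `L = O(log n)` bits, and `2^m = O(k log k)`.

Call `P` clean if the deletions neither destroy an occurrence of `P` nor create one. Then the
segments of `s'` correspond to those of `s` (`Split.Clean.lab_eq`), and at most `k` of them, those
that contain a deletion, can have a wrong hash. The power sums are Reed-Solomon syndromes, which
determine up to `k` errors, so the decoder corrects the segment hashes computed from `s'`. The
corrected lengths give the places of the segments in `s`; within a segment at most `k` symbols are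
missing, so the first `B - k` symbols of `s'` at the offset of a block form a subsequence of that
block (`Split.Clean.sublist_block`), and its colour restores it.

The decoder does not know which patterns are clean. But each deletion spoils at most `2m` patterns
(`Split.card_not_clean_le`), and `4km < 2^m` (`Params.four_mul_lt_two_pow`), so that fewer than half
of the patterns are spoiled. The decoder runs with every pattern and takes the majority for each
bit.

As to the time, for fixed `k` the number of patterns, the colour tables and the sizes of all
determinants are constants. Errors are located by exhaustive search: Hankel determinants of the
syndromes decide whether a given position is wrong and whether a given value corrects it
(`Hankel.hdet_eq_zero_iff_mem`, `Hankel.hdet_eq_zero_iff_eq`). What remains are loops up to `N = 2n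
+ 1` nested with at most one loop up to `L`, on numbers of `O(log n)` bits. The algorithms are
written in a small language of bounded loops, which is compiled to the machine once and for all.
Stored values are cut off at a bound `W`, so that the cost estimate holds on every input, including
arguments that are no genuine hash. -/

namespace RAM

open Function

/-! ### Total correctness with a bound on the cost -/

/-- From `ρ`, the program `c` halts at cost at most `T` in a state that satisfies `Q`. -/
def Runs (c : Prog) (ρ : State) (T : ℕ) (Q : State → Prop) : Prop :=
  ∃ t ρ', Exec c ρ t ρ' ∧ t ≤ T ∧ Q ρ'

theorem Runs.mono {c : Prog} {ρ : State} {T T' : ℕ} {Q Q' : State → Prop} (h : Runs c ρ T Q)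
    (hT : T ≤ T') (hQ : ∀ τ, Q τ → Q' τ) : Runs c ρ T' Q' := by
  obtain ⟨t, ρ', h1, h2, h3⟩ := h
  exact ⟨t, ρ', h1, h2.trans hT, hQ _ h3⟩

theorem Runs.skip {ρ : State} {T : ℕ} {Q : State → Prop} (hT : 1 ≤ T) (hQ : Q ρ) :
    Runs .skip ρ T Q := ⟨1, ρ, .skip ρ, hT, hQ⟩

theorem Runs.seq {c d : Prog} {ρ : State} {T U : ℕ} {Q R : State → Prop} (h : Runs c ρ T Q)
    (h' : ∀ τ, Q τ → Runs d τ U R) : Runs (.seq c d) ρ (T + U) R := by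
  obtain ⟨t, ρ', h1, h2, h3⟩ := h
  obtain ⟨u, ρ'', h4, h5, h6⟩ := h' _ h3
  exact ⟨t + u, ρ'', .seq h1 h4, by omega, h6⟩

theorem Runs.set {ρ : State} {r : ℕ} {e : Expr} {T : ℕ} {Q : State → Prop} (hT : e.cost ρ ≤ T)
    (hQ : Q ⟨update ρ.reg r (e.eval ρ), ρ.mem⟩) : Runs (.set r e) ρ T Q :=
  ⟨_, _, .set ρ r e, hT, hQ⟩

theorem Runs.put {ρ : State} {a : ℕ} {i e : Expr} {T : ℕ} {Q : State → Prop}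
    (hT : i.cost ρ + e.cost ρ ≤ T)
    (hQ : Q ⟨ρ.reg, update ρ.mem a (update (ρ.mem a) (i.eval ρ) (e.eval ρ))⟩) :
    Runs (.put a i e) ρ T Q :=
  ⟨_, _, .put ρ a i e, hT, hQ⟩

theorem Runs.ite {ρ : State} {e f : Expr} {c d : Prog} {T U : ℕ} {Q : State → Prop}
    (hT : e.cost ρ + f.cost ρ ≤ T) (hc : e.eval ρ < f.eval ρ → Runs c ρ U Q)
    (hd : ¬ e.eval ρ < f.eval ρ → Runs d ρ U Q) : Runs (.ite e f c d) ρ (T + U) Q := by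
  by_cases h : e.eval ρ < f.eval ρ
  · obtain ⟨t, τ, h1, h2, h3⟩ := hc h
    exact ⟨_, τ, .ite_true h h1, by omega, h3⟩
  · obtain ⟨t, τ, h1, h2, h3⟩ := hd h
    exact ⟨_, τ, .ite_false h h1, by omega, h3⟩

/-- The invariant is indexed by the number of completed rounds, so the exact number `K` of rounds is
part of it. The test is paid once more than the body. The induction is on the number of remaining
rounds. -/
theorem Runs.loop {e f : Expr} {c : Prog} (Inv : ℕ → State → Prop) {K T₀ T : ℕ}
    (hstep : ∀ i < K, ∀ ρ, Inv i ρ →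
      e.eval ρ < f.eval ρ ∧ e.cost ρ + f.cost ρ ≤ T₀ ∧ Runs c ρ T (Inv (i + 1)))
    (hend : ∀ ρ, Inv K ρ → ¬ e.eval ρ < f.eval ρ ∧ e.cost ρ + f.cost ρ ≤ T₀)
    {ρ : State} (h0 : Inv 0 ρ) : Runs (.loop e f c) ρ (K * (T₀ + T) + T₀) (Inv K) := by
  have key : ∀ j ≤ K, ∀ ρ, Inv (K - j) ρ → Runs (.loop e f c) ρ (j * (T₀ + T) + T₀) (Inv K) := by
    intro j
    induction j with
    | zero =>
      intro _ ρ h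
      obtain ⟨h1, h2⟩ := hend ρ h
      exact ⟨_, ρ, .loop_false h1, by simpa using h2, h⟩
    | succ j ih =>
      intro hj ρ h
      obtain ⟨h1, h2, t, τ, h3, h4, h5⟩ := hstep _ (by omega) ρ h
      rw [show K - (j + 1) + 1 = K - j by omega] at h5
      obtain ⟨u, υ, h6, h7, h8⟩ := ih (by omega) τ h5
      refine ⟨_, υ, .loop_true h1 h3 h6, ?_, h8⟩
      rw [Nat.succ_mul]
      omega
  exact key K le_rfl ρ (by simpa using h0)

/-! ### The charge for numbers of polynomial size -/

theorem len_mono {x y : ℕ} (h : x ≤ y) : len x ≤ len y := by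
  unfold len
  exact Nat.succ_le_succ (Nat.size_le_size h)

/-- Bit lengths turn powers into multiples: every quantity polynomial in `W` is charged a constant
multiple of the charge for `W`. -/
theorem len_le_of_le_pow {x W d : ℕ} (hW : 1 ≤ W) (h : x ≤ W ^ d) :
    len x ≤ (d + 1) * len W := by
  have h2 : W ^ d ≤ 2 ^ (Nat.size W * d) := by
    rw [pow_mul]
    exact Nat.pow_le_pow_left (Nat.lt_size_self W).le d
  have h3 : Nat.size x ≤ Nat.size W * d + 1 := by
    rw [Nat.size_le]
    calc x ≤ 2 ^ (Nat.size W * d) := h.trans h2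
      _ < _ := Nat.pow_lt_pow_right (by norm_num) (Nat.lt_succ_self _)
  have h4 : 0 < Nat.size W := Nat.size_pos.2 hW
  unfold len
  have : (d + 1) * (Nat.size W + 1) = Nat.size W * d + d + Nat.size W + 1 := by ring
  omega

theorem two_le_len {W : ℕ} (hW : 1 ≤ W) : 2 ≤ len W := by
  have h4 : 0 < Nat.size W := Nat.size_pos.2 hW
  unfold len
  omega

end RAM

/-! ### A language of bounded loops -/

/-! ### Syntax and semantics of the bounded-loop language -/

namespace BLoop

open Function RAM

/-- The loop bounds `N` and `L` and the bound `W` at which the stored values are cut off. -/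
structure Lims where
  N : ℕ
  L : ℕ
  W : ℕ

/-- The two kinds of loop bounds. -/
inductive Lim where
  | N | L

def Lim.val (p : Lims) : Lim → ℕ
  | .N => p.N
  | .L => p.L

/-- Expressions with bounded sums. -/
inductive X where
  | const (c : ℕ)
  | reg (r : ℕ)
  | lim (K : Lim)
  | get (a : ℕ) (i : X)
  | bin (o : Op) (e f : X)
  | sum (r : ℕ) (K : Lim) (e : X)

/-- The state after the assignment of `v` to the register `r`. -/
def setReg (σ : State) (r v : ℕ) : State := ⟨update σ.reg r v, σ.mem⟩

/-- The state after the assignment of `v` to the cell `i` of the array `a`. -/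
def setMem (σ : State) (a i v : ℕ) : State := ⟨σ.reg, update σ.mem a (update (σ.mem a) i v)⟩

def X.eval (p : Lims) : X → State → ℕ
  | .const c, _ => c
  | .reg r, σ => σ.reg r
  | .lim K, _ => K.val p
  | .get a i, σ => σ.mem a (i.eval p σ)
  | .bin o e f, σ => o.eval (e.eval p σ) (f.eval p σ)
  | .sum r K e, σ => ∑ i ∈ Finset.range (K.val p), e.eval p (setReg σ r i)

/-- If all data are at most `W`, then the value of `e` is at most `W ^ e.deg`. -/
def X.deg : X → ℕ
  | .const c => c
  | .reg _ => 1
  | .lim _ => 1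
  | .get _ _ => 1
  | .bin _ e f => e.deg + f.deg + 1
  | .sum _ _ e => e.deg + 1

/-- Commands. The register `r` of a loop runs through the numbers below the bound. -/
inductive Cmd where
  | skip
  | set (r : ℕ) (e : X)
  | put (a : ℕ) (i e : X)
  | seq (c d : Cmd)
  | ite (e : X) (c d : Cmd)
  | loop (r : ℕ) (K : Lim) (c : Cmd)

def iter (f : ℕ → State → State) (σ : State) : ℕ → State
  | 0 => σ
  | i + 1 => f i (iter f σ i)

def Cmd.run (p : Lims) : Cmd → State → State
  | .skip, σ => σ
  | .set r e, σ => setReg σ r (min (e.eval p σ) p.W)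
  | .put a i e, σ => setMem σ a (i.eval p σ) (min (e.eval p σ) p.W)
  | .seq c d, σ => d.run p (c.run p σ)
  | .ite e c d, σ => if 0 < e.eval p σ then c.run p σ else d.run p σ
  | .loop r K c, σ => iter (fun i τ => c.run p (setReg τ r i)) σ (K.val p)

/-- All data of `σ` are at most `W`. -/
def Bdd (W : ℕ) (σ : State) : Prop := (∀ r, σ.reg r ≤ W) ∧ ∀ a i, σ.mem a i ≤ W

structure Lims.Good (p : Lims) : Prop where
  N_le : p.N ≤ p.W
  L_le : p.L ≤ p.W
  two_le : 2 ≤ p.W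

theorem Lims.Good.val_le {p : Lims} (hp : p.Good) (K : Lim) : K.val p ≤ p.W := by
  cases K
  · exact hp.N_le
  · exact hp.L_le

theorem Bdd.setReg {W : ℕ} {σ : State} (h : Bdd W σ) (r : ℕ) {v : ℕ} (hv : v ≤ W) :
    Bdd W (setReg σ r v) := by
  refine ⟨fun r' => ?_, h.2⟩
  by_cases hr : r' = r
  · subst hr; simpa [BLoop.setReg] using hv
  · simpa [BLoop.setReg, hr] using h.1 r'

theorem Bdd.setMem {W : ℕ} {σ : State} (h : Bdd W σ) (a i : ℕ) {v : ℕ} (hv : v ≤ W) :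
    Bdd W (setMem σ a i v) := by
  refine ⟨h.1, fun a' i' => ?_⟩
  by_cases ha : a' = a
  · subst ha
    by_cases hi : i' = i
    · subst hi; simpa [BLoop.setMem] using hv
    · simpa [BLoop.setMem, hi] using h.2 a' i'
  · simpa [BLoop.setMem, ha] using h.2 a' i'

/-- Inside an expression nothing is cut off, so intermediate values exceed `W`, but only
polynomially, with an exponent that depends on the expression alone. -/
theorem X.eval_le {p : Lims} (hp : p.Good) (e : X) :
    ∀ σ, Bdd p.W σ → e.eval p σ ≤ p.W ^ e.deg := by
  have hW : 1 ≤ p.W := by have := hp.two_le; omega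
  induction e with
  | const c =>
    intro σ _
    exact (Nat.lt_two_pow_self (n := c)).le.trans (Nat.pow_le_pow_left hp.two_le c)
  | reg r => intro σ h; simpa [X.eval, X.deg] using h.1 r
  | lim K => intro σ h; simpa [X.eval, X.deg] using hp.val_le K
  | get a i ih => intro σ h; simpa [X.eval, X.deg] using h.2 a _
  | bin o e f ihe ihf =>
    intro σ h
    have h1 : e.eval p σ ≤ p.W ^ (e.deg + f.deg) :=
      (ihe σ h).trans (Nat.pow_le_pow_right hW (by omega))
    have h2 : f.eval p σ ≤ p.W ^ (e.deg + f.deg) :=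
      (ihf σ h).trans (Nat.pow_le_pow_right hW (by omega))
    -- The extra `1` in the degree pays for the factor `2` in a sum of two values, as `2 ≤ W`.
    have h3 : 2 * p.W ^ (e.deg + f.deg) ≤ p.W ^ (e.deg + f.deg + 1) := by
      rw [pow_succ, mul_comm]
      exact Nat.mul_le_mul_left _ hp.two_le
    have h4 : e.eval p σ * f.eval p σ ≤ p.W ^ (e.deg + f.deg) := by
      rw [pow_add]
      exact Nat.mul_le_mul (ihe σ h) (ihf σ h)
    simp only [X.eval, X.deg]
    cases o <;> simp only [Op.eval]
    · omega
    · omega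
    · omega
    · have := Nat.div_le_self (e.eval p σ) (f.eval p σ)
      omega
  | sum r K e ih =>
    intro σ h
    simp only [X.eval, X.deg]
    calc _ ≤ ∑ _i ∈ Finset.range (K.val p), p.W ^ e.deg := by
          refine Finset.sum_le_sum fun i hi => ih _ (h.setReg r ?_)
          exact (Finset.mem_range.1 hi).le.trans (hp.val_le K)
      _ = K.val p * p.W ^ e.deg := by simp
      _ ≤ _ := by
          rw [pow_succ, mul_comm]
          exact Nat.mul_le_mul_left _ (hp.val_le K)

theorem iter_induct {f : ℕ → State → State} (Inv : ℕ → State → Prop) {K : ℕ}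
    (hstep : ∀ i < K, ∀ σ, Inv i σ → Inv (i + 1) (f i σ)) {σ : State} (h0 : Inv 0 σ) :
    Inv K (iter f σ K) := by
  have : ∀ i ≤ K, Inv i (iter f σ i) := by
    intro i
    induction i with
    | zero => intro _; exact h0
    | succ i ih => intro hi; exact hstep i (by omega) _ (ih (by omega))
  exact this K le_rfl

/-- The cut-off in the assignments makes this unconditional. Without it, a decoder fed with an
arbitrary hash would need a separate bound on its data. -/
theorem Cmd.bdd_run {p : Lims} (hp : p.Good) (c : Cmd) :
    ∀ σ, Bdd p.W σ → Bdd p.W (c.run p σ) := by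
  induction c with
  | skip => intro σ h; exact h
  | set r e => intro σ h; exact h.setReg r (min_le_right _ _)
  | put a i e => intro σ h; exact h.setMem a _ (min_le_right _ _)
  | seq c d ihc ihd => intro σ h; exact ihd _ (ihc _ h)
  | ite e c d ihc ihd =>
    intro σ h
    simp only [Cmd.run]
    split_ifs
    · exact ihc _ h
    · exact ihd _ h
  | loop r K c ih =>
    intro σ h
    refine iter_induct (fun _ τ => Bdd p.W τ) (fun i hi τ hτ => ih _ (hτ.setReg r ?_)) h
    exact hi.le.trans (hp.val_le K)

end BLoop

/-! ### Compilation to the machine and its cost -/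

namespace BLoop

open Function RAM

/-! ### Compilation -/

/-- The register that holds the bound. -/
def Lim.reg : Lim → ℕ
  | .N => 1
  | .L => 3

/-- The registers for temporary values. -/
abbrev slot (d : ℕ) : ℕ := 2 * d + 7

/-- The program that evaluates the expression and leaves the value in `slot d`. The slots below `d`
are left alone. -/
def X.comp : X → ℕ → Prog
  | .const c, d => .set (slot d) (.const c)
  | .reg r, d => .set (slot d) (.reg (2 * r))
  | .lim K, d => .set (slot d) (.reg K.reg)
  | .get a i, d => .seq (i.comp d) (.set (slot d) (.get a (.reg (slot d))))
  | .bin o e f, d => .seq (e.comp d) (.seq (f.comp (d + 1))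
      (.set (slot d) (.bin o (.reg (slot d)) (.reg (slot (d + 1))))))
  | .sum r K e, d =>
      -- A sum must not change the state, so the old value of its summation register is kept in
      -- `slot d` and restored after the loop.
      .seq (.set (slot d) (.reg (2 * r))) <|
      .seq (.set (slot (d + 1)) (.const 0)) <|
      .seq (.set (slot (d + 2)) (.const 0)) <|
      .seq (.loop (.reg (slot (d + 2))) (.reg K.reg)
        (.seq (.set (2 * r) (.reg (slot (d + 2)))) <|
         .seq (e.comp (d + 3)) <|
         .seq (.set (slot (d + 1)) (.bin .add (.reg (slot (d + 1))) (.reg (slot (d + 3))))) <|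
         .set (slot (d + 2)) (.bin .add (.reg (slot (d + 2))) (.const 1)))) <|
      .seq (.set (2 * r) (.reg (slot d)))
      (.set (slot d) (.reg (slot (d + 1))))

/-- The value of the register `s`, cut off at `W`. -/
def clamp (s : ℕ) : Expr := .bin .sub (.reg s) (.bin .sub (.reg s) (.reg 5))

/-- The counter of a loop lives in a slot and is only copied to the register `r`, so the body may
overwrite `r` without changing the number of rounds. -/
def Cmd.comp : Cmd → ℕ → Prog
  | .skip, _ => .skip
  | .set r e, d => .seq (e.comp d) (.set (2 * r) (clamp (slot d)))
  | .put a i e, d => .seq (i.comp d) (.seq (e.comp (d + 1))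
      (.put a (.reg (slot d)) (clamp (slot (d + 1)))))
  | .seq c c', d => .seq (c.comp d) (c'.comp d)
  | .ite e c c', d => .seq (e.comp d) (.ite (.const 0) (.reg (slot d)) (c.comp d) (c'.comp d))
  | .loop r K c, d =>
      .seq (.set (slot d) (.const 0))
      (.loop (.reg (slot d)) (.reg K.reg)
        (.seq (.set (2 * r) (.reg (slot d))) <|
         .seq (c.comp (d + 1))
         (.set (slot d) (.bin .add (.reg (slot d)) (.const 1)))))

/-- The cost of the compiled program, in units of the charge for `W`. -/
def X.cost (p : Lims) : X → ℕ
  | .const c => c + 1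
  | .reg _ => 2
  | .lim _ => 2
  | .get _ i => i.cost p + (i.deg + 3)
  | .bin _ e f => e.cost p + (f.cost p + 2 * (e.deg + f.deg + 3))
  | .sum _ K e => K.val p * (e.cost p + 3 * e.deg + 25) + (e.deg + 25)

def Cmd.cost (p : Lims) : Cmd → ℕ
  | .skip => 1
  | .set _ e => e.cost p + (3 * e.deg + 5)
  | .put _ i e => i.cost p + (e.cost p + (i.deg + 3 * e.deg + 6))
  | .seq c d => c.cost p + d.cost p
  | .ite e c d => e.cost p + (e.deg + 2 + (c.cost p + d.cost p))
  | .loop _ K c => K.val p * (c.cost p + 20) + 20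

/-- The state `ρ` of the machine represents the state `σ` of the language. -/
structure Sim (p : Lims) (σ ρ : State) : Prop where
  mem : ρ.mem = σ.mem
  reg : ∀ r, ρ.reg (2 * r) = σ.reg r
  N : ρ.reg 1 = p.N
  L : ρ.reg 3 = p.L
  W : ρ.reg 5 = p.W

theorem Sim.lim {p : Lims} {σ ρ : State} (h : Sim p σ ρ) (K : Lim) : ρ.reg K.reg = K.val p := by
  cases K
  · exact h.N
  · exact h.L

theorem Sim.slot {p : Lims} {σ ρ : State} (h : Sim p σ ρ) (d v : ℕ) :
    Sim p σ ⟨update ρ.reg (slot d) v, ρ.mem⟩ := by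
  refine ⟨h.mem, fun r => ?_, ?_, ?_, ?_⟩
  · simpa [update_of_ne (show 2 * r ≠ 2 * d + 7 by omega)] using h.reg r
  · simpa [update_of_ne (show 1 ≠ 2 * d + 7 by omega)] using h.N
  · simpa [update_of_ne (show 3 ≠ 2 * d + 7 by omega)] using h.L
  · simpa [update_of_ne (show 5 ≠ 2 * d + 7 by omega)] using h.W

theorem Sim.var {p : Lims} {σ ρ : State} (h : Sim p σ ρ) (r v : ℕ) :
    Sim p (setReg σ r v) ⟨update ρ.reg (2 * r) v, ρ.mem⟩ := by
  refine ⟨h.mem, fun r' => ?_, ?_, ?_, ?_⟩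
  · by_cases hr : r' = r
    · subst hr; simp [setReg]
    · simpa [setReg, hr] using h.reg r'
  · simpa [update_of_ne (show 1 ≠ 2 * r by omega)] using h.N
  · simpa [update_of_ne (show 3 ≠ 2 * r by omega)] using h.L
  · simpa [update_of_ne (show 5 ≠ 2 * r by omega)] using h.W

/-- The machine state `τ` represents `σ` and agrees with `ρ` in the slots below `d`. -/
def After (p : Lims) (σ ρ : State) (d : ℕ) (τ : State) : Prop :=
  Sim p σ τ ∧ ∀ j < d, τ.reg (slot j) = ρ.reg (slot j)

theorem After.refl {p : Lims} {σ ρ : State} (h : Sim p σ ρ) (d : ℕ) : After p σ ρ d ρ :=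
  ⟨h, fun _ _ => rfl⟩

theorem After.trans {p : Lims} {σ σ' ρ τ υ : State} {d d' : ℕ} (h : After p σ ρ d τ)
    (h' : After p σ' τ d' υ) (hd : d ≤ d') : After p σ' ρ d υ :=
  ⟨h'.1, fun j hj => (h'.2 j (by omega)).trans (h.2 j hj)⟩

theorem After.slot {p : Lims} {σ ρ τ : State} {d d' : ℕ} (h : After p σ ρ d τ) (hd : d ≤ d')
    (v : ℕ) : After p σ ρ d ⟨update τ.reg (slot d') v, τ.mem⟩ := by
  refine ⟨h.1.slot d' v, fun j hj => ?_⟩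
  simpa [update_of_ne (show 2 * j + 7 ≠ 2 * d' + 7 by omega)] using h.2 j hj

theorem After.var {p : Lims} {σ ρ τ : State} {d : ℕ} (h : After p σ ρ d τ) (r v : ℕ) :
    After p (setReg σ r v) ρ d ⟨update τ.reg (2 * r) v, τ.mem⟩ := by
  refine ⟨h.1.var r v, fun j hj => ?_⟩
  simpa [update_of_ne (show 2 * j + 7 ≠ 2 * r by omega)] using h.2 j hj

@[simp] theorem setReg_setReg (σ : State) (r u v : ℕ) :
    setReg (setReg σ r u) r v = setReg σ r v := by simp [setReg]

@[simp] theorem setReg_self (σ : State) (r : ℕ) : setReg σ r (σ.reg r) = σ := by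
  simp [setReg]

/-- Induction on `e`. Slots below `d` hold results that are still needed by an enclosing expression,
which is why `After` records that they survive. All values are at most `W ^ deg`, so every
instruction costs a constant number of units. -/
theorem X.runs_comp {p : Lims} (hp : p.Good) (e : X) : ∀ (d : ℕ) (σ ρ : State), Bdd p.W σ →
    Sim p σ ρ → Runs (e.comp d) ρ (e.cost p * len p.W)
      (fun τ => After p σ ρ d τ ∧ τ.reg (slot d) = e.eval p σ) := by
  have hW : 1 ≤ p.W := by have := hp.two_le; omega
  have h2W := two_le_len hW
  have hlen : ∀ {x d : ℕ}, x ≤ p.W ^ d → len x ≤ (d + 1) * len p.W := len_le_of_le_pow hW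
  have hlen1 : ∀ {x : ℕ}, x ≤ p.W → len x ≤ len p.W := len_mono
  have len0 : len 0 = 1 := by simp [len]
  have len1 : len 1 = 2 := by simp [len]
  induction e with
  | const c =>
    intro d σ ρ hσ h
    refine Runs.set ?_ ⟨(After.refl h d).slot le_rfl _, by simp [Expr.eval, X.eval]⟩
    exact hlen (X.eval_le hp (.const c) σ hσ)
  | reg r =>
    intro d σ ρ hσ h
    refine Runs.set ?_ ⟨(After.refl h d).slot le_rfl _, by simp [Expr.eval, X.eval, h.reg]⟩
    simp only [Expr.cost, X.cost, h.reg]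
    have := hlen1 (hσ.1 r)
    nlinarith
  | lim K =>
    intro d σ ρ hσ h
    refine Runs.set ?_ ⟨(After.refl h d).slot le_rfl _, by simp [Expr.eval, X.eval, h.lim]⟩
    simp only [Expr.cost, X.cost, h.lim]
    have := hlen1 (hp.val_le K)
    nlinarith
  | get a i ih =>
    intro d σ ρ hσ h
    simp only [X.cost, add_mul (i.cost p)]
    refine (ih d σ ρ hσ h).seq fun τ hτ => Runs.set ?_ ⟨hτ.1.slot le_rfl _, ?_⟩
    · simp only [Expr.cost, Expr.eval, hτ.2, hτ.1.1.mem]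
      have h1 := hlen (X.eval_le hp i σ hσ)
      have h2 := hlen1 (hσ.2 a (i.eval p σ))
      nlinarith
    · simp [Expr.eval, X.eval, hτ.2, hτ.1.1.mem]
  | bin o e f ihe ihf =>
    intro d σ ρ hσ h
    simp only [X.cost, add_mul (e.cost p), add_mul (f.cost p)]
    refine (ihe d σ ρ hσ h).seq fun τ hτ => (ihf (d + 1) σ τ hσ hτ.1.1).seq fun υ hυ => ?_
    have h1 : υ.reg (BLoop.slot d) = e.eval p σ := by rw [hυ.1.2 d (by omega), hτ.2]
    refine Runs.set ?_ ⟨(hτ.1.trans hυ.1 (by omega)).slot le_rfl _, ?_⟩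
    · simp only [Expr.cost, Expr.eval, h1, hυ.2]
      have h3 := hlen (X.eval_le hp e σ hσ)
      have h4 := hlen (X.eval_le hp f σ hσ)
      have h5 := hlen (X.eval_le hp (.bin o e f) σ hσ)
      simp only [X.eval, X.deg] at h5
      nlinarith
    · simp [Expr.eval, X.eval, h1, hυ.2]
  | sum r K e ih =>
    intro d σ ρ hσ h
    have hr : len (σ.reg r) ≤ len p.W := hlen1 (hσ.1 r)
    have hbody : Runs (.loop (.reg (BLoop.slot (d + 2))) (.reg K.reg)
        (.seq (.set (2 * r) (.reg (BLoop.slot (d + 2)))) <|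
         .seq (e.comp (d + 3)) <|
         .seq (.set (BLoop.slot (d + 1)) (.bin .add (.reg (BLoop.slot (d + 1)))
            (.reg (BLoop.slot (d + 3))))) <|
         .set (BLoop.slot (d + 2)) (.bin .add (.reg (BLoop.slot (d + 2))) (.const 1))))
        ⟨update (update (update ρ.reg (BLoop.slot d) (σ.reg r)) (BLoop.slot (d + 1)) 0)
          (BLoop.slot (d + 2)) 0, ρ.mem⟩
        (K.val p * (2 * len p.W + (len p.W + (e.cost p * len p.W +
          ((3 * (e.deg + 2)) * len p.W + 4 * len p.W)))) + 2 * len p.W)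
        -- During the loop the summation register contains some leftover value `u`, which is
        -- irrelevant as it is restored at the end.
        (fun τ => (∃ u, After p (setReg σ r u) ρ d τ) ∧ τ.reg (BLoop.slot d) = σ.reg r ∧
          τ.reg (BLoop.slot (d + 1)) = ∑ i ∈ Finset.range (K.val p), e.eval p (setReg σ r i) ∧
          τ.reg (BLoop.slot (d + 2)) = K.val p) := by
      have hsum : ∀ i ≤ K.val p,
          ∑ i ∈ Finset.range i, e.eval p (setReg σ r i) ≤ p.W ^ (e.deg + 1) := by
        intro i hi
        refine le_trans ?_ (X.eval_le hp (.sum r K e) σ hσ)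
        exact Finset.sum_le_sum_of_subset (Finset.range_mono hi)
      refine Runs.loop (fun i τ => (∃ u, After p (setReg σ r u) ρ d τ) ∧
          τ.reg (BLoop.slot d) = σ.reg r ∧
          τ.reg (BLoop.slot (d + 1)) = ∑ i ∈ Finset.range i, e.eval p (setReg σ r i) ∧
          τ.reg (BLoop.slot (d + 2)) = i) ?_ ?_ ?_
      · rintro i hi τ ⟨⟨u, h1⟩, h2, h3, h4⟩
        have hiW : i ≤ p.W := hi.le.trans (hp.val_le K)
        have hKl := hlen1 (hp.val_le K)
        have hil := hlen1 hiW
        have hbd := hσ.setReg r hiW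
        refine ⟨by simpa [Expr.eval, h4, h1.1.lim] using hi, ?_, ?_⟩
        · simp only [Expr.cost, h4, h1.1.lim]; omega
        refine Runs.seq (Runs.set ?_ ?_) (Q := fun υ => After p (setReg σ r i) ρ d υ ∧
          υ.reg (BLoop.slot d) = σ.reg r ∧
          υ.reg (BLoop.slot (d + 1)) = ∑ i ∈ Finset.range i, e.eval p (setReg σ r i) ∧
          υ.reg (BLoop.slot (d + 2)) = i) ?_
        · simpa [Expr.cost, h4] using hil
        · simp only [Expr.eval, h4]
          have := h1.var r i
          rw [setReg_setReg] at this
          refine ⟨this, ?_, ?_, ?_⟩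
          · simpa [update_of_ne (show 2 * d + 7 ≠ 2 * r by omega)] using h2
          · simpa [update_of_ne (show 2 * (d + 1) + 7 ≠ 2 * r by omega)] using h3
          · simpa [update_of_ne (show 2 * (d + 2) + 7 ≠ 2 * r by omega)] using h4
        rintro υ ⟨h5, h6, h7, h8⟩
        refine (ih (d + 3) (setReg σ r i) υ hbd h5.1).seq fun φ hφ => ?_
        have g1 := hφ.1.2 d (by omega)
        have g2 := hφ.1.2 (d + 1) (by omega)
        have g3 := hφ.1.2 (d + 2) (by omega)
        rw [h6] at g1
        rw [h7] at g2
        rw [h8] at g3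
        refine Runs.seq (Runs.set ?_ ?_) (Q := fun υ => After p (setReg σ r i) ρ d υ ∧
          υ.reg (BLoop.slot d) = σ.reg r ∧
          υ.reg (BLoop.slot (d + 1)) = ∑ i ∈ Finset.range (i + 1), e.eval p (setReg σ r i) ∧
          υ.reg (BLoop.slot (d + 2)) = i) ?_
        · have a1 := hlen (hsum i hi.le)
          have a2 := hlen (hsum (i + 1) hi)
          have a3 := hlen (X.eval_le hp e _ hbd)
          simp only [Expr.cost, Expr.eval, Op.eval, g2, hφ.2]
          rw [← Finset.sum_range_succ]
          nlinarith
        · simp only [Expr.eval, Op.eval, g2, hφ.2]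
          refine ⟨(h5.trans hφ.1 (by omega)).slot (by omega) _, ?_, ?_, ?_⟩
          · simpa [update_of_ne (show 2 * d + 7 ≠ 2 * (d + 1) + 7 by omega)] using g1
          · simp [Finset.sum_range_succ]
          · simpa [update_of_ne (show 2 * (d + 2) + 7 ≠ 2 * (d + 1) + 7 by omega)] using g3
        rintro χ ⟨h9, h10, h11, h12⟩
        refine Runs.set ?_ ?_
        · have a1 := hlen1 (show i + 1 ≤ p.W from (Nat.succ_le_of_lt hi).trans (hp.val_le K))
          simp only [Expr.cost, Expr.eval, Op.eval, h12, len1]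
          nlinarith
        · simp only [Expr.eval, Op.eval, h12]
          refine ⟨⟨i, h9.slot (by omega) _⟩, ?_, ?_, ?_⟩
          · simpa [update_of_ne (show 2 * d + 7 ≠ 2 * (d + 2) + 7 by omega)] using h10
          · simpa [update_of_ne (show 2 * (d + 1) + 7 ≠ 2 * (d + 2) + 7 by omega)] using h11
          · simp
      · rintro τ ⟨⟨u, h1⟩, h2, h3, h4⟩
        have hKl := hlen1 (hp.val_le K)
        refine ⟨by simp [Expr.eval, h4, h1.1.lim], ?_⟩
        simp only [Expr.cost, h4, h1.1.lim]; omega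
      · refine ⟨⟨σ.reg r, ?_⟩, ?_, ?_, ?_⟩
        · rw [setReg_self]
          exact (((After.refl h d).slot le_rfl _).slot (by omega) _).slot (by omega) _
        · simp
        · simp
        · simp
    have hdeg : len (∑ i ∈ Finset.range (K.val p), e.eval p (setReg σ r i)) ≤
        (e.deg + 2) * len p.W := hlen (X.eval_le hp (.sum r K e) σ hσ)
    simp only [X.comp]
    refine Runs.mono (T := len p.W + (len p.W + (len p.W + ((K.val p * (2 * len p.W + (len p.W +
      (e.cost p * len p.W + ((3 * (e.deg + 2)) * len p.W + 4 * len p.W)))) + 2 * len p.W) +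
      (len p.W + (e.deg + 2) * len p.W)))))
      (Runs.seq (Q := fun τ => τ = ⟨update ρ.reg (BLoop.slot d) (σ.reg r), ρ.mem⟩)
        (Runs.set ?_ ?_) ?_) ?_ (fun _ h => h)
    · simpa [Expr.cost, h.reg] using hr
    · simp [Expr.eval, h.reg]
    · rintro _ rfl
      refine Runs.seq (Q := fun τ => τ = ⟨update (update ρ.reg (BLoop.slot d) (σ.reg r))
        (BLoop.slot (d + 1)) 0, ρ.mem⟩) (Runs.set ?_ rfl) ?_
      · simp [Expr.cost, len0]; omega
      rintro _ rfl
      refine Runs.seq (Q := fun τ => τ = ⟨update (update (update ρ.reg (BLoop.slot d) (σ.reg r))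
        (BLoop.slot (d + 1)) 0) (BLoop.slot (d + 2)) 0, ρ.mem⟩) (Runs.set ?_ rfl) ?_
      · simp [Expr.cost, len0]; omega
      rintro _ rfl
      refine hbody.seq ?_
      rintro τ ⟨⟨u, h1⟩, h2, h3, h4⟩
      refine Runs.seq (Q := fun υ => After p σ ρ d υ ∧
          υ.reg (BLoop.slot (d + 1)) = ∑ i ∈ Finset.range (K.val p), e.eval p (setReg σ r i))
          (Runs.set ?_ ?_) ?_
      · simpa [Expr.cost, h2] using hr
      · simp only [Expr.eval, h2]
        have := h1.var r (σ.reg r)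
        rw [setReg_setReg, setReg_self] at this
        refine ⟨this, ?_⟩
        simpa [update_of_ne (show 2 * (d + 1) + 7 ≠ 2 * r by omega)] using h3
      · rintro υ ⟨h5, h6⟩
        refine Runs.set ?_ ⟨h5.slot le_rfl _, ?_⟩
        · simpa [Expr.cost, h6] using hdeg
        · simp [Expr.eval, X.eval, h6]
    · simp only [X.cost]
      ring_nf
      nlinarith

theorem eval_clamp {p : Lims} {σ ρ : State} (h : Sim p σ ρ) {s v : ℕ} (hv : ρ.reg s = v) :
    (clamp s).eval ρ = min v p.W := by
  simp only [clamp, Expr.eval, Op.eval, h.W, hv]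
  omega

theorem cost_clamp {p : Lims} (hp : p.Good) {σ ρ : State} (h : Sim p σ ρ) {s v d : ℕ}
    (hv : ρ.reg s = v) (hd : v ≤ p.W ^ d) : (clamp s).cost ρ ≤ (3 * d + 5) * len p.W := by
  have hW : 1 ≤ p.W := by have := hp.two_le; omega
  have h1 := len_le_of_le_pow hW hd
  have h2 := len_mono (Nat.sub_le v p.W)
  have h3 : len (v - (v - p.W)) ≤ len p.W := len_mono (by omega)
  simp only [clamp, Expr.cost, Expr.eval, Op.eval, h.W, hv]
  nlinarith

/-- The semantics sets the loop register anew in each round, exactly as the compiled loop does.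
Boundedness of the state (`Cmd.bdd_run`) has to be carried along, since the cost of later commands
relies on it. -/
theorem Cmd.runs_comp {p : Lims} (hp : p.Good) (c : Cmd) : ∀ (d : ℕ) (σ ρ : State), Bdd p.W σ →
    Sim p σ ρ → Runs (c.comp d) ρ (c.cost p * len p.W) (After p (c.run p σ) ρ d) := by
  have hW : 1 ≤ p.W := by have := hp.two_le; omega
  have h2W := two_le_len hW
  have hlen : ∀ {x d : ℕ}, x ≤ p.W ^ d → len x ≤ (d + 1) * len p.W := len_le_of_le_pow hW
  have len0 : len 0 = 1 := by simp [len]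
  have len1 : len 1 = 2 := by simp [len]
  induction c with
  | skip =>
    intro d σ ρ hσ h
    exact Runs.skip (by simp only [Cmd.cost]; omega) (After.refl h d)
  | set r e =>
    intro d σ ρ hσ h
    simp only [Cmd.cost, add_mul (e.cost p)]
    refine (e.runs_comp hp d σ ρ hσ h).seq fun τ hτ => Runs.set ?_ ?_
    · exact cost_clamp hp hτ.1.1 hτ.2 (X.eval_le hp e σ hσ)
    · rw [eval_clamp hτ.1.1 hτ.2]
      exact hτ.1.var r _
  | put a i e =>
    intro d σ ρ hσ h
    simp only [Cmd.cost, add_mul (e.cost p), add_mul (i.cost p)]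
    refine (i.runs_comp hp d σ ρ hσ h).seq fun τ hτ =>
      (e.runs_comp hp (d + 1) σ τ hσ hτ.1.1).seq fun υ hυ => Runs.put ?_ ?_
    · have h1 := cost_clamp hp hυ.1.1 hυ.2 (X.eval_le hp e σ hσ)
      have h2 := hlen (X.eval_le hp i σ hσ)
      simp only [Expr.cost, hυ.1.2 d (by omega), hτ.2]
      nlinarith
    · rw [eval_clamp hυ.1.1 hυ.2]
      simp only [Expr.eval, hυ.1.2 d (by omega), hτ.2]
      have h3 := hτ.1.trans hυ.1 (by omega : d ≤ d + 1)
      refine ⟨⟨?_, h3.1.reg, h3.1.N, h3.1.L, h3.1.W⟩, h3.2⟩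
      simp [Cmd.run, setMem, h3.1.mem]
  | seq c c' ihc ihc' =>
    intro d σ ρ hσ h
    simp only [Cmd.cost, add_mul]
    exact (ihc d σ ρ hσ h).seq fun τ hτ =>
      (ihc' d _ τ (c.bdd_run hp σ hσ) hτ.1).mono le_rfl fun υ hυ => hτ.trans hυ le_rfl
  | ite e c c' ihc ihc' =>
    intro d σ ρ hσ h
    simp only [Cmd.cost, add_mul (e.cost p), add_mul (e.deg + 2)]
    refine (e.runs_comp hp d σ ρ hσ h).seq fun τ hτ => Runs.ite ?_ ?_ ?_
    · simp only [Expr.cost, hτ.2, len0]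
      have := hlen (X.eval_le hp e σ hσ)
      nlinarith
    · intro hc
      simp only [Expr.eval, hτ.2] at hc
      simp only [Cmd.run, if_pos hc]
      refine (ihc d σ τ hσ hτ.1.1).mono (by nlinarith) fun υ hυ => hτ.1.trans hυ le_rfl
    · intro hc
      simp only [Expr.eval, hτ.2] at hc
      simp only [Cmd.run, if_neg hc]
      refine (ihc' d σ τ hσ hτ.1.1).mono (by nlinarith) fun υ hυ => hτ.1.trans hυ le_rfl
  | loop r K c ih =>
    intro d σ ρ hσ h
    simp only [Cmd.comp]
    refine Runs.mono (T := len p.W + (K.val p * (2 * len p.W + (len p.W + (c.cost p * len p.W +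
          4 * len p.W))) + 2 * len p.W)) (Runs.seq
      (Q := fun τ => τ = ⟨update ρ.reg (BLoop.slot d) 0, ρ.mem⟩) (Runs.set ?_ rfl) ?_) ?_
      (fun _ h => h)
    · simp [Expr.cost, len0]; omega
    · rintro _ rfl
      refine (Runs.loop (fun i τ => After p (iter (fun i τ => c.run p (setReg τ r i)) σ i) ρ d τ ∧
        τ.reg (BLoop.slot d) = i ∧ Bdd p.W (iter (fun i τ => c.run p (setReg τ r i)) σ i))
        (T₀ := 2 * len p.W) ?_ ?_ ?_).mono le_rfl fun _ h => h.1
      · rintro i hi τ ⟨h1, h2, h3⟩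
        have hiW : i ≤ p.W := hi.le.trans (hp.val_le K)
        have hKl := len_mono (hp.val_le K)
        have hil := len_mono hiW
        have hbd := h3.setReg r hiW
        refine ⟨by simpa [Expr.eval, h2, h1.1.lim] using hi, ?_, ?_⟩
        · simp only [Expr.cost, h2, h1.1.lim]; omega
        refine Runs.seq (Q := fun υ => After p (setReg (iter (fun i τ => c.run p (setReg τ r i)) σ i)
          r i) ρ d υ ∧ υ.reg (BLoop.slot d) = i) (Runs.set ?_ ?_) ?_
        · simpa [Expr.cost, h2] using hil
        · simp only [Expr.eval, h2]
          refine ⟨h1.var r i, ?_⟩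
          simpa [update_of_ne (show 2 * d + 7 ≠ 2 * r by omega)] using h2
        rintro υ ⟨h4, h5⟩
        refine (ih (d + 1) _ υ hbd h4.1).seq fun φ hφ => Runs.set ?_ ?_
        · have a1 := len_mono (show i + 1 ≤ p.W from (Nat.succ_le_of_lt hi).trans (hp.val_le K))
          simp only [Expr.cost, Expr.eval, Op.eval, hφ.2 d (by omega), h5, len1]
          nlinarith
        · simp only [Expr.eval, Op.eval, hφ.2 d (by omega), h5]
          refine ⟨(h4.trans hφ (by omega)).slot le_rfl _, by simp, ?_⟩
          exact c.bdd_run hp _ hbd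
      · rintro τ ⟨h1, h2, h3⟩
        have hKl := len_mono (hp.val_le K)
        refine ⟨by simp [Expr.eval, h2, h1.1.lim], ?_⟩
        simp only [Expr.cost, h2, h1.1.lim]; omega
      · exact ⟨(After.refl h d).slot le_rfl _, by simp, hσ⟩
    · simp only [Cmd.cost]
      ring_nf
      nlinarith

end BLoop

/-! ### Cost estimates from the nesting of loops, and derived constructions -/

namespace BLoop

open Function RAM

/-! ### Programs of quasilinear cost -/

/-- At most `n` loops (or sums) up to `N` and at most `l` loops up to `L` are nested. -/
def X.Fits : Bool → Bool → X → Prop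
  | _, _, .const _ => True
  | _, _, .reg _ => True
  | _, _, .lim _ => True
  | n, l, .get _ i => i.Fits n l
  | n, l, .bin _ e f => e.Fits n l ∧ f.Fits n l
  | n, l, .sum _ .N e => n = true ∧ e.Fits false l
  | n, l, .sum _ .L e => l = true ∧ e.Fits n false

def Cmd.Fits : Bool → Bool → Cmd → Prop
  | _, _, .skip => True
  | n, l, .set _ e => e.Fits n l
  | n, l, .put _ i e => i.Fits n l ∧ e.Fits n l
  | n, l, .seq c d => c.Fits n l ∧ d.Fits n l
  | n, l, .ite e c d => e.Fits n l ∧ c.Fits n l ∧ d.Fits n l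
  | n, l, .loop _ .N c => n = true ∧ c.Fits false l
  | n, l, .loop _ .L c => l = true ∧ c.Fits n false

/-- The number of steps that nested loops of the given kinds make. -/
def scale (p : Lims) (n l : Bool) : ℕ := (if n then p.N else 1) * (if l then p.L else 1)

theorem one_le_scale {p : Lims} (hN : 1 ≤ p.N) (hL : 1 ≤ p.L) (n l : Bool) :
    1 ≤ scale p n l := by
  unfold scale
  refine Nat.mul_pos ?_ ?_ <;> split_ifs <;> omega

theorem exists_add_le {A B : Lims → ℕ} {n l : Bool}
    (hA : ∃ C, ∀ p : Lims, 1 ≤ p.N → 1 ≤ p.L → A p ≤ C * scale p n l)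
    (hB : ∃ C, ∀ p : Lims, 1 ≤ p.N → 1 ≤ p.L → B p ≤ C * scale p n l) :
    ∃ C, ∀ p : Lims, 1 ≤ p.N → 1 ≤ p.L → A p + B p ≤ C * scale p n l := by
  obtain ⟨C, hC⟩ := hA
  obtain ⟨D, hD⟩ := hB
  refine ⟨C + D, fun p h1 h2 => ?_⟩
  rw [add_mul]
  exact Nat.add_le_add (hC p h1 h2) (hD p h1 h2)

theorem exists_const_le (c : ℕ) (n l : Bool) :
    ∃ C, ∀ p : Lims, 1 ≤ p.N → 1 ≤ p.L → c ≤ C * scale p n l :=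
  ⟨c, fun _ h1 h2 => Nat.le_mul_of_pos_right _ (one_le_scale h1 h2 n l)⟩

/-- The loop spends the permission to loop up to `N`: what is inside must be bounded without the
factor `N`. -/
theorem exists_mul_le_N {A : Lims → ℕ} {l : Bool}
    (hA : ∃ C, ∀ p : Lims, 1 ≤ p.N → 1 ≤ p.L → A p ≤ C * scale p false l) :
    ∃ C, ∀ p : Lims, 1 ≤ p.N → 1 ≤ p.L → Lim.N.val p * A p ≤ C * scale p true l := by
  obtain ⟨C, hC⟩ := hA
  refine ⟨C, fun p h1 h2 => (Nat.mul_le_mul_left _ (hC p h1 h2)).trans (le_of_eq ?_)⟩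
  simp only [scale, Lim.val, if_true, Bool.false_eq_true, if_false]
  ring

theorem exists_mul_le_L {A : Lims → ℕ} {n : Bool}
    (hA : ∃ C, ∀ p : Lims, 1 ≤ p.N → 1 ≤ p.L → A p ≤ C * scale p n false) :
    ∃ C, ∀ p : Lims, 1 ≤ p.N → 1 ≤ p.L → Lim.L.val p * A p ≤ C * scale p n true := by
  obtain ⟨C, hC⟩ := hA
  refine ⟨C, fun p h1 h2 => (Nat.mul_le_mul_left _ (hC p h1 h2)).trans (le_of_eq ?_)⟩
  simp only [scale, Lim.val, if_true, Bool.false_eq_true, if_false]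
  ring

theorem X.exists_cost_le (e : X) : ∀ n l, e.Fits n l →
    ∃ C, ∀ p : Lims, 1 ≤ p.N → 1 ≤ p.L → e.cost p ≤ C * scale p n l := by
  induction e with
  | const c => intro n l _; exact exists_const_le _ n l
  | reg r => intro n l _; exact exists_const_le _ n l
  | lim K => intro n l _; exact exists_const_le _ n l
  | get a i ih => intro n l h; exact exists_add_le (ih n l h) (exists_const_le _ n l)
  | bin o e f ihe ihf =>
    intro n l h
    exact exists_add_le (ihe n l h.1) (exists_add_le (ihf n l h.2) (exists_const_le _ n l))
  | sum r K e ih =>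
    intro n l h
    refine exists_add_le ?_ (exists_const_le _ n l)
    cases K
    · obtain ⟨rfl, h2⟩ := h
      exact exists_mul_le_N (exists_add_le (exists_add_le (ih _ _ h2) (exists_const_le _ _ _))
        (exists_const_le _ _ _))
    · obtain ⟨rfl, h2⟩ := h
      exact exists_mul_le_L (exists_add_le (exists_add_le (ih _ _ h2) (exists_const_le _ _ _))
        (exists_const_le _ _ _))

/-- The constant depends on the command but not on the bounds `p`; so one program has one constant
for all `n`. -/
theorem Cmd.exists_cost_le (c : Cmd) : ∀ n l, c.Fits n l →
    ∃ C, ∀ p : Lims, 1 ≤ p.N → 1 ≤ p.L → c.cost p ≤ C * scale p n l := by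
  induction c with
  | skip => intro n l _; exact exists_const_le _ n l
  | set r e =>
    intro n l h
    exact exists_add_le (e.exists_cost_le n l h) (exists_const_le _ n l)
  | put a i e =>
    intro n l h
    exact exists_add_le (i.exists_cost_le n l h.1)
      (exists_add_le (e.exists_cost_le n l h.2) (exists_const_le _ n l))
  | seq c d ihc ihd => intro n l h; exact exists_add_le (ihc n l h.1) (ihd n l h.2)
  | ite e c d ihc ihd =>
    intro n l h
    exact exists_add_le (e.exists_cost_le n l h.1) (exists_add_le (exists_const_le _ n l)
      (exists_add_le (ihc n l h.2.1) (ihd n l h.2.2)))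
  | loop r K c ih =>
    intro n l h
    refine exists_add_le ?_ (exists_const_le _ n l)
    cases K
    · obtain ⟨rfl, h2⟩ := h
      exact exists_mul_le_N (exists_add_le (ih _ _ h2) (exists_const_le _ _ _))
    · obtain ⟨rfl, h2⟩ := h
      exact exists_mul_le_L (exists_add_le (ih _ _ h2) (exists_const_le _ _ _))

/-! ### Derived expressions and commands -/

instance : Add X := ⟨.bin .add⟩
instance : Sub X := ⟨.bin .sub⟩
instance : Mul X := ⟨.bin .mul⟩
instance : Div X := ⟨.bin .div⟩
instance (c : ℕ) : OfNat X c := ⟨.const c⟩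

variable (p : Lims) (σ : State) (n l : Bool) (e f : X)

section
@[simp] theorem X.eval_add : (e + f).eval p σ = e.eval p σ + f.eval p σ := (rfl)
@[simp] theorem X.eval_sub : (e - f).eval p σ = e.eval p σ - f.eval p σ := (rfl)
@[simp] theorem X.eval_mul : (e * f).eval p σ = e.eval p σ * f.eval p σ := (rfl)
@[simp] theorem X.eval_div : (e / f).eval p σ = e.eval p σ / f.eval p σ := (rfl)
@[simp] theorem X.eval_ofNat (c : ℕ) : (no_index (OfNat.ofNat c) : X).eval p σ = c := (rfl)
@[simp] theorem X.eval_const (c : ℕ) : (X.const c).eval p σ = c := (rfl)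
@[simp] theorem X.eval_reg (r : ℕ) : (X.reg r).eval p σ = σ.reg r := (rfl)
@[simp] theorem X.eval_lim (K : Lim) : (X.lim K).eval p σ = K.val p := (rfl)
@[simp] theorem X.eval_get (a : ℕ) : (X.get a e).eval p σ = σ.mem a (e.eval p σ) := (rfl)
@[simp] theorem X.eval_sum (r : ℕ) (K : Lim) : (X.sum r K e).eval p σ =
    ∑ i ∈ Finset.range (K.val p), e.eval p (setReg σ r i) := (rfl)
@[simp] theorem X.fits_add : (e + f).Fits n l ↔ e.Fits n l ∧ f.Fits n l := Iff.rfl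
@[simp] theorem X.fits_sub : (e - f).Fits n l ↔ e.Fits n l ∧ f.Fits n l := Iff.rfl
@[simp] theorem X.fits_mul : (e * f).Fits n l ↔ e.Fits n l ∧ f.Fits n l := Iff.rfl
@[simp] theorem X.fits_div : (e / f).Fits n l ↔ e.Fits n l ∧ f.Fits n l := Iff.rfl
@[simp] theorem X.fits_ofNat (c : ℕ) : (no_index (OfNat.ofNat c) : X).Fits n l := by
  cases n <;> cases l <;> trivial
@[simp] theorem X.fits_const (c : ℕ) : (X.const c).Fits n l := by
  cases n <;> cases l <;> trivial
@[simp] theorem X.fits_reg (r : ℕ) : (X.reg r).Fits n l := by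
  cases n <;> cases l <;> trivial
@[simp] theorem X.fits_lim (K : Lim) : (X.lim K).Fits n l := by
  cases n <;> cases l <;> trivial
@[simp] theorem X.fits_get (a : ℕ) : (X.get a e).Fits n l ↔ e.Fits n l := by
  cases n <;> cases l <;> rfl
@[simp] theorem X.fits_sum_N (r : ℕ) : (X.sum r .N e).Fits n l ↔ n = true ∧ e.Fits false l := by
  cases n <;> cases l <;> rfl
@[simp] theorem X.fits_sum_L (r : ℕ) : (X.sum r .L e).Fits n l ↔ l = true ∧ e.Fits n false := by
  cases n <;> cases l <;> rfl

@[simp] theorem setReg_reg (r v r' : ℕ) :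
    (setReg σ r v).reg r' = if r' = r then v else σ.reg r' := by
  simp [setReg, update_apply]

@[simp] theorem setReg_mem (r v : ℕ) : (setReg σ r v).mem = σ.mem := rfl

@[simp] theorem setMem_mem (a i v a' : ℕ) : (setMem σ a i v).mem a' =
    if a' = a then update (σ.mem a) i v else σ.mem a' := by
  simp [setMem, update_apply]

/-- `1` if `e < f` and `0` otherwise. -/
def X.lt (e f : X) : X := 1 - (1 - (f - e))

/-- `1` if `e = f` and `0` otherwise. -/
def X.eq (e f : X) : X := 1 - ((e - f) + (f - e))

/-- The remainder of `e` modulo `f`. -/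
def X.mod (e f : X) : X := e - e / f * f

@[simp] theorem X.eval_lt :
    (X.lt e f).eval p σ = if e.eval p σ < f.eval p σ then 1 else 0 := by
  simp only [X.lt, X.eval_sub, X.eval_ofNat]
  split_ifs <;> omega

@[simp] theorem X.eval_eq :
    (X.eq e f).eval p σ = if e.eval p σ = f.eval p σ then 1 else 0 := by
  simp only [X.eq, X.eval_sub, X.eval_add, X.eval_ofNat]
  split_ifs <;> omega

@[simp] theorem X.eval_mod : (X.mod e f).eval p σ = e.eval p σ % f.eval p σ := by
  simp only [X.mod, X.eval_sub, X.eval_mul, X.eval_div]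
  rw [Nat.mod_def, mul_comm]

@[simp] theorem X.fits_lt : (X.lt e f).Fits n l ↔ e.Fits n l ∧ f.Fits n l := by
  simp [X.lt, and_comm]

@[simp] theorem X.fits_eq : (X.eq e f).Fits n l ↔ e.Fits n l ∧ f.Fits n l := by
  simp [X.eq, and_comm]

@[simp] theorem X.fits_mod : (X.mod e f).Fits n l ↔ e.Fits n l ∧ f.Fits n l := by
  simp [X.mod]

def X.lsum : List X → X
  | [] => 0
  | e :: es => e + lsum es

def X.lprod : List X → X
  | [] => 1
  | e :: es => e * lprod es

@[simp] theorem X.eval_lsum (es : List X) :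
    (X.lsum es).eval p σ = (es.map fun e => e.eval p σ).sum := by
  induction es with
  | nil => rfl
  | cons e es ih => simp [X.lsum, ih]

@[simp] theorem X.eval_lprod (es : List X) :
    (X.lprod es).eval p σ = (es.map fun e => e.eval p σ).prod := by
  induction es with
  | nil => rfl
  | cons e es ih => simp [X.lprod, ih]

@[simp] theorem X.fits_lsum (es : List X) : (X.lsum es).Fits n l ↔ ∀ e ∈ es, e.Fits n l := by
  induction es with
  | nil => simp [X.lsum]
  | cons e es ih => simp [X.lsum, ih]

@[simp] theorem X.fits_lprod (es : List X) : (X.lprod es).Fits n l ↔ ∀ e ∈ es, e.Fits n l := by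
  induction es with
  | nil => simp [X.lprod]
  | cons e es ih => simp [X.lprod, ih]

/-- A sum of constant length. -/
def X.csum (c : ℕ) (f : ℕ → X) : X := X.lsum ((List.range c).map f)

@[simp] theorem X.eval_csum (c : ℕ) (f : ℕ → X) :
    (X.csum c f).eval p σ = ∑ i ∈ Finset.range c, (f i).eval p σ := by
  simp only [X.csum, X.eval_lsum, List.map_map]
  rfl

@[simp] theorem X.fits_csum (c : ℕ) (f : ℕ → X) :
    (X.csum c f).Fits n l ↔ ∀ i < c, (f i).Fits n l := by
  simp [X.csum]

/-- The power with a constant exponent. -/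
def X.pow (e : X) (c : ℕ) : X := X.lprod (List.replicate c e)

@[simp] theorem X.eval_pow (c : ℕ) : (X.pow e c).eval p σ = e.eval p σ ^ c := by
  simp [X.pow]

theorem X.fits_pow (c : ℕ) (h : e.Fits n l) : (X.pow e c).Fits n l := by
  simp only [X.pow, X.fits_lprod, List.mem_replicate]
  rintro _ ⟨_, rfl⟩
  exact h

/-- The value of the function `f` at `e`, for `e < M`. -/
def X.lookup (f : ℕ → ℕ) (M : ℕ) (e : X) : X := X.csum M fun i => .const (f i) * X.eq e (.const i)

theorem X.eval_lookup (f : ℕ → ℕ) (M : ℕ) (h : e.eval p σ < M) :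
    (X.lookup f M e).eval p σ = f (e.eval p σ) := by
  simp [X.lookup, h]

theorem X.fits_lookup (f : ℕ → ℕ) (M : ℕ) (h : e.Fits n l) : (X.lookup f M e).Fits n l := by
  simp [X.lookup, h]

/-- The determinant of the `r × r` Hankel matrix with the entries `f (i + j)`, modulo the value of
the register `q`. -/
noncomputable def X.hankel (q r : ℕ) (f : ℕ → X) : X :=
  X.lsum ((Finset.univ : Finset (Equiv.Perm (Fin r))).toList.map fun τ : Equiv.Perm (Fin r) =>
    -- Leibniz formula. Subtraction of natural numbers is truncated, so the sign `-1` is represented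
    -- by `q - 1`.
    (if Equiv.Perm.sign τ = 1 then 1 else .reg q - 1) *
      X.lprod ((List.finRange r).map fun i : Fin r => f ((τ i : ℕ) + (i : ℕ))))

theorem X.cast_eval_hankel (q r : ℕ) (f : ℕ → X) (hq : 1 ≤ σ.reg q) :
    ((X.hankel q r f).eval p σ : ZMod (σ.reg q)) =
      Matrix.det (Matrix.of fun i j : Fin r => (((f (i + j)).eval p σ : ℕ) : ZMod (σ.reg q))) := by
  rw [Matrix.det_apply, X.hankel, X.eval_lsum, List.map_map, Finset.sum_map_toList, Nat.cast_sum]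
  refine Finset.sum_congr rfl fun τ _ => ?_
  rw [comp_apply, X.eval_mul, Nat.cast_mul, X.eval_lprod, List.map_map, Nat.cast_list_prod,
    List.map_map]
  have h1 : ((List.finRange r).map ((Nat.cast : ℕ → ZMod (σ.reg q)) ∘ (fun e => X.eval p e σ) ∘
      fun i : Fin r => f ((τ i : ℕ) + (i : ℕ)))).prod =
      ∏ i : Fin r, (((f (τ i + i)).eval p σ : ℕ) : ZMod (σ.reg q)) := by
    rw [← List.prod_ofFn, List.ofFn_eq_map]
    rfl
  rw [h1]
  rcases Int.units_eq_one_or (Equiv.Perm.sign τ) with h | h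
  · simp [h]
  · have : (-1 : ℤˣ) ≠ 1 := by decide
    simp [h, this, Nat.cast_sub hq]

theorem X.fits_hankel (q r : ℕ) (f : ℕ → X) (h : ∀ i < 2 * r, (f i).Fits n l) :
    (X.hankel q r f).Fits n l := by
  simp only [X.hankel, X.fits_lsum, List.mem_map]
  rintro _ ⟨τ, _, rfl⟩
  rw [X.fits_mul, X.fits_lprod]
  constructor
  · split_ifs <;> simp
  · simp only [List.mem_map]
    rintro _ ⟨i, _, rfl⟩
    exact h _ (by have := i.2; have := (τ i).2; omega)

/-- The commands `f 0`, …, `f (c - 1)` in sequence. -/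
def Cmd.rep (c : ℕ) (f : ℕ → Cmd) : Cmd :=
  match c with
  | 0 => .skip
  | c + 1 => .seq (Cmd.rep c f) (f c)

theorem Cmd.run_rep (c : ℕ) (f : ℕ → Cmd) :
    (Cmd.rep c f).run p σ = iter (fun i => (f i).run p) σ c := by
  induction c with
  | zero => rfl
  | succ c ih => simp [Cmd.rep, Cmd.run, iter, ih]

@[simp] theorem Cmd.fits_rep (c : ℕ) (f : ℕ → Cmd) :
    (Cmd.rep c f).Fits n l ↔ ∀ i < c, (f i).Fits n l := by
  induction c with
  | zero => cases n <;> cases l <;> simp [Cmd.rep, Cmd.Fits]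
  | succ c ih =>
    simp only [Cmd.rep, Cmd.Fits, ih]
    constructor
    · rintro ⟨h1, h2⟩ i hi
      rcases Nat.lt_succ_iff_lt_or_eq.1 hi with h | rfl
      · exact h1 i h
      · exact h2
    · intro h
      exact ⟨fun i hi => h i (by omega), h c (by omega)⟩

/-- The command may write to the register `r`. -/
def Cmd.Sets (r : ℕ) : Cmd → Prop
  | .skip => False
  | .set r' _ => r = r'
  | .put _ _ _ => False
  | .seq c d => c.Sets r ∨ d.Sets r
  | .ite _ c d => c.Sets r ∨ d.Sets r
  | .loop r' _ c => r = r' ∨ c.Sets r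

/-- The command may write to the array `a`. -/
def Cmd.Puts (a : ℕ) : Cmd → Prop
  | .skip => False
  | .set _ _ => False
  | .put a' _ _ => a = a'
  | .seq c d => c.Puts a ∨ d.Puts a
  | .ite _ c d => c.Puts a ∨ d.Puts a
  | .loop _ _ c => c.Puts a

@[simp] theorem Cmd.sets_rep (r c : ℕ) (f : ℕ → Cmd) :
    (Cmd.rep c f).Sets r ↔ ∃ i < c, (f i).Sets r := by
  induction c with
  | zero => simp [Cmd.rep, Cmd.Sets]
  | succ c ih =>
    simp only [Cmd.rep, Cmd.Sets, ih, Nat.lt_succ_iff_lt_or_eq, or_and_right, exists_or,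
      exists_eq_left]

@[simp] theorem Cmd.puts_rep (a c : ℕ) (f : ℕ → Cmd) :
    (Cmd.rep c f).Puts a ↔ ∃ i < c, (f i).Puts a := by
  induction c with
  | zero => simp [Cmd.rep, Cmd.Puts]
  | succ c ih =>
    simp only [Cmd.rep, Cmd.Puts, ih, Nat.lt_succ_iff_lt_or_eq, or_and_right, exists_or,
      exists_eq_left]

end

/-- A syntactic frame rule: whether a register is preserved can be read off from the text of the
command. -/
theorem Cmd.run_reg {r : ℕ} (c : Cmd) (h : ¬ c.Sets r) : (c.run p σ).reg r = σ.reg r := by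
  induction c generalizing σ with
  | skip => rfl
  | set r' e => simp only [Cmd.Sets] at h; simp [Cmd.run, h]
  | put a i e => rfl
  | seq c d ihc ihd =>
    simp only [Cmd.Sets, not_or] at h
    simp only [Cmd.run]
    rw [ihd _ h.2, ihc _ h.1]
  | ite e c d ihc ihd =>
    simp only [Cmd.Sets, not_or] at h
    simp only [Cmd.run]
    split_ifs
    · exact ihc _ h.1
    · exact ihd _ h.2
  | loop r' K c ih =>
    simp only [Cmd.Sets, not_or] at h
    refine iter_induct (fun _ τ => τ.reg r = σ.reg r) (fun i _ τ hτ => ?_) rfl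
    rw [ih _ h.2, setReg_reg, if_neg h.1, hτ]

theorem Cmd.run_mem {a : ℕ} (c : Cmd) (h : ¬ c.Puts a) : (c.run p σ).mem a = σ.mem a := by
  induction c generalizing σ with
  | skip => rfl
  | set r' e => rfl
  | put a' i e => simp only [Cmd.Puts] at h; simp [Cmd.run, h]
  | seq c d ihc ihd =>
    simp only [Cmd.Puts, not_or] at h
    simp only [Cmd.run]
    rw [ihd _ h.2, ihc _ h.1]
  | ite e c d ihc ihd =>
    simp only [Cmd.Puts, not_or] at h
    simp only [Cmd.run]
    split_ifs
    · exact ihc _ h.1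
    · exact ihd _ h.2
  | loop r' K c ih =>
    simp only [Cmd.Puts] at h
    refine iter_induct (fun _ τ => τ.mem a = σ.mem a) (fun i _ τ hτ => ?_) rfl
    rw [ih _ h, setReg_mem, hτ]

/-! ### Programs with their loop bounds -/

/-- The bounds for strings of length `n`. -/
def limsOf (n : ℕ) : Lims := ⟨2 * n + 1, Nat.clog 2 (2 * n + 1), (2 * n + 1) * (2 * n + 1)⟩

theorem limsOf_good {n : ℕ} (hn : 1 ≤ n) : (limsOf n).Good := by
  refine ⟨Nat.le_mul_self _, ?_, ?_⟩
  · refine le_trans ?_ (Nat.le_mul_self _)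
    exact (Nat.clog_le_of_le_pow (Nat.lt_two_pow_self).le)
  · simp only [limsOf]; nlinarith

/-- The computation of the bounds for strings of length `n`, where `n` is the length of the first
input plus `k`. -/
def bounds (k : ℕ) : Prog :=
  .seq (.set 1 (.bin .add (.bin .mul (.const 2) (.bin .add (.reg 0) (.const k))) (.const 1))) <|
  .seq (.set 5 (.bin .mul (.reg 1) (.reg 1))) <|
  .seq (.set 3 (.const 0)) <|
  .seq (.set 7 (.const 1)) <|
  .loop (.reg 7) (.reg 1)
    (.seq (.set 7 (.bin .mul (.reg 7) (.const 2))) (.set 3 (.bin .add (.reg 3) (.const 1))))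

/-- The initial state of the language. -/
def start (xs : List (List Bool)) : State :=
  ⟨fun r => (State.init xs).reg (2 * r), (State.init xs).mem⟩

/-- Repeated doubling in the machine register `7` reaches `N` after exactly `L` rounds. The length
of a second input, which sits in the machine register `1`, is overwritten by `N`; this is harmless,
since the language sees only the even registers. -/
theorem runs_bounds (k : ℕ) (ρ : State) (hn : 1 ≤ ρ.reg 0 + k) (hk : k ≤ (ρ.reg 0 + k)):
    Runs (bounds k) ρ (100 * ((limsOf (ρ.reg 0 + k)).L + 1) * len (limsOf (ρ.reg 0 + k)).W)
      (Sim (limsOf (ρ.reg 0 + k)) ⟨fun r => ρ.reg (2 * r), ρ.mem⟩) := by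
  have hW := two_le_len (show 1 ≤ (limsOf (ρ.reg 0 + k)).W from by
    have := (limsOf_good hn).two_le; omega)
  set p := limsOf (ρ.reg 0 + k) with hp
  have hNW : p.N ≤ p.W := (limsOf_good hn).N_le
  have h2NW : 2 * p.N ≤ p.W := by simp only [hp, limsOf]; nlinarith
  have hLW : p.L ≤ p.N := Nat.clog_le_of_le_pow (Nat.lt_two_pow_self).le
  have hl : ∀ {x : ℕ}, x ≤ p.W → len x ≤ len p.W := len_mono
  have hNk : 2 * (ρ.reg 0 + k) + 1 = p.N := rfl
  have hN1 : 1 ≤ p.N := by omega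
  have l1 : len 1 = 2 := by simp [len]
  have l0 : len 0 = 1 := by simp [len]
  have l2 : len 2 ≤ len p.W := hl (by omega)
  refine Runs.mono (T := 20 * len p.W + (20 * len p.W + (20 * len p.W + (20 * len p.W +
    (p.L * (2 * len p.W + (3 * len p.W + 3 * len p.W)) + 2 * len p.W))))) ?_
    (by nlinarith) (fun _ h => h)
  refine Runs.seq (Q := fun τ => τ = ⟨update ρ.reg 1 p.N, ρ.mem⟩) (Runs.set ?_ rfl) ?_
  · simp only [Expr.cost, Expr.eval, Op.eval, hNk, l1]
    have a1 := hl (show ρ.reg 0 ≤ p.W by omega)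
    have a2 := hl (show k ≤ p.W by omega)
    have a3 := hl (show ρ.reg 0 + k ≤ p.W by omega)
    have a4 := hl (show 2 * (ρ.reg 0 + k) ≤ p.W by omega)
    have a5 := hl hNW
    omega
  rintro _ rfl
  refine Runs.seq (Q := fun τ => τ = ⟨update (update ρ.reg 1 p.N) 5 p.W, ρ.mem⟩) (Runs.set ?_ ?_) ?_
  · have a5 := hl hNW
    have : p.N * p.N = p.W := rfl
    simp only [Expr.cost, Expr.eval, Op.eval, update_self, this]
    omega
  · simp [Expr.eval, Op.eval, hp, limsOf]
  rintro _ rfl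
  refine Runs.seq (Q := fun τ => τ = ⟨update (update (update ρ.reg 1 p.N) 5 p.W) 3 0, ρ.mem⟩)
    (Runs.set ?_ rfl) ?_
  · simp only [Expr.cost, l0]; omega
  rintro _ rfl
  refine Runs.seq (Q := fun τ => τ = ⟨update (update (update (update ρ.reg 1 p.N) 5 p.W) 3 0) 7 1,
    ρ.mem⟩) (Runs.set ?_ rfl) ?_
  · simp only [Expr.cost, l1]; omega
  rintro _ rfl
  refine (Runs.loop (fun i τ => τ.mem = ρ.mem ∧ (∀ r, τ.reg (2 * r) = ρ.reg (2 * r)) ∧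
    τ.reg 1 = p.N ∧ τ.reg 5 = p.W ∧ τ.reg 3 = i ∧ τ.reg 7 = 2 ^ i) (K := p.L) ?_ ?_ ?_).mono le_rfl
    ?_
  · rintro i hi τ ⟨h1, h2, h3, h4, h5, h6⟩
    have hi2 : 2 ^ i < p.N := by
      by_contra hcon
      have := Nat.clog_le_of_le_pow (b := 2) (not_lt.1 hcon)
      exact absurd hi (not_lt.2 this)
    have a1 := hl (show 2 ^ i ≤ p.W by omega)
    have a2 := hl hNW
    refine ⟨by simpa [Expr.eval, h3, h6] using hi2, by simp only [Expr.cost, h3, h6]; omega, ?_⟩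
    refine Runs.seq (Q := fun τ => τ.mem = ρ.mem ∧ (∀ r, τ.reg (2 * r) = ρ.reg (2 * r)) ∧
      τ.reg 1 = p.N ∧ τ.reg 5 = p.W ∧ τ.reg 3 = i ∧ τ.reg 7 = 2 ^ (i + 1)) (Runs.set ?_ ?_) ?_
    · simp only [Expr.cost, Expr.eval, Op.eval, h6]
      have := hl (show 2 ^ i * 2 ≤ p.W by omega)
      omega
    · refine ⟨h1, fun r => ?_, ?_, ?_, ?_, ?_⟩
      · simpa [update_of_ne (show 2 * r ≠ 7 by omega)] using h2 r
      · simpa using h3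
      · simpa using h4
      · simpa using h5
      · simp [Expr.eval, Op.eval, h6, pow_succ]
    · rintro υ ⟨h1, h2, h3, h4, h5, h6⟩
      refine Runs.set ?_ ?_
      · simp only [Expr.cost, Expr.eval, Op.eval, h5, l1]
        have b1 := hl (show i ≤ p.W by omega)
        have b2 := hl (show i + 1 ≤ p.W by omega)
        omega
      · refine ⟨h1, fun r => ?_, ?_, ?_, ?_, ?_⟩
        · simpa [update_of_ne (show 2 * r ≠ 3 by omega)] using h2 r
        · simpa using h3
        · simpa using h4
        · simp [Expr.eval, Op.eval, h5]
        · simpa using h6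
  · rintro τ ⟨h1, h2, h3, h4, h5, h6⟩
    have hi2 : p.N ≤ 2 ^ p.L := Nat.le_pow_clog (by norm_num) _
    have hi3 : 2 ^ p.L ≤ p.W := by
      have : p.L ≤ Nat.clog 2 p.N := le_rfl
      have h7 : 2 ^ (p.L - 1) ≤ p.N := by
        rcases Nat.eq_zero_or_pos p.L with h | h
        · rw [h]; simpa using hN1
        · exact (Nat.pow_pred_clog_lt_self (b := 2) (by norm_num)
            (by omega : 1 < p.N)).le
      have : 2 ^ p.L ≤ 2 * 2 ^ (p.L - 1) := by
        rw [← pow_succ']; exact Nat.pow_le_pow_right (by norm_num) (by omega)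
      omega
    have a1 := hl hi3
    have a2 := hl hNW
    refine ⟨by simpa [Expr.eval, h3, h6] using hi2, by simp only [Expr.cost, h3, h6]; omega⟩
  · refine ⟨rfl, fun r => ?_, ?_, ?_, ?_, ?_⟩
    · simp only []
      rw [update_of_ne (by omega), update_of_ne (by omega), update_of_ne (by omega),
        update_of_ne (by omega)]
    · simp
    · simp
    · simp
    · simp
  · rintro τ ⟨h1, h2, h3, h4, h5, h6⟩
    exact ⟨h1, h2, h3, h5, h4⟩

/-- A command together with the computation of its bounds. -/
def Cmd.prog (k : ℕ) (c : Cmd) : Prog := .seq (bounds k) (c.comp 0)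

/-- Any command with at most one level of `N`-loops and one level of `L`-loops costs `O(N L log W)`,
including the computation of the bounds. Only the boundedness of the initial state is required of
the input. -/
theorem Cmd.exists_exec_prog (k : ℕ) (c : Cmd) (h : c.Fits true true) :
    ∃ C : ℕ, ∀ (xs : List (List Bool)) (n : ℕ), 1 ≤ n → (State.init xs).reg 0 + k = n →
      Bdd (limsOf n).W (start xs) → ∃ t ρ, Exec (c.prog k) (State.init xs) t ρ ∧
        t ≤ C * ((limsOf n).N * (limsOf n).L * len (limsOf n).W) ∧
        Sim (limsOf n) (c.run (limsOf n) (start xs)) ρ := by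
  obtain ⟨C, hC⟩ := c.exists_cost_le true true h
  refine ⟨200 + C, fun xs n hn hxs hb => ?_⟩
  have h1 := runs_bounds k (State.init xs) (by omega) (by omega)
  rw [hxs] at h1
  have hN1 : 1 ≤ (limsOf n).N := by simp [limsOf]
  have hL1 : 1 ≤ (limsOf n).L := Nat.clog_pos (by norm_num) (by omega)
  have h2 := hC (limsOf n) hN1 hL1
  obtain ⟨t, ρ, h3, h4, h5⟩ := h1.seq (d := c.comp 0)
    (R := fun τ => Sim (limsOf n) (c.run (limsOf n) (start xs)) τ) fun τ hτ =>
    (c.runs_comp (limsOf_good hn) 0 (start xs) τ hb hτ).mono le_rfl fun _ h => h.1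
  refine ⟨t, ρ, h3, h4.trans ?_, h5⟩
  rw [show scale (limsOf n) true true = (limsOf n).N * (limsOf n).L from rfl] at h2
  have h6 : 100 * ((limsOf n).L + 1) ≤ 200 * ((limsOf n).N * (limsOf n).L) := by nlinarith
  calc _ ≤ 200 * ((limsOf n).N * (limsOf n).L) * len (limsOf n).W +
        C * ((limsOf n).N * (limsOf n).L) * len (limsOf n).W :=
        Nat.add_le_add (Nat.mul_le_mul_right _ h6) (Nat.mul_le_mul_right _ h2)
    _ = _ := by ring

end BLoop

/-! ### Syndrome decoding by Hankel determinants -/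

namespace Hankel

open Finset

/-! ### Hankel determinants of power sums -/

variable {F : Type*} [Field F] [Fintype F] [DecidableEq F]

/-- The `j`-th syndrome of the error vector `e`, whose positions are the elements of `F`. -/
def syndrome (e : F → F) (j : ℕ) : F := ∑ z, e z * z ^ j

/-- The positions of the errors. -/
def errors (e : F → F) : Finset F := univ.filter fun z => e z ≠ 0

@[simp] theorem mem_errors (e : F → F) (z : F) : z ∈ errors e ↔ e z ≠ 0 := by
  rw [errors, Finset.mem_filter]
  simp

def hdet (S : ℕ → F) (r : ℕ) : F := Matrix.det (Matrix.of fun i j : Fin r => S (i + j))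

/-- The Hankel matrix factors as `Vᵀ D V`, where `V` is the Vandermonde matrix of the `r` distinct
error positions and `D` is the diagonal matrix of the nonzero error values. -/
theorem hdet_ne_zero (e : F → F) {r : ℕ} (h : (errors e).card = r) :
    hdet (syndrome e) r ≠ 0 := by
  let u : Fin r ≃ errors e := ((errors e).equivFin.trans (finCongr h)).symm
  let V : Matrix (Fin r) (Fin r) F := Matrix.vandermonde fun i => (u i : F)
  have hM : (Matrix.of fun i j : Fin r => syndrome e (i + j)) =
      V.transpose * Matrix.diagonal (fun i => e (u i)) * V := by
    ext i j
    rw [Matrix.mul_apply]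
    simp only [Matrix.mul_diagonal, Matrix.transpose_apply, Matrix.of_apply, syndrome, V,
      Matrix.vandermonde_apply]
    rw [u.sum_comp fun z : errors e => (z : F) ^ (i : ℕ) * e z * (z : F) ^ (j : ℕ)]
    rw [Finset.sum_coe_sort (errors e) fun z => z ^ (i : ℕ) * e z * z ^ (j : ℕ)]
    rw [errors, Finset.sum_filter]
    refine Finset.sum_congr rfl fun z _ => ?_
    by_cases hz : e z = 0
    · simp [hz]
    · simp only [hz, ne_eq, not_false_eq_true, if_true, pow_add]
      ring
  have hV : V.det ≠ 0 := Matrix.det_vandermonde_ne_zero_iff.2 fun i j hij =>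
    u.injective (Subtype.ext hij)
  rw [hdet, hM, Matrix.det_mul, Matrix.det_mul, Matrix.det_transpose, Matrix.det_diagonal]
  refine mul_ne_zero (mul_ne_zero hV (Finset.prod_ne_zero_iff.2 fun i _ => ?_)) hV
  exact (mem_errors e _).1 (u i).2

open Polynomial in
-- The error locator `P = ∏ (X - z)` has degree less than `r`, so its coefficients form a vector of
-- length `r`, nonzero as `P` is monic. The matrix kills it: row `i` gives `∑ e(z) z^i P(z)`, and in
-- each term `e(z)` or `P(z)` vanishes.
theorem hdet_eq_zero (e : F → F) {r : ℕ} (h : (errors e).card < r) :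
    hdet (syndrome e) r = 0 := by
  let P : F[X] := ∏ z ∈ errors e, (X - C z)
  have hP : P.Monic := monic_prod_of_monic _ _ fun z _ => monic_X_sub_C z
  have hdeg : P.natDegree = (errors e).card := by simp [P]
  rw [hdet, ← Matrix.exists_mulVec_eq_zero_iff]
  refine ⟨fun j => P.coeff j, fun h0 => ?_, ?_⟩
  · have := congrFun h0 ⟨P.natDegree, by omega⟩
    simp [hP.coeff_natDegree] at this
  · ext i
    simp only [Matrix.mulVec, dotProduct, Matrix.of_apply, syndrome, Pi.zero_apply,
      Finset.sum_mul]
    rw [Finset.sum_comm]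
    refine Finset.sum_eq_zero fun z _ => ?_
    have h1 : ∑ j : Fin r, e z * z ^ ((i : ℕ) + j) * P.coeff j = e z * z ^ (i : ℕ) * P.eval z := by
      rw [eval_eq_sum_range' (by omega : P.natDegree < r), Finset.mul_sum, Finset.sum_range]
      refine Finset.sum_congr rfl fun j _ => ?_
      rw [pow_add]; ring
    rw [h1]
    by_cases hz : e z = 0
    · simp [hz]
    · have : P.eval z = 0 := by
        rw [eval_prod]
        exact Finset.prod_eq_zero (i := z) (by simp [hz]) (by simp)
      simp [this]

/-- The error vector after the value `v` at the position `y` has been corrected. -/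
def correct (e : F → F) (y v : F) : F → F := fun z => if z = y then e z - v else e z

theorem syndrome_correct (e : F → F) (y v : F) (j : ℕ) :
    syndrome (correct e y v) j = syndrome e j - v * y ^ j := by
  have : ∀ z, correct e y v z * z ^ j = e z * z ^ j - if z = y then v * y ^ j else 0 := by
    intro z
    unfold correct
    split_ifs with h
    · subst h; ring
    · ring
  simp only [syndrome, this, Finset.sum_sub_distrib, Finset.sum_ite_eq', Finset.mem_univ, if_true]

/-- Subtracting `1` at a correct position makes `r + 1` errors, and at a wrong one it adds no new
error position. So positions can be tested before any error value is known. -/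
theorem hdet_eq_zero_iff_mem (e : F → F) {r : ℕ} (h : (errors e).card = r) (y : F) :
    hdet (syndrome (correct e y 1)) (r + 1) = 0 ↔ y ∈ errors e := by
  constructor
  · intro h0
    by_contra hy
    refine hdet_ne_zero (correct e y 1) (r := r + 1) ?_ h0
    have : errors (correct e y 1) = insert y (errors e) := by
      ext z
      by_cases hz : z = y
      · subst hz
        have : e z = 0 := by simpa using hy
        simp [correct, this]
      · simp [correct, hz]
    rw [this, Finset.card_insert_of_notMem hy, h]
  · intro hy
    apply hdet_eq_zero
    have : errors (correct e y 1) ⊆ errors e := by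
      intro z
      by_cases hz : z = y
      · subst hz; intro _; exact hy
      · simp [correct, hz]
    have := Finset.card_le_card this
    omega

theorem errors_correct (e : F → F) {y : F} (hy : y ∈ errors e) :
    errors (correct e y (e y)) = (errors e).erase y := by
  ext z
  by_cases hz : z = y
  · subst hz; simp [correct]
  · simp [correct, hz]

/-- At an error position, a wrong `v` leaves all `r` errors in place and the right one removes an
error. -/
theorem hdet_eq_zero_iff_eq (e : F → F) {r : ℕ} (h : (errors e).card = r) {y : F}
    (hy : y ∈ errors e) (v : F) :
    hdet (syndrome (correct e y v)) r = 0 ↔ v = e y := by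
  constructor
  · intro h0
    by_contra hv
    refine hdet_ne_zero (correct e y v) (r := r) ?_ h0
    have : errors (correct e y v) = errors e := by
      ext z
      by_cases hz : z = y
      · subst hz
        have h1 : z ∈ errors e := hy
        simp only [h1, iff_true]
        simpa [correct, sub_eq_zero] using fun h : e z = v => hv h.symm
      · simp [correct, hz]
    rw [this, h]
  · rintro rfl
    apply hdet_eq_zero
    rw [errors_correct e hy, Finset.card_erase_of_mem hy]
    have := Finset.card_pos.2 ⟨y, hy⟩
    omega

end Hankel

/-! ### Constant-size blocks: digit expansions and deletion-correcting colourings -/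

namespace Block

open Finset

/-! ### Digits -/

theorem digit_aux (b : ℕ) (f : ℕ → ℕ) (hf : ∀ i, f i < b) (M : ℕ) :
    ∑ i ∈ range M, b ^ i * f i < b ^ M := by
  induction M with
  | zero => simp
  | succ M ih =>
    rw [sum_range_succ, pow_succ]
    have := Nat.mul_le_mul_left (b ^ M) (Nat.succ_le_of_lt (hf M))
    rw [Nat.mul_succ] at this
    omega

theorem sum_digits_lt {b M : ℕ} (hb : 0 < b) {f : ℕ → ℕ} (hf : ∀ i < M, f i < b) :
    ∑ i ∈ range M, b ^ i * f i < b ^ M := by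
  have := digit_aux b (fun i => if i < M then f i else 0)
    (fun i => by split_ifs with h; exacts [hf i h, hb]) M
  refine lt_of_le_of_lt (le_of_eq (sum_congr rfl fun i hi => ?_)) this
  rw [if_pos (mem_range.1 hi)]

theorem sum_digits_div_mod {b M : ℕ} (hb : 0 < b) {f : ℕ → ℕ} (hf : ∀ i < M, f i < b) {i : ℕ}
    (hi : i < M) : (∑ j ∈ range M, b ^ j * f j) / b ^ i % b = f i := by
  induction M generalizing f i with
  | zero => omega
  | succ M ih =>
    rw [sum_range_succ']
    have h1 : ∑ k ∈ range M, b ^ (k + 1) * f (k + 1) = b * ∑ k ∈ range M, b ^ k * f (k + 1) := by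
      rw [mul_sum]; refine sum_congr rfl fun k _ => ?_; ring
    rw [h1, pow_zero, one_mul]
    cases i with
    | zero =>
      rw [pow_zero, Nat.div_one, Nat.mul_add_mod, Nat.mod_eq_of_lt (hf 0 (by omega))]
    | succ i =>
      rw [pow_succ', ← Nat.div_div_eq_div_mul, Nat.mul_add_div hb,
        Nat.div_eq_of_lt (hf 0 (by omega)), add_zero]
      exact ih (fun i hi => hf (i + 1) (by omega)) (by omega)

theorem sum_div_mod {b M c : ℕ} (hb : 0 < b) (hc : c < b ^ M) :
    ∑ j ∈ range M, b ^ j * (c / b ^ j % b) = c := by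
  induction M generalizing c with
  | zero => simp at hc; simp [hc]
  | succ M ih =>
    rw [sum_range_succ']
    have h1 : ∑ k ∈ range M, b ^ (k + 1) * (c / b ^ (k + 1) % b) =
        b * ∑ k ∈ range M, b ^ k * (c / b / b ^ k % b) := by
      rw [mul_sum]; refine sum_congr rfl fun k _ => ?_
      rw [pow_succ', ← Nat.div_div_eq_div_mul]; ring
    rw [h1, ih (by rw [Nat.div_lt_iff_lt_mul hb, ← pow_succ]; exact hc), pow_zero, one_mul,
      Nat.div_one]
    exact Nat.div_add_mod c b

/-! ### Superlists and sublists of given length -/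

/-- Look at the first symbol of the superlist `y` of `a :: z`. If it is `a`, the rest is a superlist
of `z` with as many additional symbols; otherwise the rest is a superlist of `a :: z` with one
additional symbol less. The bound satisfies the resulting recursion. -/
theorem card_superlists_le (z : List Bool) (r : ℕ) :
    {y : List Bool | y.length = z.length + r ∧ z.Sublist y}.Finite ∧
    {y : List Bool | y.length = z.length + r ∧ z.Sublist y}.ncard ≤ (z.length + 2) ^ r := by
  have hfin : ∀ (z : List Bool) r, {y : List Bool | y.length = z.length + r ∧ z.Sublist y}.Finite :=
    fun z r => (List.finite_length_eq Bool (z.length + r)).subset fun y hy => hy.1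
  refine ⟨hfin z r, ?_⟩
  induction z generalizing r with
  | nil =>
    simp only [List.length_nil, zero_add, List.nil_sublist, and_true]
    rw [← Nat.card_coe_set_eq]
    change Nat.card (List.Vector Bool r) ≤ _
    simp
  | cons a z ih =>
    induction r with
    | zero =>
      rw [pow_zero]
      refine (Set.ncard_le_one_iff (hfin (a :: z) 0)).2 fun {x y} hx hy => ?_
      rw [← hx.2.eq_of_length (by rw [hx.1]; rfl), ← hy.2.eq_of_length (by rw [hy.1]; rfl)]
    | succ r ihr =>
      have hsub : {y : List Bool | y.length = (a :: z).length + (r + 1) ∧ (a :: z).Sublist y} ⊆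
          (List.cons a '' {y | y.length = z.length + (r + 1) ∧ z.Sublist y}) ∪
          (List.cons (!a) '' {y | y.length = (a :: z).length + r ∧ (a :: z).Sublist y}) := by
        rintro y ⟨hy1, hy2⟩
        cases y with
        | nil => simp at hy2
        | cons c y =>
          simp only [List.length_cons] at hy1
          by_cases hc : c = a
          · subst hc
            left
            exact ⟨y, ⟨by omega, by simpa using hy2⟩, rfl⟩
          · right
            have hc' : c = !a := by cases a <;> cases c <;> simp_all
            refine ⟨y, ⟨by simp only [List.length_cons]; omega, ?_⟩, by rw [hc']⟩
            cases hy2 with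
            | cons _ h => exact h
            | cons_cons _ h => exact absurd rfl hc
      have h3 := Set.ncard_le_ncard hsub (((hfin z (r + 1)).image _).union ((hfin (a :: z) r).image _))
      refine h3.trans ((Set.ncard_union_le _ _).trans ?_)
      have h4 := (Set.ncard_image_le (f := List.cons a) (hfin z (r + 1))).trans (ih (r + 1))
      have h5 := (Set.ncard_image_le (f := List.cons (!a)) (hfin (a :: z) r)).trans ihr
      refine (Nat.add_le_add h4 h5).trans ?_
      simp only [List.length_cons]
      have h6 : (z.length + 2) ^ (r + 1) ≤ (z.length + 2) * (z.length + 1 + 2) ^ r := by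
        rw [pow_succ, mul_comm]
        exact Nat.mul_le_mul_left _ (Nat.pow_le_pow_left (by omega) r)
      calc _ ≤ (z.length + 2) * (z.length + 1 + 2) ^ r + (z.length + 1 + 2) ^ r :=
            Nat.add_le_add_right h6 _
        _ = _ := by ring

/-! ### Colours of blocks -/

/-- Greedy colouring: among `D + 1` colours, the neighbours of a new vertex block at most `D`. -/
theorem exists_coloring {α : Type*} [DecidableEq α] (V : Finset α) (R : α → α → Prop)
    [DecidableRel R] (hR : ∀ x y, R x y → R y x) (D : ℕ)
    (hD : ∀ x ∈ V, (V.filter (R x)).card ≤ D) :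
    ∃ φ : α → ℕ, (∀ x, φ x < D + 1) ∧ ∀ x ∈ V, ∀ y ∈ V, x ≠ y → R x y → φ x ≠ φ y := by
  suffices h : ∀ S ⊆ V, ∃ φ : α → ℕ, (∀ x, φ x < D + 1) ∧
      ∀ x ∈ S, ∀ y ∈ S, x ≠ y → R x y → φ x ≠ φ y from h V subset_rfl
  intro S
  induction S using Finset.induction_on with
  | empty => intro _; exact ⟨fun _ => 0, fun _ => Nat.succ_pos D, by simp⟩
  | insert v S hv ih =>
    intro hS
    obtain ⟨φ, h1, h2⟩ := ih ((subset_insert v S).trans hS)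
    have hcard : ((V.filter (R v)).image φ).card < (range (D + 1)).card := by
      rw [card_range]
      exact Nat.lt_succ_of_le (card_image_le.trans (hD v (hS (mem_insert_self v S))))
    obtain ⟨c, hc1, hc2⟩ := exists_mem_notMem_of_card_lt_card hcard
    have hc3 : ∀ y ∈ S, R v y → φ y ≠ c := by
      intro y hy hvy hyc
      exact hc2 (mem_image.2 ⟨y, mem_filter.2 ⟨hS (mem_insert_of_mem hy), hvy⟩, hyc⟩)
    refine ⟨Function.update φ v c, fun x => ?_, ?_⟩
    · by_cases hx : x = v
      · subst hx; simpa using hc1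
      · simpa [hx] using h1 x
    · intro x hx y hy hxy hRxy
      by_cases hxv : x = v
      · subst hxv
        have hyS : y ∈ S := (mem_insert.1 hy).resolve_left (Ne.symm hxy)
        rw [Function.update_self, Function.update_of_ne (Ne.symm hxy)]
        exact (hc3 y hyS hRxy).symm
      · have hxS : x ∈ S := (mem_insert.1 hx).resolve_left hxv
        rw [Function.update_of_ne hxv]
        by_cases hyv : y = v
        · subst hyv
          rw [Function.update_self]
          exact hc3 x hxS (hR _ _ hRxy)
        · rw [Function.update_of_ne hyv]
          exact h2 x hxS y ((mem_insert.1 hy).resolve_left hyv) hxy hRxy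

/-- The first `B` values of `u`, as bits. -/
def bitList (B : ℕ) (u : ℕ → ℕ) : List Bool := (List.range B).map fun t => decide (u t = 1)

@[simp] theorem length_bitList (B : ℕ) (u : ℕ → ℕ) : (bitList B u).length = B := by
  simp [bitList]

theorem bitList_congr {B : ℕ} {u v : ℕ → ℕ} (h : ∀ t < B, u t = v t) :
    bitList B u = bitList B v := by
  refine List.map_congr_left fun t ht => ?_
  rw [h t (List.mem_range.1 ht)]

/-- The binary digits of `c`. -/
def digits (c : ℕ) : ℕ → ℕ := fun t => c / 2 ^ t % 2

theorem digits_injOn (B : ℕ) : Set.InjOn (fun c => bitList B (digits c)) {c | c < 2 ^ B} := by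
  intro c hc c' hc' h
  have h1 : ∀ t < B, digits c t = digits c' t := by
    intro t ht
    have h2 := List.map_inj_left.1 h t (List.mem_range.2 ht)
    have h3 : digits c t = 1 ↔ digits c' t = 1 := by simpa using h2
    have h4 : digits c t < 2 := Nat.mod_lt _ (by norm_num)
    have h5 : digits c' t < 2 := Nat.mod_lt _ (by norm_num)
    omega
  rw [← sum_div_mod (b := 2) (by norm_num) hc, ← sum_div_mod (b := 2) (by norm_num) hc']
  exact sum_congr rfl fun t ht => congrArg _ (h1 t (mem_range.1 ht))

/-- The number of colours. -/
def colours (k B : ℕ) : ℕ := (B + 2) ^ (2 * k) + 1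

/-- There are a colouring `φ` of the blocks of length `B` and a function `ψ` such that `ψ` recovers
each block from its colour and any of its subsequences of length `B - k`. -/
theorem exists_tables {k B : ℕ} (hk : k ≤ B) : ∃ (φ : ℕ → ℕ) (ψ : ℕ → ℕ → ℕ),
    (∀ c, φ c < colours k B) ∧ ∀ c < 2 ^ B, ∀ w,
      (bitList (B - k) (digits w)).Sublist (bitList B (digits c)) → ψ (φ c) w = c := by
  classical
  -- Two blocks conflict if they can become equal after `k` deletions each. A block has at most `(B
  -- choose k) (B + 2)^k` conflicts: choose what survives, then a superlist of it.
  let R : ℕ → ℕ → Prop := fun c c' => ∃ z : List Bool, z.length = B - k ∧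
    z.Sublist (bitList B (digits c)) ∧ z.Sublist (bitList B (digits c'))
  have hD : ∀ c ∈ range (2 ^ B), ((range (2 ^ B)).filter (R c)).card ≤ (B + 2) ^ (2 * k) := by
    intro c _
    let S : List Bool → Finset ℕ := fun z =>
      (range (2 ^ B)).filter fun c' => z.Sublist (bitList B (digits c'))
    have hsub : (range (2 ^ B)).filter (R c) ⊆
        (List.sublistsLen (B - k) (bitList B (digits c))).toFinset.biUnion S := by
      intro c' hc'
      obtain ⟨h1, z, hz, h2, h3⟩ := mem_filter.1 hc'
      exact mem_biUnion.2 ⟨z, List.mem_toFinset.2 (List.mem_sublistsLen.2 ⟨h2, hz⟩),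
        mem_filter.2 ⟨h1, h3⟩⟩
    have hS : ∀ z ∈ (List.sublistsLen (B - k) (bitList B (digits c))).toFinset,
        (S z).card ≤ (B + 2) ^ k := by
      intro z hz
      obtain ⟨_, hz⟩ := List.mem_sublistsLen.1 (List.mem_toFinset.1 hz)
      obtain ⟨g1, g2⟩ := card_superlists_le z k
      rw [← Set.ncard_coe_finset]
      refine (Set.ncard_le_ncard_of_injOn (fun c => bitList B (digits c)) (fun c' hc' => ?_)
        (fun a ha b hb hab => ?_) g1).trans (g2.trans (Nat.pow_le_pow_left (by omega) k))
      · exact ⟨by rw [length_bitList, hz]; omega, (mem_filter.1 (mem_coe.1 hc')).2⟩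
      · exact digits_injOn B (mem_range.1 (mem_filter.1 (mem_coe.1 ha)).1)
          (mem_range.1 (mem_filter.1 (mem_coe.1 hb)).1) hab
    refine (card_le_card hsub).trans ((card_biUnion_le_card_mul _ _ _ hS).trans ?_)
    rw [two_mul, pow_add]
    refine Nat.mul_le_mul_right _ ((List.toFinset_card_le _).trans ?_)
    rw [List.length_sublistsLen, length_bitList, Nat.choose_symm hk]
    exact (Nat.choose_le_pow B k).trans (Nat.pow_le_pow_left (by omega) k)
  obtain ⟨φ, h1, h2⟩ := exists_coloring (range (2 ^ B)) R
    -- `ψ` picks any block of the given colour that contains the given subsequence. Two such blocks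
    -- would conflict, so there is only one.
    (fun x y ⟨z, hz, hx, hy⟩ => ⟨z, hz, hy, hx⟩) ((B + 2) ^ (2 * k)) hD
  refine ⟨φ, fun a w => if h : ∃ c < 2 ^ B, φ c = a ∧
    (bitList (B - k) (digits w)).Sublist (bitList B (digits c)) then h.choose else 0, h1, ?_⟩
  intro c hc w hw
  have h : ∃ c' < 2 ^ B, φ c' = φ c ∧
    (bitList (B - k) (digits w)).Sublist (bitList B (digits c')) := ⟨c, hc, rfl, hw⟩
  change dite (∃ c' < 2 ^ B, φ c' = φ c ∧
    (bitList (B - k) (digits w)).Sublist (bitList B (digits c'))) _ _ = c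
  rw [dif_pos h]
  obtain ⟨g1, g2, g3⟩ := h.choose_spec
  by_contra hne
  exact h2 _ (mem_range.2 g1) _ (mem_range.2 hc) hne ⟨_, by simp, g3, hw⟩ g2

end Block

/-! ### Segments of a string and their behaviour under deletions -/

namespace Split

open Finset

/-! ### Occurrences of a pattern and the segments between them -/

/-- The number whose binary digits are the `m` symbols of `x` from the position `i` on. -/
def code (m : ℕ) (x : ℕ → ℕ) (i : ℕ) : ℕ := ∑ t ∈ range m, 2 ^ t * x (i + t)

/-- The pattern with the code `P` occurs at the position `i` of the string `x` of length `n`. -/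
def Occ (m P n : ℕ) (x : ℕ → ℕ) (i : ℕ) : Prop := i + m ≤ n ∧ code m x i = P

instance (m P n : ℕ) (x : ℕ → ℕ) (i : ℕ) : Decidable (Occ m P n x i) := by
  unfold Occ; infer_instance

/-- The number of occurrences before the position `i`: the index of the segment of `i`. -/
def lab (m P n : ℕ) (x : ℕ → ℕ) (i : ℕ) : ℕ := ∑ t ∈ range i, if Occ m P n x t then 1 else 0

def segLen (m P n : ℕ) (x : ℕ → ℕ) (j : ℕ) : ℕ :=
  ∑ i ∈ range n, if lab m P n x i = j then 1 else 0

def segStart (m P n : ℕ) (x : ℕ → ℕ) (j : ℕ) : ℕ := ∑ i ∈ range j, segLen m P n x i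

/-- The segment `j`, followed by zeros. -/
def seg (m P n : ℕ) (x : ℕ → ℕ) (j t : ℕ) : ℕ :=
  if t < segLen m P n x j then x (segStart m P n x j + t) else 0

section
variable (m P n : ℕ) (x : ℕ → ℕ)

theorem lab_succ (i : ℕ) :
    lab m P n x (i + 1) = lab m P n x i + if Occ m P n x i then 1 else 0 :=
  sum_range_succ _ _

theorem lab_mono : Monotone (lab m P n x) :=
  monotone_nat_of_le_succ fun i => by rw [lab_succ]; omega

theorem lab_le (i : ℕ) : lab m P n x i ≤ i := by
  induction i with
  | zero => simp [lab]
  | succ i ih => rw [lab_succ]; split_ifs <;> omega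

theorem segStart_eq (j : ℕ) :
    segStart m P n x j = ((range n).filter fun i => lab m P n x i < j).card := by
  simp only [segStart, segLen]
  rw [sum_comm, card_filter]
  refine sum_congr rfl fun i _ => ?_
  rw [sum_ite_eq]
  simp

theorem segStart_le (j : ℕ) : segStart m P n x j ≤ n := by
  rw [segStart_eq]
  exact (card_filter_le _ _).trans (by simp)

theorem segStart_succ (j : ℕ) :
    segStart m P n x (j + 1) = segStart m P n x j + segLen m P n x j := sum_range_succ _ _

theorem lt_segStart_iff {i : ℕ} (hi : i < n) (j : ℕ) :
    i < segStart m P n x j ↔ lab m P n x i < j := by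
  rw [segStart_eq]
  constructor
  · intro h
    by_contra hlab
    have : ((range n).filter fun i => lab m P n x i < j) ⊆ range i := by
      intro t ht
      rw [mem_filter] at ht
      rw [mem_range]
      by_contra hti
      have := lab_mono m P n x (not_lt.1 hti)
      omega
    have := card_le_card this
    rw [card_range] at this
    omega
  · intro h
    have : range (i + 1) ⊆ (range n).filter fun i => lab m P n x i < j := by
      intro t ht
      rw [mem_range] at ht
      rw [mem_filter, mem_range]
      have := lab_mono m P n x (Nat.lt_succ_iff.1 ht)
      exact ⟨by omega, by omega⟩
    have := card_le_card this
    rw [card_range] at this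
    omega

theorem lab_eq_iff {i : ℕ} (hi : i < n) (j : ℕ) :
    lab m P n x i = j ↔ segStart m P n x j ≤ i ∧ i < segStart m P n x (j + 1) := by
  have h1 := lt_segStart_iff m P n x hi j
  have h2 := lt_segStart_iff m P n x hi (j + 1)
  omega

theorem segLen_eq_zero {j : ℕ} (hj : n ≤ j) : segLen m P n x j = 0 := by
  refine sum_eq_zero fun i hi => ?_
  rw [mem_range] at hi
  have := lab_le m P n x i
  rw [if_neg (by omega)]

/-- An occurrence that starts at `t` makes `t + 1` the start of a new segment. If the segment had
more than `d` symbols, the occurrence within its first `d` symbols would split it; `1 ≤ m` keeps `t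
+ 1` inside. -/
theorem segLen_le {d : ℕ} (hm : 1 ≤ m)
    (hd : ∀ i, i + d ≤ n → ∃ t, i ≤ t ∧ t + m ≤ i + d ∧ Occ m P n x t) (j : ℕ) :
    segLen m P n x j ≤ d := by
  by_contra hcon
  have h1 := segStart_succ m P n x j
  have h2 := segStart_le m P n x (j + 1)
  obtain ⟨t, ht1, ht2, ht3⟩ := hd (segStart m P n x j) (by omega)
  have h3 := lab_succ m P n x t
  rw [if_pos ht3] at h3
  have h4 : lab m P n x (t + 1) = j := (lab_eq_iff m P n x (by omega) j).2 ⟨by omega, by omega⟩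
  have h5 : lab m P n x t = j := (lab_eq_iff m P n x (by omega) j).2 ⟨by omega, by omega⟩
  omega

/-- The index of the segment of `i` can be computed from the positions of the segments. -/
theorem lab_succ_eq {i : ℕ} (hi : i + 1 < n) : lab m P n x (i + 1) =
    lab m P n x i + if i + 1 = segStart m P n x (lab m P n x i + 1) then 1 else 0 := by
  have h1 := (lab_eq_iff m P n x (by omega : i < n) _).1 rfl
  have h2 := lab_succ m P n x i
  have h3 := lt_segStart_iff m P n x hi (lab m P n x i + 1)
  split_ifs at h2 ⊢ <;> omega

end

/-! ### Deletions -/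

/-- `f` embeds the string `x'` of length `n'` into the string `x` of length `n`. -/
structure Emb (n n' : ℕ) (x x' f : ℕ → ℕ) : Prop where
  lt : ∀ i < n', f i < n
  mono : ∀ i j, i < j → j < n' → f i < f j
  val : ∀ i < n', x' i = x (f i)

/-- The deleted positions. -/
def del (n n' : ℕ) (f : ℕ → ℕ) : Finset ℕ := range n \ (range n').image f

/-- No occurrence of the pattern is destroyed and none is created. -/
structure Clean (m P n n' : ℕ) (x x' f : ℕ → ℕ) : Prop where
  kept : ∀ i, Occ m P n x i → ∀ d ∈ del n n' f, ¬ (i ≤ d ∧ d < i + m)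
  old : ∀ i, Occ m P n' x' i → f (i + (m - 1)) = f i + (m - 1)

section
variable {m P n n' : ℕ} {x x' f : ℕ → ℕ}

theorem Emb.injOn (h : Emb n n' x x' f) : Set.InjOn f (range n') := by
  intro i hi j hj hij
  rw [mem_coe, mem_range] at hi hj
  rcases lt_trichotomy i j with hlt | rfl | hlt
  · have := h.mono i j hlt hj; omega
  · rfl
  · have := h.mono j i hlt hi; omega

theorem Emb.card_del (h : Emb n n' x x' f) : (del n n' f).card = n - n' := by
  rw [del, card_sdiff_of_subset, card_image_of_injOn h.injOn, card_range, card_range]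
  intro y hy
  obtain ⟨i, hi, rfl⟩ := mem_image.1 hy
  exact mem_range.2 (h.lt i (mem_range.1 hi))

theorem Emb.grow (h : Emb n n' x x' f) (i : ℕ) : ∀ o, i + o < n' → f i + o ≤ f (i + o) := by
  intro o
  induction o with
  | zero => intro _; simp
  | succ o ih =>
    intro ho
    have := ih (by omega)
    have := h.mono (i + o) (i + (o + 1)) (by omega) ho
    omega

theorem Emb.mono_iff (h : Emb n n' x x' f) {i j : ℕ} (hi : i < n') (hj : j < n') :
    f i < f j ↔ i < j := by
  constructor
  · intro hf
    by_contra hij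
    rcases Nat.eq_or_lt_of_le (not_lt.1 hij) with rfl | hlt
    · omega
    · have := h.mono j i hlt hi; omega
  · intro hij; exact h.mono i j hij hj

theorem Emb.exists_of_notMem_del {d : ℕ} (hd : d < n) (h : d ∉ del n n' f) : ∃ i < n', f i = d := by
  rw [del, mem_sdiff, not_and_not_right] at h
  obtain ⟨i, hi, rfl⟩ := mem_image.1 (h (mem_range.2 hd))
  exact ⟨i, mem_range.1 hi, rfl⟩

/-- For a clean pattern, `f` is a bijection from the occurrences in `x'` before `i` to those in `x`
before `f i`: an old occurrence is contiguous in `x`, and a kept one survives as a contiguous block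
of `x'`. -/
theorem Clean.lab_eq (h : Emb n n' x x' f) (hc : Clean m P n n' x x' f) (hm : 1 ≤ m) {i : ℕ}
    (hi : i < n') : lab m P n' x' i = lab m P n x (f i) := by
  have hocc : ∀ t, Occ m P n' x' t → Occ m P n x (f t) := by
    intro t ht
    have h1 := hc.old t ht
    have hlen := ht.1
    have h2 : ∀ o < m, f (t + o) = f t + o := by
      intro o ho
      have h3 := h.grow t o (by omega)
      have h4 := h.grow (t + o) (m - 1 - o) (by omega)
      rw [show t + o + (m - 1 - o) = t + (m - 1) by omega] at h4
      omega
    refine ⟨?_, ?_⟩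
    · have := h.lt (t + (m - 1)) (by omega)
      omega
    · rw [← ht.2]
      refine sum_congr rfl fun o ho => ?_
      rw [mem_range] at ho
      rw [h.val (t + o) (by omega), h2 o ho]
  simp only [lab]
  rw [← card_filter, ← card_filter]
  refine card_bij (fun t _ => f t) ?_ ?_ ?_
  · intro t ht
    rw [mem_filter, mem_range] at ht ⊢
    exact ⟨h.mono t i ht.1 hi, hocc t ht.2⟩
  · intro a ha b hb hab
    rw [mem_filter, mem_range] at ha hb
    exact h.injOn (mem_coe.2 (mem_range.2 (by omega))) (mem_coe.2 (mem_range.2 (by omega))) hab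
  · intro t ht
    rw [mem_filter, mem_range] at ht
    have hlen := ht.2.1
    have hnd : ∀ o < m, t + o ∉ del n n' f := fun o ho hd =>
      hc.kept t ht.2 _ hd ⟨by omega, by omega⟩
    obtain ⟨a, ha, hfa⟩ := Emb.exists_of_notMem_del (by omega) (hnd 0 (by omega))
    rw [add_zero] at hfa
    -- No position of the occurrence is deleted, so consecutive symbols of `x` come from consecutive
    -- symbols of `x'`.
    have hrun : ∀ o < m, a + o < n' ∧ f (a + o) = t + o := by
      intro o
      induction o with
      | zero => intro _; exact ⟨ha, hfa⟩
      | succ o ih =>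
        intro ho
        obtain ⟨h1, h2⟩ := ih (by omega)
        obtain ⟨b, hb, hfb⟩ := Emb.exists_of_notMem_del (by omega) (hnd (o + 1) ho)
        have h3 : a + o < b := (h.mono_iff h1 hb).1 (by omega)
        have h4 := h.mono (a + o) (a + (o + 1)) (by omega) (by omega)
        have h5 : ¬ b > a + (o + 1) := by
          intro hgt
          have := h.mono _ _ hgt hb
          omega
        have h6 : b = a + (o + 1) := by omega
        rw [← h6]
        exact ⟨hb, hfb⟩
    refine ⟨a, ?_, hfa⟩
    rw [mem_filter, mem_range]
    refine ⟨(h.mono_iff ha hi).1 (by omega), ?_, ?_⟩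
    · have := (hrun (m - 1) (by omega)).1
      omega
    · rw [← ht.2.2]
      refine sum_congr rfl fun o ho => ?_
      rw [mem_range] at ho
      rw [h.val (a + o) (hrun o ho).1, (hrun o ho).2]

open Classical in
/-- At most `2 m` patterns are affected by each deletion. -/
theorem card_not_clean_le (h : Emb n n' x x' f) (hm : 1 ≤ m) (V : Finset ℕ) :
    (V.filter fun P => ¬ Clean m P n n' x x' f).card ≤ 2 * m * (del n n' f).card := by
  -- The number of symbols that survive before the position `d`. A deletion at `d` destroys only
  -- occurrences starting at `d - o` in `x`, and creates only occurrences in `x'` that straddle the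
  -- gap, starting at `r d - 1 - o`, with `o < m` in both cases.
  let r : ℕ → ℕ := fun d => ((range n').filter fun j => f j < d).card
  have hsub : (V.filter fun P => ¬ Clean m P n n' x x' f) ⊆
      ((del n n' f ×ˢ range m).image fun p => code m x (p.1 - p.2)) ∪
      ((del n n' f ×ˢ range m).image fun p => code m x' (r p.1 - 1 - p.2)) := by
    intro P hP
    have hnc := (mem_filter.1 hP).2
    rw [mem_union]
    by_contra hcon
    rw [not_or] at hcon
    refine hnc ⟨fun i hi d hd hid => hcon.1 ?_, fun i hi => ?_⟩
    · refine mem_image.2 ⟨(d, d - i), mem_product.2 ⟨hd, mem_range.2 (by omega)⟩, ?_⟩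
      simp only
      rw [show d - (d - i) = i by omega]
      exact hi.2
    · have hlen := hi.1
      by_contra hne
      -- A new occurrence is not contiguous in `x`. The position just behind the last symbol before
      -- the gap is deleted and serves as `d`.
      have hgap : ∃ t < m - 1, f (i + t) + 1 < f (i + t + 1) := by
        by_contra hno
        push Not at hno
        have : ∀ t ≤ m - 1, f (i + t) ≤ f i + t := by
          intro t
          induction t with
          | zero => intro _; simp
          | succ t ih =>
            intro ht
            have := ih (by omega)
            have := hno t (by omega)
            rw [← add_assoc]
            omega
        have h1 := this (m - 1) le_rfl
        have h2 := h.grow i (m - 1) (by omega)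
        omega
      obtain ⟨t, ht, hgap⟩ := hgap
      refine hcon.2 (mem_image.2 ⟨(f (i + t) + 1, t), mem_product.2 ⟨?_, mem_range.2 (by omega)⟩, ?_⟩)
      · rw [del, mem_sdiff, mem_range]
        refine ⟨?_, ?_⟩
        · have := h.lt (i + t + 1) (by omega)
          omega
        · intro hmem
          obtain ⟨b, hb, hfb⟩ := mem_image.1 hmem
          rw [mem_range] at hb
          have h1 : i + t < b := (h.mono_iff (by omega) hb).1 (by omega)
          have h2 : b < i + t + 1 := (h.mono_iff hb (by omega)).1 (by omega)
          omega
      · have hr : r (f (i + t) + 1) = i + t + 1 := by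
          have : ((range n').filter fun j => f j < f (i + t) + 1) = range (i + t + 1) := by
            ext j
            rw [mem_filter, mem_range, mem_range]
            constructor
            · rintro ⟨hj, hfj⟩
              have : j < i + t + 1 := (h.mono_iff hj (by omega)).1 (by omega)
              exact this
            · intro hj
              refine ⟨by omega, ?_⟩
              rcases Nat.lt_succ_iff_lt_or_eq.1 hj with hlt | rfl
              · have := h.mono j (i + t) hlt (by omega)
                omega
              · omega
          simp only [r, this, card_range]
        simp only
        rw [hr, show i + t + 1 - 1 - t = i by omega]
        exact hi.2
  refine (card_le_card hsub).trans ((card_union_le _ _).trans ?_)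
  have h1 : ∀ g : ℕ × ℕ → ℕ, ((del n n' f ×ˢ range m).image g).card ≤ (del n n' f).card * m := by
    intro g
    refine card_image_le.trans ?_
    rw [card_product, card_range]
  refine (Nat.add_le_add (h1 _) (h1 _)).trans (le_of_eq ?_)
  ring

/-- The number of deletions in the segment `j`. -/
def loss (m P n n' : ℕ) (x f : ℕ → ℕ) (j : ℕ) : ℕ :=
  ((del n n' f).filter fun d => lab m P n x d = j).card

theorem Clean.segLen_eq (h : Emb n n' x x' f) (hc : Clean m P n n' x x' f) (hm : 1 ≤ m) (j : ℕ) :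
    segLen m P n x j = segLen m P n' x' j + loss m P n n' x f j := by
  simp only [segLen]
  rw [← card_filter, ← card_filter, loss]
  have h1 : (range n).filter (fun i => lab m P n x i = j) =
      (((range n').filter fun i => lab m P n' x' i = j).image f) ∪
        ((del n n' f).filter fun d => lab m P n x d = j) := by
    ext d
    rw [mem_union, mem_filter, mem_filter, mem_image, mem_range]
    constructor
    · rintro ⟨hd, hl⟩
      by_cases hdel : d ∈ del n n' f
      · exact Or.inr ⟨hdel, hl⟩
      · obtain ⟨i, hi, rfl⟩ := Emb.exists_of_notMem_del hd hdel
        exact Or.inl ⟨i, mem_filter.2 ⟨mem_range.2 hi, by rw [hc.lab_eq h hm hi, hl]⟩, rfl⟩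
    · rintro (⟨i, hi, rfl⟩ | ⟨hdel, hl⟩)
      · rw [mem_filter, mem_range] at hi
        exact ⟨h.lt i hi.1, by rw [← hc.lab_eq h hm hi.1, hi.2]⟩
      · exact ⟨mem_range.1 (mem_sdiff.1 hdel).1, hl⟩
  rw [h1, card_union_of_disjoint, card_image_of_injOn]
  · exact h.injOn.mono (by intro a ha; exact mem_coe.2 (mem_filter.1 (mem_coe.1 ha)).1)
  · rw [disjoint_left]
    intro d hd hd'
    obtain ⟨i, hi, rfl⟩ := mem_image.1 hd
    exact (mem_sdiff.1 (mem_filter.1 hd').1).2 (mem_image_of_mem f (mem_filter.1 hi).1)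

theorem loss_le (j : ℕ) : loss m P n n' x f j ≤ (del n n' f).card := card_filter_le _ _

/-- Inside a segment, a symbol moves only by the number of deletions in front of it in the same
segment. The lower bound comes from the first symbol of the segment, the upper one from its last. -/
theorem Clean.bounds (h : Emb n n' x x' f) (hc : Clean m P n n' x x' f) (hm : 1 ≤ m) {j t : ℕ}
    (ht : t < segLen m P n' x' j) :
    segStart m P n x j + t ≤ f (segStart m P n' x' j + t) ∧
      f (segStart m P n' x' j + t) ≤ segStart m P n x j + t + loss m P n n' x f j := by
  have h1 := segStart_succ m P n' x' j
  have h2 := segStart_le m P n' x' (j + 1)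
  have h3 := segStart_succ m P n x j
  have h4 := hc.segLen_eq h hm j
  have hmem : ∀ u, u < segLen m P n' x' j → segStart m P n x j ≤ f (segStart m P n' x' j + u) ∧
      f (segStart m P n' x' j + u) < segStart m P n x (j + 1) := by
    intro u hu
    have hlt : segStart m P n' x' j + u < n' := by omega
    rw [← lab_eq_iff m P n x (h.lt _ hlt), ← hc.lab_eq h hm hlt]
    exact (lab_eq_iff m P n' x' hlt j).2 ⟨by omega, by omega⟩
  have h5 := (hmem 0 (by omega)).1
  have h6 := h.grow (segStart m P n' x' j) t (by omega)
  have h7 := (hmem (segLen m P n' x' j - 1) (by omega)).2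
  have h8 := h.grow (segStart m P n' x' j + t) (segLen m P n' x' j - 1 - t) (by omega)
  rw [show segStart m P n' x' j + t + (segLen m P n' x' j - 1 - t) =
    segStart m P n' x' j + (segLen m P n' x' j - 1) by omega] at h8
  rw [add_zero] at h5
  omega

theorem Clean.seg_eq_of_loss (h : Emb n n' x x' f) (hc : Clean m P n n' x x' f) (hm : 1 ≤ m)
    {j : ℕ} (hj : loss m P n n' x f j = 0) :
    segLen m P n' x' j = segLen m P n x j ∧ ∀ t, seg m P n' x' j t = seg m P n x j t := by
  have h1 := hc.segLen_eq h hm j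
  refine ⟨by omega, fun t => ?_⟩
  unfold seg
  rw [h1, hj, add_zero]
  split_ifs with ht
  · have h2 := hc.bounds h hm ht
    have h3 := segStart_succ m P n' x' j
    have h4 := segStart_le m P n' x' (j + 1)
    rw [h.val _ (by omega)]
    congr 1
    omega
  · rfl

theorem sublist_bitList {a b : ℕ} {u v : ℕ → ℕ} (g : ℕ → ℕ) (hg : ∀ i j, i < j → j < a → g i < g j)
    (hb : ∀ i < a, g i < b) (huv : ∀ i < a, u i = v (g i)) :
    (Block.bitList a u).Sublist (Block.bitList b v) := by
  rw [List.sublist_iff_exists_fin_orderEmbedding_get_eq]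
  have hl : ∀ c w, (Block.bitList c w).length = c := Block.length_bitList
  have ha : ∀ i : Fin (Block.bitList a u).length, (i : ℕ) < a := fun i =>
    lt_of_lt_of_eq i.2 (hl a u)
  refine ⟨OrderEmbedding.ofStrictMono (fun i => ⟨g i, lt_of_lt_of_eq (hb i (ha i)) (hl b v).symm⟩)
    (fun i j hij => hg i j hij (ha j)), fun i => ?_⟩
  have hget : ∀ c w l (hc : l < (Block.bitList c w).length),
      (Block.bitList c w)[l] = decide (w l = 1) := by
    intro c w l hc
    simp [Block.bitList]
  refine (hget a u i i.2).trans (Eq.trans ?_ (hget b v (g i) _).symm)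
  rw [huv i (ha i)]

/-- A window of a segment of `x'` is a subsequence of the block of the corresponding segment of `x`
at the same position. -/
theorem Clean.sublist_block (h : Emb n n' x x' f) (hc : Clean m P n n' x x' f) (hm : 1 ≤ m)
    {k B : ℕ} (hk : n - n' ≤ k) (hB : k ≤ B) (j o : ℕ) :
    (Block.bitList (B - k) fun t => seg m P n' x' j (o + t)).Sublist
      (Block.bitList B fun t => seg m P n x j (o + t)) := by
  have hlen := hc.segLen_eq h hm j
  have hloss := (loss_le (m := m) (P := P) (x := x) (n := n) (n' := n') (f := f) j).trans
    (h.card_del.le.trans hk)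
  -- `g` is the embedding in terms of offsets in the segment. Behind the end of the segment it
  -- shifts by the full loss, so that the padding zeros of `x'` are matched with padding zeros of
  -- `x`.
  let g : ℕ → ℕ := fun t => if t < segLen m P n' x' j then
    f (segStart m P n' x' j + t) - segStart m P n x j else t + loss m P n n' x f j
  have h3 := segStart_succ m P n' x' j
  have h4 := segStart_le m P n' x' (j + 1)
  have hg : ∀ t, t ≤ g t ∧ g t ≤ t + loss m P n n' x f j := by
    intro t
    simp only [g]
    split_ifs with ht
    · have := hc.bounds h hm ht
      omega
    · omega
  have hmono : ∀ s t, s < t → g s < g t := by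
    intro s t hst
    by_cases ht : t < segLen m P n' x' j
    · have hs : s < segLen m P n' x' j := by omega
      have h1 := hc.bounds h hm ht
      have h2 := hc.bounds h hm hs
      have h5 := h.mono (segStart m P n' x' j + s) (segStart m P n' x' j + t) (by omega) (by omega)
      simp only [g, if_pos ht, if_pos hs]
      omega
    · have h1 := (hg s).2
      have h2 : g t = t + loss m P n n' x f j := by simp only [g, if_neg ht]
      omega
  have hval : ∀ t, seg m P n' x' j t = seg m P n x j (g t) := by
    intro t
    simp only [seg, g]
    by_cases ht : t < segLen m P n' x' j
    · have h1 := hc.bounds h hm ht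
      rw [if_pos ht, if_pos ht, if_pos (by omega), h.val _ (by omega)]
      congr 1
      omega
    · rw [if_neg ht, if_neg ht, if_neg (by omega)]
  refine sublist_bitList (fun t => g (o + t) - o) ?_ ?_ ?_
  · intro s t hst _
    have h1 := hmono (o + s) (o + t) (by omega)
    have h2 := (hg (o + s)).1
    have h5 := (hg (o + t)).1
    omega
  · intro t ht
    have := (hg (o + t)).2
    omega
  · intro t _
    have h1 := (hg (o + t)).1
    rw [hval, show o + (g (o + t) - o) = g (o + t) by omega]

/-- Each deletion lies in one segment only. -/
theorem card_loss_ne_zero_le (h : Emb n n' x x' f) (V : Finset ℕ) :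
    (V.filter fun j => loss m P n n' x f j ≠ 0).card ≤ n - n' := by
  rw [← h.card_del]
  refine (card_le_card (fun j hj => ?_)).trans
    (card_image_le (s := del n n' f) (f := lab m P n x))
  obtain ⟨d, hd⟩ := card_pos.1 (Nat.pos_of_ne_zero (mem_filter.1 hj).2)
  rw [mem_filter] at hd
  exact mem_image.2 ⟨d, hd.1, hd.2⟩

end

/-- The symbols of a string, followed by zeros. -/
def bits (s : List Bool) (i : ℕ) : ℕ := (s.getD i false).toNat

theorem bits_lt_two (s : List Bool) (i : ℕ) : bits s i < 2 := by
  unfold bits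
  cases s.getD i false <;> simp

theorem exists_emb {s s' : List Bool} (h : s'.Sublist s) :
    ∃ f, Emb s.length s'.length (bits s) (bits s') f := by
  obtain ⟨f, hf⟩ := List.sublist_iff_exists_fin_orderEmbedding_get_eq.1 h
  refine ⟨fun i => if hi : i < s'.length then f ⟨i, hi⟩ else 0, ?_, ?_, ?_⟩
  · intro i hi
    rw [dif_pos hi]
    exact (f ⟨i, hi⟩).2
  · intro i j hij hj
    rw [dif_pos hj, dif_pos (hij.trans hj)]
    exact f.strictMono (show (⟨i, hij.trans hj⟩ : Fin s'.length) < ⟨j, hj⟩ from hij)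
  · intro i hi
    have h1 := hf ⟨i, hi⟩
    simp only [List.get_eq_getElem] at h1
    rw [dif_pos hi, bits, bits, List.getD_eq_getElem _ _ hi, List.getD_eq_getElem _ _ (f ⟨i, hi⟩).2, h1]

theorem exists_occ_of_isMixed {k : ℕ} {s : List Bool} (hs : IsMixed k s) {P : ℕ}
    (hP : P < 2 ^ patternLength k) {i : ℕ} (hi : i + windowLength k s.length ≤ s.length) :
    ∃ t, i ≤ t ∧ t + patternLength k ≤ i + windowLength k s.length ∧
      Occ (patternLength k) P s.length (bits s) t := by
  set m := patternLength k
  set d := windowLength k s.length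
  have hlen : ((s.drop i).take d).length = d := by simp; omega
  obtain ⟨t, ht⟩ := hs (Block.bitList m (Block.digits P)) (by simp [m]) ((s.drop i).take d)
    ((List.take_prefix _ _).isInfix.trans (List.drop_suffix _ _).isInfix) hlen
  rw [IsSplitPoint, Block.length_bitList] at ht
  have hm : m ≤ d - t := by
    have := congrArg List.length ht
    simp only [List.length_take, List.length_drop, Block.length_bitList] at this
    omega
  -- For the empty pattern the split point provided may lie outside the window, so this case is
  -- treated separately.
  rcases Nat.eq_zero_or_pos m with h0 | hpos
  · refine ⟨i, le_rfl, by omega, by omega, ?_⟩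
    rw [h0] at hP ⊢
    simp at hP
    simp [code, hP]
  refine ⟨i + t, by omega, by omega, by omega, ?_⟩
  rw [← Block.sum_div_mod (b := 2) (by norm_num) hP]
  refine sum_congr rfl fun u hu => ?_
  rw [mem_range] at hu
  congr 1
  have h1 : (((s.drop i).take d).drop t).take m = Block.bitList m (Block.digits P) := ht
  have h2 := congrArg (fun l => l[u]?) h1
  simp only [List.getElem?_take, List.getElem?_drop] at h2
  rw [if_pos hu, if_pos (by omega), List.getElem?_eq_getElem (by omega)] at h2
  rw [List.getElem?_eq_getElem (by simpa using hu)] at h2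
  simp only [Block.bitList, List.getElem_map, List.getElem_range, Option.some.injEq] at h2
  rw [bits, List.getD_eq_getElem _ _ (by omega)]
  have h3 : s[i + t + u]'(by omega) = decide (Block.digits P u = 1) := by
    rw [← h2]; congr 1; omega
  rw [h3]
  have h4 : Block.digits P u < 2 := Nat.mod_lt _ (by norm_num)
  change _ = Block.digits P u
  by_cases h5 : Block.digits P u = 1
  · simp [h5]
  · have : Block.digits P u = 0 := by omega
    simp [this]

end Split

/-! ### Numerical estimates -/

namespace Params

open Real

/-! ### The choice of the parameters -/

/-- The number of colours is polynomial in `B`, so a colour has `O(k log B)` bits, which is less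
than `B` by any prescribed constant factor `A` once `B` is large. -/
theorem exists_blockLength (k A : ℕ) :
    ∃ B, k ≤ B ∧ 1 ≤ B ∧ A * (4 * Nat.size (Block.colours k B)) ≤ B := by
  have hsq : ∀ z, 4 ≤ z → z * z ≤ 2 ^ z := by
    intro z hz
    induction z, hz using Nat.le_induction with
    | base => norm_num
    | succ z hz ih => rw [pow_succ]; nlinarith
  -- With `B = 2^z - 2` the number of colours is `2^(2kz) + 1`, of size at most `2kz + 2`. This `z`
  -- is large enough for `z^2 ≤ 2^z` to beat the linear terms.
  set z := 8 * A * k + 8 * A + k + 8 with hz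
  have h1 := hsq z (by omega)
  have h2 : z * (8 * A * k + 8 * A + k + 8) ≤ 2 ^ z := by rw [← hz]; exact h1
  have hz1 : 1 ≤ z := by omega
  have hB2 : 2 ^ z - 2 + 2 = 2 ^ z := by
    have : 2 ^ 1 ≤ 2 ^ z := Nat.pow_le_pow_right (by norm_num) hz1
    omega
  have hsize : Nat.size (Block.colours k (2 ^ z - 2)) ≤ 2 * k * z + 2 := by
    rw [Nat.size_le, Block.colours, hB2, ← pow_mul, pow_succ, mul_comm z]
    have := Nat.one_le_two_pow (n := 2 * k * z)
    rw [pow_succ]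
    omega
  have h3 : A * (4 * Nat.size (Block.colours k (2 ^ z - 2))) ≤ A * (4 * (2 * k * z + 2)) :=
    Nat.mul_le_mul_left _ (Nat.mul_le_mul_left _ hsize)
  have h4 : A * (4 * (2 * k * z + 2)) + k + 3 ≤ z * (8 * A * k + 8 * A + k + 8) := by
    have e : z * (8 * A * k + 8 * A + k + 8) = A * (4 * (2 * k * z)) + 8 * A * z + k * z + 8 * z := by
      ring
    rw [e]
    nlinarith
  exact ⟨2 ^ z - 2, by omega, by omega, by omega⟩

/-- The number of blocks in a segment. -/
def blocks (k B L : ℕ) : ℕ := L / (4 * Nat.size (Block.colours k B)) + 1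

/-- The bound for the lengths of the segments. -/
def maxLen (k B L : ℕ) : ℕ := blocks k B L * B

/-- The colours of the segment take about `L / 4` bits, since `blocks` divides `L` by four times the
size of a colour. The length of the segment and the rounding up of the number of blocks fit into the
remaining bits. As `2^(L - 2) ≤ n`, the segment hashes are at most `n`. -/
theorem exists_hash_bound (k B : ℕ) : ∃ L₀, ∀ L ≥ L₀,
    (maxLen k B L + 1) * Block.colours k B ^ blocks k B L ≤ 2 ^ (L - 2) := by
  set c := Block.colours k B with hc
  set z := Nat.size c with hz
  have hz1 : 0 < z := by
    rw [hz, Nat.size_pos, hc, Block.colours]; omega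
  -- `E` collects the factors independent of `L`; the threshold guarantees `E + L / 4 + L / 4 ≤ L -
  -- 2`.
  set E := 4 * (B + 1) * c
  refine ⟨2 * E + 8, fun L hL => ?_⟩
  have h1 : c ^ (L / (4 * z)) ≤ 2 ^ (L / 4) := by
    calc c ^ (L / (4 * z)) ≤ (2 ^ z) ^ (L / (4 * z)) :=
          Nat.pow_le_pow_left (Nat.lt_size_self c).le _
      _ = 2 ^ (z * (L / (4 * z))) := (pow_mul _ _ _).symm
      _ ≤ _ := by
          refine Nat.pow_le_pow_right (by norm_num) ?_
          rw [← Nat.div_div_eq_div_mul]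
          exact Nat.mul_div_le _ _
  have h2 : maxLen k B L + 1 ≤ (B + 1) * (4 * 2 ^ (L / 4)) := by
    have h3 : blocks k B L ≤ L + 1 := Nat.succ_le_succ (Nat.div_le_self _ _)
    have h4 : L / 4 + 1 ≤ 2 ^ (L / 4) := Nat.lt_two_pow_self
    have h5 : L + 1 ≤ 4 * 2 ^ (L / 4) := by omega
    unfold maxLen
    nlinarith
  have h3 : E ≤ 2 ^ E := Nat.lt_two_pow_self.le
  calc (maxLen k B L + 1) * c ^ blocks k B L
      ≤ (B + 1) * (4 * 2 ^ (L / 4)) * (2 ^ (L / 4) * c) := by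
        refine Nat.mul_le_mul h2 ?_
        rw [blocks, pow_succ]
        exact Nat.mul_le_mul_right _ h1
    _ = E * (2 ^ (L / 4) * 2 ^ (L / 4)) := by simp only [E]; ring
    _ ≤ 2 ^ E * (2 ^ (L / 4) * 2 ^ (L / 4)) := Nat.mul_le_mul_right _ h3
    _ = 2 ^ (E + (L / 4 + L / 4)) := by rw [pow_add, pow_add]
    _ ≤ _ := Nat.pow_le_pow_right (by norm_num) (by omega)

theorem two_pow_clog_le {n : ℕ} (hn : 1 ≤ n) : 2 ^ (Nat.clog 2 (2 * n + 1) - 2) ≤ n := by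
  have h := Nat.pow_pred_clog_lt_self (b := 2) (by norm_num) (by omega : 1 < 2 * n + 1)
  rcases Nat.lt_or_ge (Nat.clog 2 (2 * n + 1)) 2 with h2 | h2
  · rw [Nat.sub_eq_zero_of_le h2.le]; simpa using hn
  · have e : Nat.clog 2 (2 * n + 1) - 1 = Nat.clog 2 (2 * n + 1) - 2 + 1 := by omega
    rw [Nat.pred_eq_sub_one, e, pow_succ] at h
    omega

theorem le_logb_of_one_le {k : ℕ} (hk : 2 ≤ k) : 1 ≤ logb 2 k := by
  rw [le_logb_iff_rpow_le (by norm_num) (by positivity)]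
  simpa using (show (2 : ℝ) ≤ k by exact_mod_cast hk)

theorem logb_le_self {y : ℝ} (hy : 0 < y) : logb 2 y ≤ y := by
  rw [logb_le_iff_le_rpow (by norm_num) hy]
  have h1 := one_add_mul_self_le_rpow_one_add (s := 1) (by norm_num) (le_refl (1 : ℝ))
  rcases le_or_gt 1 y with h | h
  · have := one_add_mul_self_le_rpow_one_add (s := 1) (by norm_num) h
    norm_num at this
    linarith
  · have := Real.one_le_rpow (x := 2) (z := y) (by norm_num) hy.le
    linarith

theorem clog_le {n : ℕ} (hn : 2 ≤ n) : (Nat.clog 2 (2 * n + 1) : ℝ) ≤ 4 * logb 2 n := by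
  have h := Nat.pow_pred_clog_lt_self (b := 2) (by norm_num) (by omega : 1 < 2 * n + 1)
  have hpos : 0 < Nat.clog 2 (2 * n + 1) := Nat.clog_pos (by norm_num) (by omega)
  have h2 : (2 : ℝ) ^ (Nat.clog 2 (2 * n + 1) - 1) ≤ 4 * n := by
    have : 2 ^ (Nat.clog 2 (2 * n + 1) - 1) ≤ 4 * n := by
      rw [← Nat.pred_eq_sub_one]; omega
    exact_mod_cast this
  have h3 := logb_le_logb_of_le (b := 2) (by norm_num) (by positivity) h2
  rw [logb_pow, logb_mul (by norm_num) (by positivity), logb_self_eq_one (by norm_num),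
    show (4 : ℝ) = 2 ^ (2 : ℕ) by norm_num, logb_pow, logb_self_eq_one (by norm_num)] at h3
  have h4 := le_logb_of_one_le hn
  rw [Nat.cast_sub hpos] at h3
  push_cast at h3
  linarith

/-- Crude estimates `log k ≤ k` and `log n ≤ L` suffice, because `B` may be any constant depending
on `k`. Thus the blocks, though few, cover a whole segment. -/
theorem windowLength_le {k n B : ℕ} (hk : 2 ≤ k) (hn : 2 ≤ n)
    (hB : 20000 * k ^ 3 * (4 * Nat.size (Block.colours k B)) ≤ B) :
    windowLength k n ≤ maxLen k B (Nat.clog 2 (2 * n + 1)) := by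
  set L := Nat.clog 2 (2 * n + 1)
  set c := 4 * Nat.size (Block.colours k B) with hc
  have hc1 : 0 < c := by
    have : 0 < Nat.size (Block.colours k B) := by
      rw [Nat.size_pos, Block.colours]; omega
    omega
  have hlogn : logb 2 n ≤ L := by
    rw [logb_le_iff_le_rpow (by norm_num) (by positivity), rpow_natCast]
    have : 2 * n + 1 ≤ 2 ^ L := Nat.le_pow_clog (by norm_num) _
    exact_mod_cast (show n ≤ 2 ^ L by omega)
  have hlogk : logb 2 k ≤ k := logb_le_self (by positivity)
  have hlogk1 := le_logb_of_one_le hk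
  have hlogn1 := le_logb_of_one_le hn
  have h1 : windowLength k n ≤ 20000 * k ^ 3 * L := by
    refine Nat.floor_le_of_le ?_
    push_cast
    have h2 : logb 2 k ^ 2 ≤ (k : ℝ) ^ 2 := by gcongr
    calc 20000 * (k : ℝ) * logb 2 k ^ 2 * logb 2 n ≤ 20000 * (k : ℝ) * (k : ℝ) ^ 2 * L := by gcongr
      _ = _ := by ring
  refine h1.trans ?_
  have h3 : L ≤ c * (L / c + 1) := by
    have := Nat.lt_mul_div_succ L hc1
    exact this.le
  calc 20000 * k ^ 3 * L ≤ 20000 * k ^ 3 * (c * (L / c + 1)) := Nat.mul_le_mul_left _ h3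
    _ = (L / c + 1) * (20000 * k ^ 3 * c) := by ring
    _ ≤ _ := Nat.mul_le_mul_left _ hB

theorem one_le_loglog {k : ℕ} (hk : 2 ≤ k) : 1 ≤ logb 2 ((k : ℝ) + 1) := by
  have := le_logb_of_one_le (show 2 ≤ k + 1 by omega)
  push_cast at this
  exact this

theorem exponent_pos {k : ℕ} (hk : 2 ≤ k) :
    0 ≤ logb 2 k + logb 2 (logb 2 (k + 1)) + 5 := by
  have h1 := le_logb_of_one_le hk
  have h2 := logb_nonneg (b := 2) (by norm_num) (one_le_loglog hk)
  linarith

theorem rpow_exponent {k : ℕ} (hk : 2 ≤ k) :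
    (2 : ℝ) ^ (logb 2 k + logb 2 (logb 2 (k + 1)) + 5) = 32 * k * logb 2 (k + 1) := by
  have h1 := one_le_loglog hk
  rw [rpow_add (by norm_num), rpow_add (by norm_num), rpow_logb (by norm_num) (by norm_num)
    (by positivity), rpow_logb (by norm_num) (by norm_num) (by linarith)]
  norm_num
  ring

theorem two_pow_patternLength_le {k : ℕ} (hk : 2 ≤ k) :
    (2 : ℝ) ^ patternLength k ≤ 64 * k * logb 2 (k + 1) := by
  have h1 := (Nat.ceil_lt_add_one (exponent_pos hk)).le
  rw [← rpow_natCast]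
  calc (2 : ℝ) ^ (patternLength k : ℝ)
      ≤ 2 ^ (logb 2 k + logb 2 (logb 2 (k + 1)) + 5 + 1) :=
        rpow_le_rpow_of_exponent_le (by norm_num) h1
    _ = _ := by rw [rpow_add (by norm_num), rpow_exponent hk, rpow_one]; ring

/-- Here the shape of `m` is used: `m < 8 log (k + 1)`, while `32 k log (k + 1) ≤ 2^m`. The at most
`2mk` spoiled patterns are therefore fewer than half of all. -/
theorem four_mul_lt_two_pow {k : ℕ} (hk : 2 ≤ k) :
    4 * k * patternLength k < 2 ^ patternLength k := by
  have h1 := Nat.ceil_lt_add_one (exponent_pos hk)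
  have h2 := Nat.le_ceil (logb 2 k + logb 2 (logb 2 (k + 1)) + 5)
  have hl := one_le_loglog hk
  have h3 : logb 2 (logb 2 ((k : ℝ) + 1)) ≤ logb 2 (k + 1) := logb_le_self (by linarith)
  have h4 : logb 2 (k : ℝ) < logb 2 (k + 1) :=
    logb_lt_logb (by norm_num) (by positivity) (by linarith)
  have h5 : (patternLength k : ℝ) < 8 * logb 2 (k + 1) := by
    unfold patternLength
    linarith
  have h6 : 32 * k * logb 2 ((k : ℝ) + 1) ≤ 2 ^ patternLength k := by
    rw [← rpow_exponent hk, ← rpow_natCast]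
    exact rpow_le_rpow_of_exponent_le (by norm_num) h2
  have h7 : (4 * k * patternLength k : ℝ) < 2 ^ patternLength k := by
    have : (0 : ℝ) < k := by positivity
    nlinarith
  exact_mod_cast h7

theorem one_le_patternLength {k : ℕ} (hk : 2 ≤ k) : 1 ≤ patternLength k := by
  have := four_mul_lt_two_pow hk
  by_contra h
  have h0 : patternLength k = 0 := by omega
  have h2 := Nat.le_ceil (logb 2 k + logb 2 (logb 2 (k + 1)) + 5)
  have h3 : ((patternLength k : ℕ) : ℝ) = 0 := by rw [h0]; simp
  have h4 := le_logb_of_one_le hk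
  have h5 := logb_nonneg (b := 2) (by norm_num) (one_le_loglog hk)
  unfold patternLength at h3
  linarith

/-- The length of the hash. -/
noncomputable def hashLength (k n : ℕ) : ℕ :=
  2 ^ patternLength k * (2 * k + 1) * Nat.clog 2 (2 * n + 1)

/-- The constant is `64 * 2 * 3 * 4`, from `2^m ≤ 64 k log (k + 1)`, `log (k + 1) ≤ 2 log k`, `2k +
1 ≤ 3k` and `L ≤ 4 log n`. -/
theorem hashLength_le {k n : ℕ} (hk : 2 ≤ k) (hn : 2 ≤ n) :
    (hashLength k n : ℝ) ≤ 1536 * (k : ℝ) ^ 2 * logb 2 k * logb 2 n := by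
  have h1 := two_pow_patternLength_le hk
  have h2 := clog_le hn
  have hk' : (2 : ℝ) ≤ k := by exact_mod_cast hk
  have h3 : logb 2 ((k : ℝ) + 1) ≤ 2 * logb 2 k := by
    have : logb 2 ((k : ℝ) + 1) ≤ logb 2 ((k : ℝ) ^ 2) :=
      logb_le_logb_of_le (by norm_num) (by positivity) (by nlinarith)
    rwa [logb_pow] at this
  have h4 := le_logb_of_one_le hk
  have h5 := le_logb_of_one_le hn
  have h6 := one_le_loglog hk
  unfold hashLength
  push_cast
  calc (2 : ℝ) ^ patternLength k * (2 * k + 1) * Nat.clog 2 (2 * n + 1)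
      ≤ (64 * k * (2 * logb 2 k)) * (3 * k) * (4 * logb 2 n) := by
        gcongr
        · exact h1.trans (by gcongr)
        · linarith
    _ = _ := by ring

/-- The estimate actually obtained is `n (log n)^2`, from `N ≤ 3n`, `L ≤ 4 log n` and `len W ≤ 16
log n`. -/
theorem time_le {n : ℕ} (hn : 2 ≤ n) (C : ℕ) :
    ((C * ((BLoop.limsOf n).N * (BLoop.limsOf n).L * RAM.len (BLoop.limsOf n).W) : ℕ) : ℝ) ≤
      (192 * C : ℝ) * n * logb 2 n ^ 4 := by
  have h1 := clog_le hn
  have h5 := le_logb_of_one_le hn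
  have hn' : (2 : ℝ) ≤ n := by exact_mod_cast hn
  have hL1 : 1 ≤ Nat.clog 2 (2 * n + 1) := Nat.clog_pos (by norm_num) (by omega)
  have h2 : RAM.len (BLoop.limsOf n).W ≤ 4 * Nat.clog 2 (2 * n + 1) := by
    have h3 : 2 * n + 1 ≤ 2 ^ Nat.clog 2 (2 * n + 1) := Nat.le_pow_clog (by norm_num) _
    have h4 : Nat.size (BLoop.limsOf n).W ≤ 2 * Nat.clog 2 (2 * n + 1) + 1 := by
      rw [Nat.size_le]
      calc (2 * n + 1) * (2 * n + 1) ≤ 2 ^ Nat.clog 2 (2 * n + 1) * 2 ^ Nat.clog 2 (2 * n + 1) :=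
            Nat.mul_le_mul h3 h3
        _ = 2 ^ (2 * Nat.clog 2 (2 * n + 1)) := by rw [← pow_add, ← two_mul]
        _ < _ := Nat.pow_lt_pow_right (by norm_num) (Nat.lt_succ_self _)
    unfold RAM.len
    omega
  have h3 : (RAM.len (BLoop.limsOf n).W : ℝ) ≤ 16 * logb 2 n := by
    have : (RAM.len (BLoop.limsOf n).W : ℝ) ≤ 4 * Nat.clog 2 (2 * n + 1) := by exact_mod_cast h2
    linarith
  have hN : ((BLoop.limsOf n).N : ℝ) ≤ 3 * n := by
    simp only [BLoop.limsOf]; push_cast; linarith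
  have hL : ((BLoop.limsOf n).L : ℝ) ≤ 4 * logb 2 n := h1
  push_cast
  have h6 : logb 2 (n : ℝ) ^ 2 ≤ logb 2 (n : ℝ) ^ 4 := pow_le_pow_right₀ h5 (by norm_num)
  calc (C : ℝ) * ((BLoop.limsOf n).N * (BLoop.limsOf n).L * RAM.len (BLoop.limsOf n).W)
      ≤ C * (3 * n * (4 * logb 2 n) * (16 * logb 2 n)) := by gcongr
    _ = 192 * C * n * logb 2 n ^ 2 := by ring
    _ ≤ _ := by gcongr

end Params

namespace BLoop

open Function RAM Finset

/-! ### Loops that fill an array -/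

/-- The state `σ` with the register `r` and the array `a` replaced. -/
def withRegMem (σ : State) (r i a : ℕ) (A : ℕ → ℕ) : State :=
  ⟨update σ.reg r i, update σ.mem a A⟩

@[simp] theorem withRegMem_reg (σ : State) (r i a : ℕ) (A : ℕ → ℕ) (r' : ℕ) :
    (withRegMem σ r i a A).reg r' = if r' = r then i else σ.reg r' := by
  simp [withRegMem, update_apply]

@[simp] theorem withRegMem_mem (σ : State) (r i a : ℕ) (A : ℕ → ℕ) (a' : ℕ) :
    (withRegMem σ r i a A).mem a' = if a' = a then A else σ.mem a' := by
  simp [withRegMem, update_apply]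

theorem loop_induct (p : Lims) (r : ℕ) (K : Lim) (c : Cmd) (Inv : ℕ → State → Prop) {σ : State}
    (h0 : Inv 0 σ)
    (hstep : ∀ i < K.val p, ∀ τ, Inv i τ → Inv (i + 1) (c.run p (setReg τ r i))) :
    Inv (K.val p) ((Cmd.loop r K c).run p σ) :=
  iter_induct Inv (fun i hi τ hτ => hstep i hi τ hτ) h0

theorem rep_induct (p : Lims) (c : ℕ) (f : ℕ → Cmd) (Inv : ℕ → State → Prop) {σ : State}
    (h0 : Inv 0 σ) (hstep : ∀ i < c, ∀ τ, Inv i τ → Inv (i + 1) ((f i).run p τ)) :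
    Inv c ((Cmd.rep c f).run p σ) := by
  rw [Cmd.run_rep]
  exact iter_induct Inv (fun i hi τ hτ => hstep i hi τ hτ) h0

/-- Such a loop changes one register and one array only, so an invariant about the contents of that
array is enough and all other data are those of the initial state. -/
theorem loop_put_induct (p : Lims) (r : ℕ) (K : Lim) (a : ℕ) (I E : X)
    (Inv : ℕ → (ℕ → ℕ) → Prop) {σ : State} (h0 : Inv 0 (σ.mem a))
    (hstep : ∀ i < K.val p, ∀ A, Inv i A → Inv (i + 1)
      (update A (I.eval p (withRegMem σ r i a A)) (min (E.eval p (withRegMem σ r i a A)) p.W))) :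
    Inv (K.val p) (((Cmd.loop r K (.put a I E)).run p σ).mem a) := by
  have := loop_induct p r K (.put a I E) (σ := σ) (fun i τ => ∃ A, τ.mem = update σ.mem a A ∧
    (∀ r', r' ≠ r → τ.reg r' = σ.reg r') ∧ Inv i A) ⟨σ.mem a, by simp, fun _ _ => rfl, h0⟩ ?_
  · obtain ⟨A, hA, _, h⟩ := this
    rw [hA]
    simpa using h
  · rintro i hi τ ⟨A, hA, hr, h⟩
    have e : setReg τ r i = withRegMem σ r i a A := by
      have : update τ.reg r i = update σ.reg r i := by
        ext r'
        by_cases hr' : r' = r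
        · subst hr'; simp
        · simp [hr', hr r' hr']
      simp [setReg, withRegMem, hA, this]
    refine ⟨_, ?_, ?_, hstep i hi A h⟩
    · simp only [Cmd.run, e, setMem]
      simp [withRegMem]
    · intro r' hne
      simp only [Cmd.run, e, setMem]
      simp [hne]

/-- A loop that writes to the cell `i` in its step `i`. -/
theorem loop_fill (p : Lims) (r : ℕ) (K : Lim) (a : ℕ) (E : X) (g : ℕ → ℕ) {σ : State}
    (hE : ∀ i < K.val p, ∀ A, A i = σ.mem a i → E.eval p (withRegMem σ r i a A) = g i)
    (hg : ∀ i < K.val p, g i ≤ p.W) :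
    ∀ i, ((Cmd.loop r K (.put a (.reg r) E)).run p σ).mem a i =
      if i < K.val p then g i else σ.mem a i := by
  refine loop_put_induct p r K a (.reg r) E
    (fun i A => ∀ j, A j = if j < i then g j else σ.mem a j) (fun j => by simp) ?_
  intro i hi A hA j
  rw [hE i hi A (by rw [hA]; simp), min_eq_left (hg i hi)]
  simp only [X.eval_reg, withRegMem_reg, if_true, update_apply]
  by_cases hj : j = i
  · subst hj; simp
  · rw [if_neg hj, hA]
    have : j < i + 1 ↔ j < i := by omega
    simp only [this]

/-- A loop that computes the cell `i + 1` from the cell `i` in its step `i`. -/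
theorem loop_recurrence (p : Lims) (r : ℕ) (K : Lim) (a : ℕ) (E : X) (g : ℕ → ℕ) {σ : State}
    (h0 : σ.mem a 0 = g 0)
    (hE : ∀ i < K.val p, ∀ A, (∀ j ≤ i, A j = g j) →
      min (E.eval p (withRegMem σ r i a A)) p.W = g (i + 1)) :
    ∀ i ≤ K.val p, ((Cmd.loop r K (.put a (.reg r + 1) E)).run p σ).mem a i = g i := by
  refine loop_put_induct p r K a (.reg r + 1) E
    (fun i A => ∀ j ≤ i, A j = g j) (fun j hj => by rw [Nat.le_zero.1 hj, h0]) ?_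
  intro i hi A hA j hj
  rw [hE i hi A hA]
  simp only [X.eval_add, X.eval_ofNat, X.eval_reg, withRegMem_reg, if_true, update_apply]
  split_ifs with h
  · rw [h]
  · exact hA j (by omega)

end BLoop

/-! ### Tables of powers and a sieve for the field size -/

namespace Codec

open BLoop RAM Finset

/-! ### Powers and a prime -/

/-- The powers of the constant `b` are stored in the array `a`. -/
def powers (a b : ℕ) : Cmd :=
  .seq (.put a 0 1) (.loop 2 .L (.put a (.reg 2 + 1) (.const b * .get a (.reg 2))))

/-- Powers beyond `W` are cut off in the table and never used; hence the hypothesis on `b ^ i`. -/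
theorem run_powers {p : Lims} (hp : p.Good) (a b : ℕ) (hb : 1 ≤ b) (σ : State) {i : ℕ}
    (hi : i ≤ p.L) (hW : b ^ i ≤ p.W) : ((powers a b).run p σ).mem a i = b ^ i := by
  have h := loop_put_induct p 2 .L a (.reg 2 + 1) (.const b * .get a (.reg 2))
    (fun i A => ∀ j ≤ i, b ^ j ≤ p.W → A j = b ^ j) (σ := (Cmd.put a 0 1).run p σ) ?_ ?_
  · exact h i hi hW
  · intro j hj _
    have := hp.two_le
    have e : min 1 p.W = 1 := by omega
    simp [Nat.le_zero.1 hj, Cmd.run, e]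
  · intro i hi A hA j hj hjW
    simp only [X.eval_add, X.eval_ofNat, X.eval_reg, withRegMem_reg, if_true, X.eval_mul,
      X.eval_const, X.eval_get, withRegMem_mem, Function.update_apply]
    split_ifs with h
    · have : b ^ i ≤ b ^ (i + 1) := Nat.pow_le_pow_right hb (by omega)
      rw [h] at hjW
      rw [hA i le_rfl (by omega), h, ← pow_succ', min_eq_left hjW]
    · exact hA j (by omega) hjW

/-- The composite numbers below `N` are marked in the array `9`. -/
def sieve : Cmd :=
  .loop 3 .L (.loop 2 .N (.put 9
    ((.get 7 (.reg 3) + X.mod (.reg 2) (.get 7 (.reg 3))) * (.reg 2 / .get 7 (.reg 3)) *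
      (X.lt 1 (.reg 2 / .get 7 (.reg 3)) * X.lt 0 (.reg 3))) 1))

/-- All factorisations `a b < N` must be reached by a single pair of nested loops up to `L` and `N`.
The index `l` is the binary logarithm of `a`, and `u = b 2^l + (a - 2^l)` encodes both factors;
moreover `u ≤ a b < N`. -/
theorem run_sieve {p : Lims} (hp : p.Good) (hN : p.N ≤ 2 ^ p.L) (σ : State)
    (h2 : ∀ i ≤ p.L, σ.mem 7 i = 2 ^ i) (h9 : ∀ c, σ.mem 9 c = 0) {c : ℕ} (hc : 2 ≤ c)
    (hcN : c < p.N) : (sieve.run p σ).mem 9 c = 0 ↔ c.Prime := by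
  -- If one of the factors would be trivial, the index is `0`; the cell `0` serves as a dump.
  let idx : ℕ → ℕ → ℕ := fun l u => (2 ^ l + u % 2 ^ l) * (u / 2 ^ l) *
    ((if 1 < u / 2 ^ l then 1 else 0) * if 0 < l then 1 else 0)
  have hone : min 1 p.W = 1 := by have := hp.two_le; omega
  have key := loop_induct p 3 .L (.loop 2 .N (.put 9
    ((.get 7 (.reg 3) + X.mod (.reg 2) (.get 7 (.reg 3))) * (.reg 2 / .get 7 (.reg 3)) *
      (X.lt 1 (.reg 2 / .get 7 (.reg 3)) * X.lt 0 (.reg 3))) 1))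
    (fun l τ => (∀ i ≤ p.L, τ.mem 7 i = 2 ^ i) ∧
      (∀ l' < l, ∀ u < p.N, τ.mem 9 (idx l' u) = 1) ∧
      ∀ c, 0 < c → τ.mem 9 c ≠ 0 → ∃ a b, 2 ≤ a ∧ 2 ≤ b ∧ a * b = c) (σ := σ)
    ⟨h2, by omega, fun c _ h => absurd (h9 c) h⟩ ?_
  · obtain ⟨-, h3, h4⟩ := key
    change _ = _ ↔ _
    constructor
    · intro h0
      by_contra hnp
      obtain ⟨a, b, ha, hb, hab⟩ := (Nat.not_prime_iff_exists_mul_eq hc).1 hnp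
      have ha2 : 2 ≤ a := by
        rcases Nat.lt_or_ge a 2 with h | h
        · interval_cases a <;> omega
        · exact h
      have hb2 : 2 ≤ b := by
        rcases Nat.lt_or_ge b 2 with h | h
        · interval_cases b <;> omega
        · exact h
      set l := Nat.log 2 a with hl
      have hl1 : 2 ^ l ≤ a := Nat.pow_log_le_self 2 (by omega)
      have hl2 : a < 2 ^ (l + 1) := Nat.lt_pow_succ_log_self (by norm_num) a
      have hlpos : 0 < l := Nat.log_pos (by norm_num) ha2
      have haN : a < p.N := by nlinarith
      have hlL : l < p.L := by
        rw [← Nat.pow_lt_pow_iff_right (a := 2) (by norm_num)]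
        omega
      have hmod : (b * 2 ^ l + (a - 2 ^ l)) % 2 ^ l = a - 2 ^ l := by
        rw [Nat.mul_add_mod_of_lt]
        rw [pow_succ] at hl2
        omega
      have hdiv : (b * 2 ^ l + (a - 2 ^ l)) / 2 ^ l = b := by
        rw [mul_comm, Nat.mul_add_div (by positivity), Nat.div_eq_of_lt, add_zero]
        rw [pow_succ] at hl2
        omega
      have hu : b * 2 ^ l + (a - 2 ^ l) < p.N := by
        have : a - 2 ^ l ≤ b * (a - 2 ^ l) := Nat.le_mul_of_pos_left _ (by omega)
        have e : b * (a - 2 ^ l) + b * 2 ^ l = b * a := by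
          rw [← mul_add]; congr 1; omega
        rw [mul_comm] at hab
        omega
      have := h3 l hlL _ hu
      simp only [idx, hmod, hdiv] at this
      rw [if_pos (by omega), if_pos hlpos, mul_one, mul_one,
        show 2 ^ l + (a - 2 ^ l) = a by omega, hab] at this
      simp only [sieve] at h0
      omega
    · intro hpr
      by_contra h0
      obtain ⟨a, b, ha, hb, hab⟩ := h4 c (by omega) h0
      exact Nat.not_prime_of_mul_eq hab (by omega) (by omega) hpr
  · rintro l hl τ ⟨h3, h4, h5⟩
    have hl' : l < p.L := hl
    refine ⟨?_, ?_⟩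
    · intro i hi
      rw [Cmd.run_mem _ _ _ (by simp [Cmd.Puts])]
      exact h3 i hi
    · have := loop_put_induct p 2 .N 9 ((.get 7 (.reg 3) + X.mod (.reg 2) (.get 7 (.reg 3))) *
        (.reg 2 / .get 7 (.reg 3)) * (X.lt 1 (.reg 2 / .get 7 (.reg 3)) * X.lt 0 (.reg 3))) 1
        (fun u A => (∀ l' < l, ∀ u < p.N, A (idx l' u) = 1) ∧ (∀ u' < u, A (idx l u') = 1) ∧
          ∀ c, 0 < c → A c ≠ 0 → ∃ a b, 2 ≤ a ∧ 2 ≤ b ∧ a * b = c) (σ := setReg τ 3 l)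
        ⟨h4, by omega, h5⟩ ?_
      · obtain ⟨g1, g2, g3⟩ := this
        refine ⟨fun l' hl' u hu => ?_, g3⟩
        rcases Nat.lt_succ_iff_lt_or_eq.1 hl' with h | rfl
        · exact g1 l' h u hu
        · exact g2 u hu
      · rintro u hu A ⟨g1, g2, g3⟩
        have e : X.eval p ((.get 7 (.reg 3) + X.mod (.reg 2) (.get 7 (.reg 3))) *
            (.reg 2 / .get 7 (.reg 3)) * (X.lt 1 (.reg 2 / .get 7 (.reg 3)) * X.lt 0 (.reg 3)))
            (withRegMem (setReg τ 3 l) 2 u 9 A) = idx l u := by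
          simp [idx, h3 l hl'.le]
        rw [e, X.eval_ofNat, hone]
        have hup : ∀ c, A c = 1 → Function.update A (idx l u) 1 c = 1 := by
          intro c hc
          rw [Function.update_apply]
          split_ifs
          · rfl
          · exact hc
        refine ⟨fun l' hl' u hu => hup _ (g1 l' hl' u hu), fun u' hu' => ?_, ?_⟩
        · rcases Nat.lt_succ_iff_lt_or_eq.1 hu' with h | rfl
          · exact hup _ (g2 u' h)
          · simp
        · intro c hc h
          by_cases hci : c = idx l u
          · subst hci
            simp only [idx] at hc ⊢
            split_ifs at hc ⊢ with h6 h7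
            · refine ⟨2 ^ l + u % 2 ^ l, u / 2 ^ l, ?_, h6, by ring⟩
              have : 2 ^ 1 ≤ 2 ^ l := Nat.pow_le_pow_right (by norm_num) h7
              omega
            all_goals simp at hc
          · rw [Function.update_of_ne hci] at h
            exact g3 c hc h

/-- A prime between `N / 2` and `N` is stored in the register `5`. -/
def findPrime : Cmd :=
  .loop 2 .N (.ite (X.lt (.lim .N / 2) (.reg 2) * X.eq (.get 9 (.reg 2)) 0) (.set 5 (.reg 2)) .skip)

/-- The largest prime up to `2 * n`. -/
def bigPrime (n : ℕ) : ℕ := Nat.findGreatest Nat.Prime (2 * n)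

theorem bigPrime_spec {n : ℕ} (hn : 1 ≤ n) :
    (bigPrime n).Prime ∧ n < bigPrime n ∧ bigPrime n ≤ 2 * n := by
  obtain ⟨c, h1, h2, h3⟩ := Nat.exists_prime_lt_and_le_two_mul n (by omega)
  exact ⟨Nat.findGreatest_spec h3 h1, h2.trans_le (Nat.le_findGreatest h3 h1),
    Nat.findGreatest_le _⟩

/-- Later hits overwrite earlier ones, so the largest prime remains. Bertrand's postulate provides
one above `n`. -/
theorem run_findPrime {n : ℕ} (hn : 1 ≤ n) (σ : State)
    (h9 : ∀ c, 2 ≤ c → c < 2 * n + 1 → (σ.mem 9 c = 0 ↔ c.Prime)) :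
    (findPrime.run (limsOf n) σ).reg 5 = bigPrime n := by
  have hp := limsOf_good hn
  have key := loop_induct (limsOf n) 2 .N (.ite (X.lt (.lim .N / 2) (.reg 2) *
      X.eq (.get 9 (.reg 2)) 0) (.set 5 (.reg 2)) .skip)
    (fun i τ => τ.mem = σ.mem ∧ ((∃ c < i, n < c ∧ c.Prime) →
      τ.reg 5 = Nat.findGreatest Nat.Prime (i - 1))) (σ := σ) ⟨rfl, by simp⟩ ?_
  · obtain ⟨c, h1, h2, h3⟩ := Nat.exists_prime_lt_and_le_two_mul n (by omega)
    exact key.2 ⟨c, Nat.lt_succ_of_le h3, h2, h1⟩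
  · rintro i hi τ ⟨h1, h2⟩
    have hi' : i < 2 * n + 1 := hi
    have hiW : i ≤ (limsOf n).W := (Nat.le_of_lt hi).trans hp.N_le
    have hN : (limsOf n).N / 2 = n := by simp only [limsOf]; omega
    have hmin : min i (limsOf n).W = i := min_eq_left hiW
    by_cases hc : n < i ∧ i.Prime
    · have h0 : σ.mem 9 i = 0 := (h9 i hc.2.two_le hi').2 hc.2
      simp only [Cmd.run, X.eval_mul, X.eval_lt, X.eval_div, X.eval_lim, Lim.val, X.eval_ofNat, hN,
        X.eval_reg, setReg_reg, if_true, X.eval_eq, X.eval_get, setReg_mem, h1, h0, hc.1, mul_one,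
        zero_lt_one, hmin, true_and, Nat.add_sub_cancel]
      exact fun _ => (le_antisymm (Nat.findGreatest_le _) (Nat.le_findGreatest le_rfl hc.2)).symm
    · have hcond : ¬ (n < i ∧ σ.mem 9 i = 0) := by
        rintro ⟨g1, g2⟩
        exact hc ⟨g1, (h9 i (by omega) hi').1 g2⟩
      have hz : (if n < i then 1 else 0) * (if σ.mem 9 i = 0 then 1 else 0) = 0 := by
        split_ifs <;> first | rfl | tauto
      simp only [Cmd.run, X.eval_mul, X.eval_lt, X.eval_div, X.eval_lim, Lim.val, X.eval_ofNat, hN,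
        X.eval_reg, setReg_reg, if_true, X.eval_eq, X.eval_get, setReg_mem, h1, hz, lt_irrefl,
        if_false, true_and]
      rintro ⟨c, g1, g2, g3⟩
      have : c ≠ i := by rintro rfl; exact hc ⟨g2, g3⟩
      have h3 := h2 ⟨c, by omega, g2, g3⟩
      obtain ⟨i, rfl⟩ : ∃ i', i = i' + 1 := ⟨i - 1, by omega⟩
      have h4 : ¬ (i + 1).Prime := fun h => hc ⟨by omega, h⟩
      rw [Nat.add_sub_cancel, Nat.findGreatest_of_not h4]
      simpa using h3

end Codec

/-! ### Hashes of the segments: definition and computation -/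

namespace Codec

open BLoop RAM Finset Split

/-! ### The hashes of the segments -/

/-- The number of deletions, the length of the patterns, the length of the blocks, their colours and
the function that recovers them. -/
structure Par where
  k : ℕ
  m : ℕ
  B : ℕ
  φ : ℕ → ℕ
  ψ : ℕ → ℕ → ℕ

def Par.nc (a : Par) : ℕ := Block.colours a.k a.B

/-- The code of the block `b` of the segment `j`. -/
def blockCode (a : Par) (P n : ℕ) (x : ℕ → ℕ) (j b : ℕ) : ℕ :=
  ∑ t ∈ range a.B, 2 ^ t * seg a.m P n x j (b * a.B + t)

/-- The hash of the segment `j`: its length and the colours of its blocks. -/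
def segHash (a : Par) (L P n : ℕ) (x : ℕ → ℕ) (j : ℕ) : ℕ :=
  segLen a.m P n x j + (Params.maxLen a.k a.B L + 1) *
    ∑ b ∈ range (Params.blocks a.k a.B L), a.nc ^ b * a.φ (blockCode a P n x j b)

/-- Conditions on the tables, and that the strings are long. -/
structure Par.Ok (a : Par) (n : ℕ) : Prop where
  n_pos : 1 ≤ n
  m_pos : 1 ≤ a.m
  k_le : a.k ≤ a.B
  B_pos : 1 ≤ a.B
  φ_lt : ∀ c, a.φ c < a.nc
  ψ_eq : ∀ c < 2 ^ a.B, ∀ w, (Block.bitList (a.B - a.k) (Block.digits w)).Sublist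
    (Block.bitList a.B (Block.digits c)) → a.ψ (a.φ c) w = c
  bound : (Params.maxLen a.k a.B (limsOf n).L + 1) * a.nc ^ Params.blocks a.k a.B (limsOf n).L ≤ n
  large : 2 ^ a.m * (2 * a.k + 1) ≤ n

theorem Par.nc_pos (a : Par) : 1 ≤ a.nc := by
  unfold Par.nc Block.colours; omega

theorem Par.Ok.two_pow_le {a : Par} {n : ℕ} (h : a.Ok n) : 2 ^ (limsOf n).L ≤ 4 * n := by
  have h1 := Params.two_pow_clog_le h.n_pos
  have : 2 ^ (limsOf n).L ≤ 4 * 2 ^ (Nat.clog 2 (2 * n + 1) - 2) := by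
    rw [show (4 : ℕ) = 2 ^ 2 by norm_num, ← pow_add]
    refine Nat.pow_le_pow_right (by norm_num) ?_
    simp only [limsOf]; omega
  omega

theorem four_mul_le (n : ℕ) : 4 * n ≤ (limsOf n).W := by
  simp only [limsOf]; nlinarith

theorem N_le_two_pow (n : ℕ) : (limsOf n).N ≤ 2 ^ (limsOf n).L := Nat.le_pow_clog (by norm_num) _

theorem Par.Ok.pow_le {a : Par} {n : ℕ} (h : a.Ok n) {b : ℕ}
    (hb : b ≤ Params.blocks a.k a.B (limsOf n).L) : a.nc ^ b ≤ n := by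
  refine (Nat.pow_le_pow_right a.nc_pos hb).trans (le_trans ?_ h.bound)
  exact Nat.le_mul_of_pos_left _ (Nat.succ_pos _)

theorem blocks_le {k B L : ℕ} (hL : 2 ≤ L) : Params.blocks k B L ≤ L := by
  unfold Params.blocks
  have h1 : 0 < Nat.size (Block.colours k B) := by
    rw [Nat.size_pos]; unfold Block.colours; omega
  have h2 : L / (4 * Nat.size (Block.colours k B)) ≤ L / 4 :=
    Nat.div_le_div_left (by omega) (by norm_num)
  omega

theorem two_le_L {n : ℕ} (hn : 1 ≤ n) : 2 ≤ (limsOf n).L := by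
  have h := N_le_two_pow n
  by_contra hL
  have : 2 ^ (limsOf n).L ≤ 2 ^ 1 := Nat.pow_le_pow_right (by norm_num) (by omega)
  simp only [limsOf] at this h
  omega

/-- The hash is a number in mixed radix: the length is its lowest digit, in base `maxLen + 1`, and
the colours are the other digits, in base `nc`. So it is bounded by the product of the bases. -/
theorem segHash_lt {a : Par} {n : ℕ} (h : a.Ok n) {P n' : ℕ} {x : ℕ → ℕ} {j : ℕ}
    (hj : segLen a.m P n' x j ≤ Params.maxLen a.k a.B (limsOf n).L) :
    segHash a (limsOf n).L P n' x j < n + 1 := by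
  have h1 := Block.sum_digits_lt a.nc_pos (M := Params.blocks a.k a.B (limsOf n).L)
    (f := fun b => a.φ (blockCode a P n' x j b)) fun _ _ => h.φ_lt _
  have h2 := h.bound
  unfold segHash
  have h3 := Nat.mul_le_mul_left (Params.maxLen a.k a.B (limsOf n).L + 1) (Nat.succ_le_of_lt h1)
  rw [Nat.mul_succ] at h3
  omega

/-! ### Preparation -/

/-- The string is moved from the array `0` to the array `2`, since the array `0` receives the
output. -/
def setup (a : Par) : Cmd :=
  .seq (.set 1 (.reg 0)) <|
  .seq (.loop 2 .N (.put 2 (.reg 2) (.get 0 (.reg 2)))) <|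
  .seq (powers 7 2) <|
  .seq (powers 8 a.nc) <|
  .seq sieve findPrime

structure Ready (a : Par) (n n' : ℕ) (x : ℕ → ℕ) (σ : State) : Prop where
  len : σ.reg 1 = n'
  q : σ.reg 5 = bigPrime n
  str : σ.mem 2 = x
  pow : ∀ i ≤ (limsOf n).L, σ.mem 7 i = 2 ^ i
  cpow : ∀ i ≤ Params.blocks a.k a.B (limsOf n).L, σ.mem 8 i = a.nc ^ i

theorem Ready.of_frame {a : Par} {n n' : ℕ} {x : ℕ → ℕ} {σ : State} (h : Ready a n n' x σ) (c : Cmd)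
    (h1 : ¬ c.Sets 1) (h5 : ¬ c.Sets 5) (h2 : ¬ c.Puts 2) (h7 : ¬ c.Puts 7) (h8 : ¬ c.Puts 8) :
    Ready a n n' x (c.run (limsOf n) σ) := by
  refine ⟨?_, ?_, ?_, ?_, ?_⟩
  · rw [Cmd.run_reg _ _ _ h1, h.len]
  · rw [Cmd.run_reg _ _ _ h5, h.q]
  · rw [Cmd.run_mem _ _ _ h2, h.str]
  · rw [Cmd.run_mem _ _ _ h7]; exact h.pow
  · rw [Cmd.run_mem _ _ _ h8]; exact h.cpow

theorem run_setup {a : Par} {n : ℕ} (ha : a.Ok n) {σ : State} (hσ : Bdd (limsOf n).W σ)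
    (h0 : ∀ i, (limsOf n).N ≤ i → σ.mem 0 i = 0) (h2 : ∀ i, σ.mem 2 i = 0)
    (h9 : ∀ i, σ.mem 9 i = 0) :
    Ready a n (σ.reg 0) (σ.mem 0) ((setup a).run (limsOf n) σ) := by
  have hp := limsOf_good ha.n_pos
  have h4 := four_mul_le n
  set σ1 := (Cmd.set 1 (.reg 0)).run (limsOf n) σ with e1
  set σ2 := (Cmd.loop 2 .N (.put 2 (.reg 2) (.get 0 (.reg 2)))).run (limsOf n) σ1 with e2
  set σ3 := (powers 7 2).run (limsOf n) σ2 with e3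
  set σ4 := (powers 8 a.nc).run (limsOf n) σ3 with e4
  set σ5 := sieve.run (limsOf n) σ4 with e5
  have e : (setup a).run (limsOf n) σ = findPrime.run (limsOf n) σ5 := rfl
  have h3 : ∀ i ≤ (limsOf n).L, σ3.mem 7 i = 2 ^ i := fun i hi => by
    refine run_powers hp 7 2 (by norm_num) σ2 hi ?_
    have := Nat.pow_le_pow_right (n := 2) (by norm_num) hi
    have := ha.two_pow_le
    omega
  have h3' : ∀ i ≤ (limsOf n).L, σ4.mem 7 i = 2 ^ i := fun i hi => by
    rw [e4, Cmd.run_mem _ _ _ (by simp [powers, Cmd.Puts]), h3 i hi]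
  rw [e]
  refine ⟨?_, ?_, ?_, fun i hi => ?_, fun i hi => ?_⟩
  · rw [Cmd.run_reg _ _ _ (by simp [findPrime, Cmd.Sets]), e5,
      Cmd.run_reg _ _ _ (by simp [sieve, Cmd.Sets]), e4,
      Cmd.run_reg _ _ _ (by simp [powers, Cmd.Sets]), e3,
      Cmd.run_reg _ _ _ (by simp [powers, Cmd.Sets]), e2,
      Cmd.run_reg _ _ _ (by simp [Cmd.Sets]), e1]
    simp [Cmd.run, min_eq_left (hσ.1 0)]
  · refine run_findPrime ha.n_pos σ5 fun c hc hcN => ?_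
    refine run_sieve hp (N_le_two_pow n) σ4 h3' (fun c => ?_) hc hcN
    rw [e4, Cmd.run_mem _ _ _ (by simp [powers, Cmd.Puts]), e3,
      Cmd.run_mem _ _ _ (by simp [powers, Cmd.Puts]), e2, Cmd.run_mem _ _ _ (by simp [Cmd.Puts])]
    exact h9 c
  · rw [Cmd.run_mem _ _ _ (by simp [findPrime, Cmd.Puts]), e5,
      Cmd.run_mem _ _ _ (by simp [sieve, Cmd.Puts]), e4,
      Cmd.run_mem _ _ _ (by simp [powers, Cmd.Puts]), e3,
      Cmd.run_mem _ _ _ (by simp [powers, Cmd.Puts]), e2]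
    ext i
    have hmem : σ1.mem = σ.mem := rfl
    rw [loop_fill (limsOf n) 2 .N 2 (.get 0 (.reg 2)) (σ.mem 0) (σ := σ1)
      (fun i _ A _ => by simp [hmem]) (fun i _ => hσ.2 0 i) i]
    split_ifs with hi
    · rfl
    · rw [hmem, h2, h0 i (not_lt.1 hi)]
  · rw [Cmd.run_mem _ _ _ (by simp [findPrime, Cmd.Puts]), e5,
      Cmd.run_mem _ _ _ (by simp [sieve, Cmd.Puts])]
    exact h3' i hi
  · rw [Cmd.run_mem _ _ _ (by simp [findPrime, Cmd.Puts]), e5,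
      Cmd.run_mem _ _ _ (by simp [sieve, Cmd.Puts])]
    have := ha.pow_le hi
    exact run_powers hp 8 a.nc a.nc_pos σ3 (hi.trans (blocks_le (two_le_L ha.n_pos)))
      (by omega)

/-! ### The segments of a string -/

/-- The number of blocks in a segment. -/
def blocksX (a : Par) : X := .lim .L / .const (4 * Nat.size (Block.colours a.k a.B)) + 1

/-- The maximal length of a segment plus one. -/
def maxLenX (a : Par) : X := blocksX a * .const a.B + 1

/-- The bound on the position is needed: the zeros behind the end of the string could complete a
pattern. -/
def occX (a : Par) (P : ℕ) : X :=
  X.lt (.reg 2 + .const a.m) (.reg 1 + 1) *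
    X.eq (X.csum a.m fun t => .const (2 ^ t) * .get 2 (.reg 2 + .const t)) (.const P)

/-- The first `c` symbols of the block `b` of the segment `j`. -/
def codeX (a : Par) (c : ℕ) (j b : X) : X :=
  X.csum c fun t => .const (2 ^ t) * (.get 2 (.get 5 j + (b * .const a.B + .const t)) *
    X.lt (b * .const a.B + .const t) (.get 4 j))

/-- Sums are available only up to `N` and `L`; the test restricts the sum to the actual number of
blocks, which is at most `L` (`blocks_le`). -/
def hashX (a : Par) : X :=
  .get 4 (.reg 2) + maxLenX a * .sum 3 .L (X.lt (.reg 3) (blocksX a) *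
    (.get 8 (.reg 3) * X.lookup a.φ (2 ^ a.B) (codeX a a.B (.reg 2) (.reg 3))))

/-- The segments of the string in the array `2` with respect to the pattern `P`, and their
hashes. -/
def segments (a : Par) (P : ℕ) : Cmd :=
  .seq (.put 3 0 0) <|
  .seq (.loop 2 .N (.put 3 (.reg 2 + 1) (.get 3 (.reg 2) + occX a P))) <|
  -- The counters are cleared because the command is run again for every pattern.
  .seq (.loop 2 .N (.put 4 (.reg 2) 0)) <|
  .seq (.loop 2 .N (.put 4 (.get 3 (.reg 2)) (.get 4 (.get 3 (.reg 2)) + X.lt (.reg 2) (.reg 1)))) <|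
  .seq (.put 5 0 0) <|
  .seq (.loop 2 .N (.put 5 (.reg 2 + 1) (.get 5 (.reg 2) + .get 4 (.reg 2)))) <|
  .loop 2 .N (.put 6 (.reg 2) (X.mod (hashX a) (.reg 5)))

structure Segmented (a : Par) (P n n' : ℕ) (x : ℕ → ℕ) (σ : State) : Prop where
  len : ∀ j < (limsOf n).N, σ.mem 4 j = segLen a.m P n' x j
  start : ∀ j ≤ (limsOf n).N, σ.mem 5 j = segStart a.m P n' x j
  hash : ∀ j < (limsOf n).N, σ.mem 6 j = segHash a (limsOf n).L P n' x j % bigPrime n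

theorem eval_blocksX (a : Par) (p : Lims) (σ : State) :
    (blocksX a).eval p σ = Params.blocks a.k a.B p.L := by
  simp [blocksX, Params.blocks, Lim.val]

theorem eval_maxLenX (a : Par) (p : Lims) (σ : State) :
    (maxLenX a).eval p σ = Params.maxLen a.k a.B p.L + 1 := by
  simp [maxLenX, Params.maxLen, eval_blocksX]

theorem eval_codeX {a : Par} {P n n' : ℕ} {x : ℕ → ℕ} {σ : State} {j b : X} (c : ℕ)
    (h2 : σ.mem 2 = x)
    (h4 : σ.mem 4 (j.eval (limsOf n) σ) = segLen a.m P n' x (j.eval (limsOf n) σ))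
    (h5 : σ.mem 5 (j.eval (limsOf n) σ) = segStart a.m P n' x (j.eval (limsOf n) σ)) :
    (codeX a c j b).eval (limsOf n) σ = ∑ t ∈ range c, 2 ^ t *
      seg a.m P n' x (j.eval (limsOf n) σ) (b.eval (limsOf n) σ * a.B + t) := by
  simp only [codeX, X.eval_csum, X.eval_mul, X.eval_const, X.eval_get, X.eval_add, X.eval_lt, h2,
    h4, h5, seg, mul_ite, mul_one, mul_zero]

theorem seg_lt_two {m P n : ℕ} {x : ℕ → ℕ} (hx : ∀ i, x i < 2) (j t : ℕ) :
    seg m P n x j t < 2 := by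
  unfold seg
  split_ifs
  · exact hx _
  · norm_num

/-- Labels arise by a recurrence over the positions, lengths by counting labels, starts as partial
sums of lengths. All stored numbers are at most `W`, so the cut-off never acts. -/
theorem run_segments {a : Par} {P n n' : ℕ} {x : ℕ → ℕ} {σ : State} (ha : a.Ok n)
    (hx : ∀ i, x i < 2) (hn : n' ≤ n) (hσ : Ready a n n' x σ) :
    Segmented a P n n' x ((segments a P).run (limsOf n) σ) := by
  have hp := limsOf_good ha.n_pos
  have hNW := hp.N_le
  have hnN : n < (limsOf n).N := by simp only [limsOf]; omega
  set p := limsOf n with hpdef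
  set σ1 := (Cmd.put 3 0 0).run p σ with e1
  set σ2 := (Cmd.loop 2 .N (.put 3 (.reg 2 + 1) (.get 3 (.reg 2) + occX a P))).run p σ1 with e2
  set σ3 := (Cmd.loop 2 .N (.put 4 (.reg 2) 0)).run p σ2 with e3
  set σ4 := (Cmd.loop 2 .N (.put 4 (.get 3 (.reg 2)) (.get 4 (.get 3 (.reg 2)) +
    X.lt (.reg 2) (.reg 1)))).run p σ3 with e4
  set σ5 := (Cmd.put 5 0 0).run p σ4 with e5
  set σ6 := (Cmd.loop 2 .N (.put 5 (.reg 2 + 1) (.get 5 (.reg 2) + .get 4 (.reg 2)))).run p σ5 with e6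
  have e : (segments a P).run p σ = (Cmd.loop 2 .N (.put 6 (.reg 2)
    (X.mod (hashX a) (.reg 5)))).run p σ6 := rfl
  have r1 : Ready a n n' x σ1 := hσ.of_frame _ (by simp [Cmd.Sets]) (by simp [Cmd.Sets])
    (by simp [Cmd.Puts]) (by simp [Cmd.Puts]) (by simp [Cmd.Puts])
  have r2 : Ready a n n' x σ2 := r1.of_frame _ (by simp [Cmd.Sets]) (by simp [Cmd.Sets])
    (by simp [Cmd.Puts]) (by simp [Cmd.Puts]) (by simp [Cmd.Puts])
  have r3 : Ready a n n' x σ3 := r2.of_frame _ (by simp [Cmd.Sets]) (by simp [Cmd.Sets])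
    (by simp [Cmd.Puts]) (by simp [Cmd.Puts]) (by simp [Cmd.Puts])
  have r4 : Ready a n n' x σ4 := r3.of_frame _ (by simp [Cmd.Sets]) (by simp [Cmd.Sets])
    (by simp [Cmd.Puts]) (by simp [Cmd.Puts]) (by simp [Cmd.Puts])
  have r5 : Ready a n n' x σ5 := r4.of_frame _ (by simp [Cmd.Sets]) (by simp [Cmd.Sets])
    (by simp [Cmd.Puts]) (by simp [Cmd.Puts]) (by simp [Cmd.Puts])
  have r6 : Ready a n n' x σ6 := r5.of_frame _ (by simp [Cmd.Sets]) (by simp [Cmd.Sets])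
    (by simp [Cmd.Puts]) (by simp [Cmd.Puts]) (by simp [Cmd.Puts])
  have hlab : ∀ i ≤ p.N, σ2.mem 3 i = lab a.m P n' x i := by
    refine loop_recurrence p 2 .N 3 _ _ ?_ ?_
    · simp [e1, Cmd.run, lab]
    · intro i hi A hA
      have hi' : i < p.N := hi
      have h1 := hA i le_rfl
      have h2 := lab_le a.m P n' x (i + 1)
      rw [lab_succ] at h2 ⊢
      have h3 : (occX a P).eval p (withRegMem σ1 2 i 3 A) = if Occ a.m P n' x i then 1 else 0 := by
        have g1 : (X.reg 1).eval p (withRegMem σ1 2 i 3 A) = n' := by simpa using r1.len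
        have g2 : ∀ t, (X.get 2 (.reg 2 + .const t)).eval p (withRegMem σ1 2 i 3 A) = x (i + t) :=
          fun t => by simp [r1.str]
        simp only [occX, X.eval_mul, X.eval_lt, X.eval_add, g1, X.eval_const, X.eval_ofNat,
          X.eval_eq, X.eval_csum, g2, Occ, code]
        simp only [X.eval_reg, withRegMem_reg, if_true]
        by_cases g3 : i + a.m ≤ n'
        · simp [g3]
        · simp [g3]
      simp only [X.eval_add, X.eval_get, X.eval_reg, withRegMem_reg, withRegMem_mem, if_true, h3,
        h1]
      exact min_eq_left (by omega)
  have hzero : ∀ j < p.N, σ3.mem 4 j = 0 := by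
    intro j hj
    rw [e3, loop_fill p 2 .N 4 0 (fun _ => 0) (fun i _ A _ => by simp) (fun i _ => by omega) j]
    exact if_pos hj
  have hlab3 : ∀ i ≤ p.N, σ3.mem 3 i = lab a.m P n' x i := fun i hi => by
    rw [e3, Cmd.run_mem _ _ _ (by simp [Cmd.Puts]), hlab i hi]
  have hlen : ∀ j < p.N, σ4.mem 4 j = segLen a.m P n' x j := by
    have key := loop_put_induct p 2 .N 4 (.get 3 (.reg 2)) (.get 4 (.get 3 (.reg 2)) +
      X.lt (.reg 2) (.reg 1)) (fun i A => ∀ j < p.N, A j =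
        ∑ t ∈ range i, if t < n' ∧ lab a.m P n' x t = j then 1 else 0) (σ := σ3)
        (fun j hj => by rw [hzero j hj]; simp) ?_
    · intro j hj
      refine (key j hj).trans ?_
      change ∑ t ∈ range p.N, _ = _
      -- The loop passes over positions behind the end of the string too; these are not counted.
      have hsub : range n' ⊆ range p.N := range_mono (by omega)
      rw [segLen, ← sum_subset hsub]
      · refine sum_congr rfl fun t ht => ?_
        simp [mem_range.1 ht]
      · intro t _ ht
        rw [mem_range] at ht
        simp [ht]
    · intro i hi A hA j hj
      have hi' : i < p.N := hi
      have h1 := lab_le a.m P n' x i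
      have h2 : ∑ t ∈ range i, (if t < n' ∧ lab a.m P n' x t = lab a.m P n' x i then 1 else 0) ≤
          ∑ t ∈ range i, 1 := sum_le_sum fun t _ => by split_ifs <;> omega
      rw [sum_const, card_range, smul_eq_mul, mul_one] at h2
      have h3 : X.eval p (.get 4 (.get 3 (.reg 2)) + X.lt (.reg 2) (.reg 1))
          (withRegMem σ3 2 i 4 A) = A (lab a.m P n' x i) + if i < n' then 1 else 0 := by
        simp [hlab3 i hi'.le, r3.len]
      have h4 : X.eval p (.get 3 (.reg 2)) (withRegMem σ3 2 i 4 A) = lab a.m P n' x i := by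
        simp [hlab3 i hi'.le]
      rw [h3, h4, hA _ (by omega), min_eq_left (by split_ifs <;> omega), sum_range_succ,
        Function.update_apply]
      by_cases hj : j = lab a.m P n' x i
      · subst hj
        simp
      · rw [if_neg hj, hA j (by omega)]
        simp [Ne.symm hj]
  have hlen5 : ∀ j < p.N, σ5.mem 4 j = segLen a.m P n' x j := fun j hj => by
    rw [e5, Cmd.run_mem _ _ _ (by simp [Cmd.Puts]), hlen j hj]
  have hlen6 : ∀ j < p.N, σ6.mem 4 j = segLen a.m P n' x j := fun j hj => by
    rw [e6, Cmd.run_mem _ _ _ (by simp [Cmd.Puts]), hlen5 j hj]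
  have hstart : ∀ j ≤ p.N, σ6.mem 5 j = segStart a.m P n' x j := by
    refine loop_recurrence p 2 .N 5 _ _ ?_ ?_
    · simp [e5, Cmd.run, segStart]
    · intro i hi A hA
      have h1 := hA i le_rfl
      have h2 := segStart_le a.m P n' x (i + 1)
      rw [segStart_succ] at h2 ⊢
      simp only [X.eval_add, X.eval_get, X.eval_reg, withRegMem_reg, withRegMem_mem, if_true, h1]
      rw [if_neg (by norm_num), hlen5 i hi, min_eq_left (by omega)]
  obtain ⟨hq1, hq2, hq3⟩ := bigPrime_spec ha.n_pos
  have hhash : ∀ j < p.N, ((Cmd.loop 2 .N (.put 6 (.reg 2) (X.mod (hashX a) (.reg 5)))).run p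
      σ6).mem 6 j = segHash a p.L P n' x j % bigPrime n := by
    intro j hj
    rw [loop_fill p 2 .N 6 _ (fun j => segHash a p.L P n' x j % bigPrime n) ?_ ?_ j]
    · exact if_pos hj
    · intro i hi A hA
      have hi' : i < p.N := hi
      rw [X.eval_mod]
      congr 1
      · simp only [hashX, X.eval_add, X.eval_mul, eval_maxLenX, X.eval_sum, X.eval_lt, X.eval_reg,
          eval_blocksX, X.eval_get, withRegMem_reg, withRegMem_mem, setReg_reg, setReg_mem, if_true]
        rw [if_neg (by norm_num), hlen6 i hi', segHash]
        congr 2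
        have hsub : range (Params.blocks a.k a.B p.L) ⊆ range (Lim.L.val p) :=
          range_mono (blocks_le (two_le_L ha.n_pos))
        rw [← sum_subset hsub]
        · refine sum_congr rfl fun b hb => ?_
          rw [mem_range] at hb
          have hcode : (codeX a a.B (.reg 2) (.reg 3)).eval p
              (setReg (withRegMem σ6 2 i 6 A) 3 b) = blockCode a P n' x i b := by
            rw [eval_codeX (P := P) (n' := n') (x := x)]
            · simp [blockCode]
            · simpa using r6.str
            · simpa using hlen6 i hi'
            · simpa using hstart i hi'.le
          have hlt : blockCode a P n' x i b < 2 ^ a.B :=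
            Block.sum_digits_lt (by norm_num) fun t _ => seg_lt_two hx _ _
          rw [if_pos hb, one_mul, X.eval_lookup _ _ _ _ _ (by rw [hcode]; exact hlt), hcode,
            if_neg (by norm_num), r6.cpow b hb.le]
        · intro b _ hb
          rw [mem_range] at hb
          rw [if_neg hb, zero_mul]
      · simpa using r6.q
    · intro i _
      have := Nat.mod_lt (segHash a p.L P n' x i) hq1.pos
      have : 4 * n ≤ p.W := four_mul_le n
      omega
  rw [e]
  refine ⟨fun j hj => ?_, fun j hj => ?_, hhash⟩
  · rw [Cmd.run_mem _ _ _ (by simp [Cmd.Puts]), hlen6 j hj]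
  · rw [Cmd.run_mem _ _ _ (by simp [Cmd.Puts]), hstart j hj]

end Codec

/-! ### The hash function as a program -/

namespace Codec

open BLoop RAM Finset Split

/-! ### The hash function -/

/-- The syndrome `r` of the hashes of the segments with respect to the pattern `P`. -/
def segSyndrome (a : Par) (n n' : ℕ) (x : ℕ → ℕ) (P r : ℕ) : ℕ :=
  (∑ j ∈ range (bigPrime n), segHash a (limsOf n).L P n' x j % bigPrime n * j ^ r) % bigPrime n

def hashBit (a : Par) (n : ℕ) (x : ℕ → ℕ) (i : ℕ) : ℕ :=
  segSyndrome a n n x (i / (limsOf n).L / (2 * a.k + 1)) (i / (limsOf n).L % (2 * a.k + 1)) /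
    2 ^ (i % (limsOf n).L) % 2

/-- The sum of `f r` times the `r`-th powers of the positions, for the array `6`. -/
def powerSumX (r : ℕ) : X :=
  .sum 4 .N (X.lt (.reg 4) (.reg 5) * (.get 6 (.reg 4) * X.pow (.reg 4) r))

def writeSyndrome (c r : ℕ) : Cmd :=
  .seq (.set 6 (X.mod (powerSumX r) (.reg 5)))
    (.loop 3 .L (.put 0 (.const c * .lim .L + .reg 3) (X.mod (.reg 6 / .get 7 (.reg 3)) 2)))

def hashCmd (a : Par) : Cmd :=
  .seq (setup a) <|
  .seq (.rep (2 ^ a.m) fun P => .seq (segments a P) <|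
    .rep (2 * a.k + 1) fun r => writeSyndrome (P * (2 * a.k + 1) + r) r)
  (.set 0 (.const (2 ^ a.m * (2 * a.k + 1)) * .lim .L))

theorem eval_powerSumX {n : ℕ} {f : ℕ → ℕ} {σ : State} (hn : 1 ≤ n) (r : ℕ)
    (h5 : σ.reg 5 = bigPrime n) (h6 : ∀ j < bigPrime n, σ.mem 6 j = f j) :
    (powerSumX r).eval (limsOf n) σ = ∑ j ∈ range (bigPrime n), f j * j ^ r := by
  have hq := (bigPrime_spec hn).2.2
  have hsub : range (bigPrime n) ⊆ range (Lim.N.val (limsOf n)) :=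
    range_mono (by simp only [Lim.val, limsOf]; omega)
  rw [powerSumX, X.eval_sum, ← sum_subset hsub]
  · refine sum_congr rfl fun j hj => ?_
    rw [mem_range] at hj
    simp [h5, hj, h6 j hj]
  · intro j _ hj
    rw [mem_range] at hj
    simp [h5, hj]

theorem Segmented.of_frame {a : Par} {P n n' : ℕ} {x : ℕ → ℕ} {σ : State}
    (h : Segmented a P n n' x σ) (c : Cmd)
    (h4 : ¬ c.Puts 4) (h5 : ¬ c.Puts 5) (h6 : ¬ c.Puts 6) :
    Segmented a P n n' x (c.run (limsOf n) σ) := by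
  refine ⟨?_, ?_, ?_⟩
  · rw [Cmd.run_mem _ _ _ h4]; exact h.len
  · rw [Cmd.run_mem _ _ _ h5]; exact h.start
  · rw [Cmd.run_mem _ _ _ h6]; exact h.hash

theorem segSyndrome_lt {n : ℕ} (hn : 1 ≤ n) (a : Par) (n' : ℕ) (x : ℕ → ℕ) (P r : ℕ) :
    segSyndrome a n n' x P r < bigPrime n :=
  Nat.mod_lt _ (bigPrime_spec hn).1.pos

theorem run_writeSyndrome {a : Par} {P n n' : ℕ} {x : ℕ → ℕ} {σ : State} (hn : 1 ≤ n)
    (hσ : Ready a n n' x σ) (hP : Segmented a P n n' x σ) (c r i : ℕ) :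
    ((writeSyndrome c r).run (limsOf n) σ).mem 0 i =
      if c * (limsOf n).L ≤ i ∧ i < (c + 1) * (limsOf n).L then
        segSyndrome a n n' x P r / 2 ^ (i - c * (limsOf n).L) % 2 else σ.mem 0 i := by
  have hp := limsOf_good hn
  have hW := hp.two_le
  have hq := bigPrime_spec hn
  have h4 := four_mul_le n
  have hlt := segSyndrome_lt hn a n' x P r
  set p := limsOf n with hpdef
  set τ := (Cmd.set 6 (X.mod (powerSumX r) (.reg 5))).run p σ with hτ
  have h6 : τ.reg 6 = segSyndrome a n n' x P r := by
    have : (powerSumX r).eval p σ = _ := eval_powerSumX hn r hσ.q fun j hj =>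
      hP.hash j (by simp only [limsOf]; omega)
    simp only [hτ, Cmd.run, X.eval_mod, this, X.eval_reg, hσ.q, setReg_reg, if_true]
    exact min_eq_left (by change segSyndrome a n n' x P r ≤ _; omega)
  have h7 : τ.mem = σ.mem := rfl
  have key := loop_put_induct p 3 .L 0 (.const c * .lim .L + .reg 3)
    (X.mod (.reg 6 / .get 7 (.reg 3)) 2)
    (fun t A => ∀ i, A i = if c * p.L ≤ i ∧ i < c * p.L + t then
      segSyndrome a n n' x P r / 2 ^ (i - c * p.L) % 2 else σ.mem 0 i) (σ := τ)
      (fun i => by rw [if_neg (by omega)]; rfl) ?_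
  · refine (key i).trans ?_
    rw [show Lim.L.val p = p.L from rfl, Nat.succ_mul]
  · intro t ht A hA i
    have ht' : t < p.L := ht
    have e1 : X.eval p (.const c * .lim .L + .reg 3) (withRegMem τ 3 t 0 A) = c * p.L + t := by
      simp [Lim.val]
    have e2 : X.eval p (X.mod (.reg 6 / .get 7 (.reg 3)) 2) (withRegMem τ 3 t 0 A) =
        segSyndrome a n n' x P r / 2 ^ t % 2 := by
      simp [h6, h7, hσ.pow t ht'.le]
    rw [e1, e2, min_eq_left (by omega), Function.update_apply]
    by_cases hi : i = c * p.L + t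
    · subst hi
      rw [if_pos rfl, if_pos (by omega), Nat.add_sub_cancel_left]
    · rw [if_neg hi, hA]
      congr 1
      simp only [eq_iff_iff]
      omega

/-- Syndrome `r` of the pattern `P` occupies the `L` cells from `(P (2k + 1) + r) L` on. The
invariants of the two nested repetitions say that the cells up to the current place are filled. -/
theorem run_hashCmd {a : Par} {n : ℕ} {σ : State} (ha : a.Ok n) (hσ : Bdd (limsOf n).W σ)
    (hn : σ.reg 0 = n) (hx : ∀ i, σ.mem 0 i < 2)
    (h0 : ∀ i, (limsOf n).N ≤ i → σ.mem 0 i = 0) (h2 : ∀ i, σ.mem 2 i = 0)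
    (h9 : ∀ i, σ.mem 9 i = 0) :
    ((hashCmd a).run (limsOf n) σ).reg 0 = 2 ^ a.m * (2 * a.k + 1) * (limsOf n).L ∧
    ∀ i < 2 ^ a.m * (2 * a.k + 1) * (limsOf n).L,
      ((hashCmd a).run (limsOf n) σ).mem 0 i = hashBit a n (σ.mem 0) i := by
  set p := limsOf n with hpdef
  set K := 2 * a.k + 1 with hK
  have hLpos := two_le_L ha.n_pos
  set τ := (setup a).run p σ with hτ
  have r1 : Ready a n n (σ.mem 0) τ := by
    have := run_setup ha hσ h0 h2 h9
    rwa [hn] at this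
  set x := σ.mem 0 with hxdef
  have key := rep_induct p (2 ^ a.m) (fun P => .seq (segments a P) <|
    .rep K fun r => writeSyndrome (P * K + r) r)
    (fun P υ => Ready a n n x υ ∧ ∀ i < P * K * p.L, υ.mem 0 i = hashBit a n x i) (σ := τ)
    ⟨r1, by simp⟩ ?_
  · have hW : 2 ^ a.m * K * p.L ≤ p.W := by
      have h1 : p.L ≤ p.N := Nat.clog_le_of_le_pow Nat.lt_two_pow_self.le
      have h2 : 2 ^ a.m * K ≤ p.N := by
        have : 2 ^ a.m * K ≤ n := ha.large
        simp only [hpdef, limsOf]; omega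
      exact Nat.mul_le_mul h2 h1
    refine ⟨?_, fun i hi => ?_⟩
    · simp only [hashCmd, Cmd.run, setReg_reg, if_true, X.eval_mul, X.eval_const, X.eval_lim,
        Lim.val]
      exact min_eq_left hW
    · exact key.2 i hi
  · rintro P hP υ ⟨g1, g2⟩
    set υ1 := (segments a P).run p υ with hυ1
    have s1 : Segmented a P n n x υ1 := run_segments ha hx le_rfl g1
    have s2 : Ready a n n x υ1 := g1.of_frame _ (by simp [segments, Cmd.Sets])
      (by simp [segments, Cmd.Sets]) (by simp [segments, Cmd.Puts]) (by simp [segments, Cmd.Puts])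
      (by simp [segments, Cmd.Puts])
    have s3 : υ1.mem 0 = υ.mem 0 := Cmd.run_mem _ _ _ (by simp [segments, Cmd.Puts])
    have := rep_induct p K (fun r => writeSyndrome (P * K + r) r)
      (fun r ρ => Ready a n n x ρ ∧ Segmented a P n n x ρ ∧
        ∀ i < (P * K + r) * p.L, ρ.mem 0 i = hashBit a n x i) (σ := υ1)
      ⟨s2, s1, by rw [s3]; exact g2⟩ ?_
    · refine ⟨this.1, ?_⟩
      rw [Nat.succ_mul]
      exact this.2.2
    · rintro r hr ρ ⟨t1, t2, t3⟩
      refine ⟨t1.of_frame _ (by simp [writeSyndrome, Cmd.Sets]) (by simp [writeSyndrome, Cmd.Sets])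
        (by simp [writeSyndrome, Cmd.Puts]) (by simp [writeSyndrome, Cmd.Puts])
        (by simp [writeSyndrome, Cmd.Puts]), t2.of_frame _ (by simp [writeSyndrome, Cmd.Puts])
        (by simp [writeSyndrome, Cmd.Puts]) (by simp [writeSyndrome, Cmd.Puts]), fun i hi => ?_⟩
      rw [run_writeSyndrome ha.n_pos t1 t2, ← hpdef]
      split_ifs with h
      · have e1 : i / p.L = P * K + r := by
          have hL0 : 0 < p.L := by have : 2 ≤ p.L := hLpos; omega
          rw [Nat.div_eq_iff hL0]
          rw [Nat.succ_mul] at h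
          constructor
          · exact h.1
          · have := h.2; change i ≤ (P * K + r) * p.L + p.L - 1; omega
        have e2 : i % p.L = i - (P * K + r) * p.L := by
          rw [Nat.mod_def, e1, mul_comm]
        have e3 : (P * K + r) / K = P := by
          rw [mul_comm, Nat.mul_add_div (by omega), Nat.div_eq_of_lt hr, add_zero]
        have e4 : (P * K + r) % K = r := by
          rw [mul_comm, Nat.mul_add_mod, Nat.mod_eq_of_lt hr]
        rw [hashBit, e1, e2, e3, e4]
      · refine t3 i ?_
        by_contra h'
        exact h ⟨not_lt.1 h', hi⟩

theorem fits_hashX (a : Par) : (hashX a).Fits false true := by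
  simp [hashX, maxLenX, blocksX, codeX, X.fits_lookup]

theorem fits_segments (a : Par) (P : ℕ) : (segments a P).Fits true true := by
  simp [segments, Cmd.Fits, fits_hashX, occX]

theorem fits_setup (a : Par) : (setup a).Fits true true := by
  simp [setup, Cmd.Fits, powers, sieve, findPrime]

theorem fits_hashCmd (a : Par) : (hashCmd a).Fits true true := by
  simp [hashCmd, Cmd.Fits, fits_setup, fits_segments, writeSyndrome, powerSumX, X.fits_pow]

end Codec

namespace BLoop

/-- A loop that looks for an index with the property `Q`. -/
theorem run_search {p : Lims} (hp : p.N ≤ p.W) {w : ℕ} (hw : w ≠ 2) (E : X) (Q : ℕ → Prop)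
    (σ : RAM.State)
    (hE : ∀ i < p.N, ∀ τ : RAM.State, τ.mem = σ.mem → (∀ r, r ≠ 2 → r ≠ w → τ.reg r = σ.reg r) →
      τ.reg 2 = i → (0 < E.eval p τ ↔ Q i)) (hQ : ∃ i < p.N, Q i) :
    Q (((Cmd.loop 2 .N (.ite E (.set w (.reg 2)) .skip)).run p σ).reg w) := by
  have key := loop_induct p 2 .N (.ite E (.set w (.reg 2)) .skip)
    (fun i τ => τ.mem = σ.mem ∧ (∀ r, r ≠ 2 → r ≠ w → τ.reg r = σ.reg r) ∧
      ((∃ j < i, Q j) → Q (τ.reg w))) (σ := σ) ⟨rfl, fun _ _ _ => rfl, by simp⟩ ?_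
  · exact key.2.2 hQ
  · rintro i hi τ ⟨h1, h2, h3⟩
    have hiN : i < p.N := hi
    have hcond := hE i hi (setReg τ 2 i) h1 (fun r hr hrw => by simp [hr, h2 r hr hrw]) (by simp)
    simp only [Cmd.run]
    split_ifs with h
    · refine ⟨h1, fun r hr hrw => by simp [hr, hrw, h2 r hr hrw], fun _ => ?_⟩
      have : min i p.W = i := min_eq_left (by omega)
      simpa [this] using hcond.1 h
    · refine ⟨h1, fun r hr hrw => by simp [hr, h2 r hr hrw], ?_⟩
      rintro ⟨j, hj, hQj⟩
      simp only [setReg_reg, if_neg hw]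
      refine h3 ⟨j, ?_, hQj⟩
      rcases Nat.lt_succ_iff_lt_or_eq.1 hj with hj | rfl
      · exact hj
      · exact absurd (hcond.2 hQj) h

end BLoop

/-! ### Error correction over the prime field by exhaustive search -/

namespace Codec

open BLoop RAM Finset Split Hankel

/-! ### The correction of the hashes of the segments -/

theorem sum_zmod {q : ℕ} [NeZero q] {M : Type*} [AddCommMonoid M] (f : ZMod q → M) :
    ∑ z, f z = ∑ j ∈ range q, f j :=
  sum_nbij' (fun z => z.val) (fun j => (j : ZMod q)) (fun z _ => mem_range.2 (ZMod.val_lt z))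
    (fun _ _ => mem_univ _) (fun z _ => by simp)
    (fun j hj => ZMod.val_cast_of_lt (mem_range.1 hj)) (fun z _ => by simp)

/-- The difference of the vectors `T` and `A` of length `q`. -/
def errorVec (q : ℕ) (T A : ℕ → ℕ) (z : ZMod q) : ZMod q := T z.val - A z.val

theorem syndrome_errorVec {q : ℕ} [Fact q.Prime] (T A : ℕ → ℕ) (r : ℕ) :
    syndrome (errorVec q T A) r =
      ((∑ j ∈ range q, T j * j ^ r : ℕ) : ZMod q) - ((∑ j ∈ range q, A j * j ^ r : ℕ) : ZMod q) := by
  rw [syndrome, sum_zmod]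
  push_cast
  rw [← sum_sub_distrib]
  refine sum_congr rfl fun j hj => ?_
  rw [errorVec, ZMod.val_cast_of_lt (mem_range.1 hj)]
  ring

noncomputable def modHankelX (r : ℕ) (f : ℕ → X) : X := X.mod (X.hankel 5 r f) (.reg 5)

/-- An `r × r` Hankel matrix involves the syndromes up to `2r - 2` only. The largest one in use has
`r = k + 1`, which is why `2k + 1` syndromes are published. -/
theorem eval_modHankelX {q r : ℕ} [Fact q.Prime] {f : ℕ → X} {S : ℕ → ZMod q} {p : Lims}
    {σ : State} (h5 : σ.reg 5 = q) (hf : ∀ i, i + 1 < 2 * r → (((f i).eval p σ : ℕ) : ZMod q) = S i) :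
    (modHankelX r f).eval p σ = 0 ↔ hdet S r = 0 := by
  have hq : 1 ≤ q := (Fact.out : q.Prime).one_le
  have h := X.cast_eval_hankel p σ 5 r f (by omega)
  subst h5
  rw [modHankelX, X.eval_mod, X.eval_reg, ← Nat.dvd_iff_mod_eq_zero, ← ZMod.natCast_eq_zero_iff, h]
  have : (Matrix.of fun i j : Fin r => (((f (i + j)).eval p σ : ℕ) : ZMod (σ.reg 5))) =
      Matrix.of fun i j : Fin r => S (i + j) := by
    ext i j
    exact hf _ (by have := i.2; have := j.2; omega)
  rw [this]
  rfl

/-- The entries are the syndromes after the value `1` has been subtracted at the candidate position;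
`q - 1` plays the role of `-1`. -/
noncomputable def findPosition (e : ℕ) : Cmd :=
  .loop 2 .N (.ite (X.lt (.reg 2) (.reg 5) * X.eq (modHankelX (e + 1) fun r =>
    .get 10 (.const r) + (.reg 5 - 1) * X.pow (.reg 2) r) 0) (.set 6 (.reg 2)) .skip)

noncomputable def findValue (e : ℕ) : Cmd :=
  .loop 2 .N (.ite (X.lt (.reg 2) (.reg 5) * X.eq (modHankelX e fun r =>
    .get 10 (.const r) + (.reg 5 - 1) * (.reg 2 * X.pow (.reg 6) r)) 0) (.set 7 (.reg 2)) .skip)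

def correctSyndromes (k : ℕ) : Cmd :=
  .rep (2 * k + 1) fun r => .put 10 (.const r)
    (X.mod (.get 10 (.const r) + (.reg 5 - 1) * (.reg 7 * X.pow (.reg 6) r)) (.reg 5))

/-- If there are `e` errors then one of them is corrected. -/
noncomputable def fixError (k e : ℕ) : Cmd :=
  .ite (modHankelX e fun r => .get 10 (.const r))
    (.seq (findPosition e) <| .seq (findValue e) <|
      .seq (.put 6 (.reg 6) (X.mod (.get 6 (.reg 6) + .reg 7) (.reg 5))) (correctSyndromes k)) .skip

/-- The vector `T` is the unknown truth. The stored syndromes are kept equal to those of the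
difference between `T` and the current array `6`, whose number of errors is bounded by `e`. -/
structure Fixing (k q : ℕ) [Fact q.Prime] (T : ℕ → ℕ) (e : ℕ) (σ : State) : Prop where
  reg : σ.reg 5 = q
  lt : ∀ j < q, σ.mem 6 j < q
  syn : ∀ r ≤ 2 * k, (σ.mem 10 r : ZMod q) = syndrome (errorVec q T (σ.mem 6)) r
  card : (errors (errorVec q T (σ.mem 6))).card ≤ e

theorem run_findPosition {p : Lims} {k q e : ℕ} [Fact q.Prime] {T : ℕ → ℕ} {σ : State}
    (hp : p.N ≤ p.W) (hq : q ≤ p.N) (he : e ≤ k) (hσ : Fixing k q T e σ)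
    (hc : (errors (errorVec q T (σ.mem 6))).card = e) (h0 : 0 < e) :
    ((findPosition e).run p σ).reg 6 < q ∧
      (((findPosition e).run p σ).reg 6 : ZMod q) ∈ errors (errorVec q T (σ.mem 6)) := by
  refine run_search hp (by norm_num) _
    (fun y => y < q ∧ (y : ZMod q) ∈ errors (errorVec q T (σ.mem 6))) σ ?_ ?_
  · intro i hi τ h1 h2 h3
    have h5 : τ.reg 5 = q := by rw [h2 5 (by norm_num) (by norm_num), hσ.reg]
    have hq1 : 1 ≤ q := (Fact.out : q.Prime).one_le
    have key : (modHankelX (e + 1) fun r => .get 10 (.const r) + (.reg 5 - 1) *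
        X.pow (.reg 2) r).eval p τ = 0 ↔ (i : ZMod q) ∈ errors (errorVec q T (σ.mem 6)) := by
      rw [← hdet_eq_zero_iff_mem _ hc]
      refine eval_modHankelX h5 fun r hr => ?_
      simp [h1, h3, h5, hσ.syn r (by omega), syndrome_correct, Nat.cast_sub hq1]
      ring
    simp only [X.eval_mul, X.eval_lt, X.eval_eq, X.eval_reg, X.eval_ofNat, h3, h5, key]
    split_ifs <;> simp_all
  · obtain ⟨z, hz⟩ := card_pos.1 (hc ▸ h0)
    have := z.val_lt
    exact ⟨z.val, by omega, this, by simpa using hz⟩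

theorem run_findValue {p : Lims} {k q e : ℕ} [Fact q.Prime] {T : ℕ → ℕ} {σ : State}
    (hp : p.N ≤ p.W) (hq : q ≤ p.N) (he : e ≤ k) (hσ : Fixing k q T e σ)
    (hc : (errors (errorVec q T (σ.mem 6))).card = e)
    (hy : (σ.reg 6 : ZMod q) ∈ errors (errorVec q T (σ.mem 6))) :
    ((findValue e).run p σ).reg 7 < q ∧
      (((findValue e).run p σ).reg 7 : ZMod q) = errorVec q T (σ.mem 6) (σ.reg 6) := by
  refine run_search hp (by norm_num) _
    (fun v => v < q ∧ (v : ZMod q) = errorVec q T (σ.mem 6) (σ.reg 6)) σ ?_ ?_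
  · intro i hi τ h1 h2 h3
    have h5 : τ.reg 5 = q := by rw [h2 5 (by norm_num) (by norm_num), hσ.reg]
    have h6 : τ.reg 6 = σ.reg 6 := h2 6 (by norm_num) (by norm_num)
    have hq1 : 1 ≤ q := (Fact.out : q.Prime).one_le
    have key : (modHankelX e fun r => .get 10 (.const r) + (.reg 5 - 1) *
        (.reg 2 * X.pow (.reg 6) r)).eval p τ = 0 ↔
        (i : ZMod q) = errorVec q T (σ.mem 6) (σ.reg 6) := by
      rw [← hdet_eq_zero_iff_eq _ hc hy]
      refine eval_modHankelX h5 fun r hr => ?_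
      simp [h1, h3, h5, h6, hσ.syn r (by omega), syndrome_correct, Nat.cast_sub hq1]
      ring
    simp only [X.eval_mul, X.eval_lt, X.eval_eq, X.eval_reg, X.eval_ofNat, h3, h5, key]
    split_ifs <;> simp_all
  · set z := errorVec q T (σ.mem 6) (σ.reg 6)
    have := z.val_lt
    exact ⟨z.val, by omega, this, by simp⟩

theorem run_correctSyndromes {p : Lims} {k q : ℕ} [Fact q.Prime] {σ : State} (hq : q ≤ p.W)
    (h5 : σ.reg 5 = q) : ∀ r ≤ 2 * k, (((correctSyndromes k).run p σ).mem 10 r : ZMod q) =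
      σ.mem 10 r - σ.reg 7 * (σ.reg 6 : ZMod q) ^ r := by
  have hq1 : 1 ≤ q := (Fact.out : q.Prime).one_le
  have key := rep_induct p (2 * k + 1) (fun r => .put 10 (.const r)
    (X.mod (.get 10 (.const r) + (.reg 5 - 1) * (.reg 7 * X.pow (.reg 6) r)) (.reg 5)))
    (fun i τ => τ.reg = σ.reg ∧ ∀ r, (τ.mem 10 r : ZMod q) = if r < i then
      σ.mem 10 r - σ.reg 7 * (σ.reg 6 : ZMod q) ^ r else σ.mem 10 r) (σ := σ) ⟨rfl, by simp⟩ ?_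
  · intro r hr
    rw [← if_pos (c := r < 2 * k + 1) (by omega) (t := (σ.mem 10 r - σ.reg 7 *
      (σ.reg 6 : ZMod q) ^ r : ZMod q)) (e := (σ.mem 10 r : ZMod q))]
    exact key.2 r
  · rintro i hi τ ⟨h1, h2⟩
    refine ⟨h1, fun r => ?_⟩
    have h3 := h2 i
    rw [if_neg (lt_irrefl _)] at h3
    have hlt := Nat.mod_lt (X.eval p (.get 10 (.const i) + (.reg 5 - 1) *
      (.reg 7 * X.pow (.reg 6) i)) τ) hq1
    simp only [Cmd.run, X.eval_mod, X.eval_reg, h1, h5, X.eval_const]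
    rw [min_eq_left (by omega)]
    simp only [setMem_mem, if_true, Function.update_apply]
    by_cases hr : r = i
    · subst hr
      simp [h3, h1, h5, Nat.cast_sub hq1]
      ring
    · have : r < i + 1 ↔ r < i := by omega
      simp only [hr, if_false, h2 r, this]

/-- If the determinant vanishes, there are fewer than `e + 1` errors and nothing has to be done.
Otherwise there are exactly `e + 1`, so that the tests for positions and values apply and one error
is removed. -/
theorem Fixing.run_fixError {p : Lims} {k q e : ℕ} [Fact q.Prime] {T : ℕ → ℕ} {σ : State}
    (hp : p.N ≤ p.W) (hq : q ≤ p.N) (he : e + 1 ≤ k) (hσ : Fixing k q T (e + 1) σ) :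
    Fixing k q T e ((fixError k (e + 1)).run p σ) := by
  have hq1 : 1 ≤ q := (Fact.out : q.Prime).one_le
  have h0 : (modHankelX (e + 1) fun r => .get 10 (.const r)).eval p σ = 0 ↔
      hdet (syndrome (errorVec q T (σ.mem 6))) (e + 1) = 0 :=
    eval_modHankelX hσ.reg fun r hr => by simpa using hσ.syn r (by omega)
  simp only [fixError, Cmd.run]
  split_ifs with h
  · have hc : (errors (errorVec q T (σ.mem 6))).card = e + 1 := by
      by_contra hne
      have := h0.2 (hdet_eq_zero _ (lt_of_le_of_ne hσ.card hne))
      omega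
    set τ1 := (findPosition (e + 1)).run p σ with hτ1
    obtain ⟨hy1, hy2⟩ := run_findPosition hp hq he hσ hc (Nat.succ_pos _)
    rw [← hτ1] at hy1 hy2
    have m1 : τ1.mem 6 = σ.mem 6 := Cmd.run_mem _ _ _ (by simp [findPosition, Cmd.Puts])
    have f1 : Fixing k q T (e + 1) τ1 := by
      refine ⟨?_, ?_, ?_, ?_⟩
      · rw [hτ1, Cmd.run_reg _ _ _ (by simp [findPosition, Cmd.Sets]), hσ.reg]
      · rw [m1]; exact hσ.lt
      · rw [m1, hτ1, Cmd.run_mem _ _ _ (by simp [findPosition, Cmd.Puts])]; exact hσ.syn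
      · rw [m1]; exact hσ.card
    rw [← m1] at hc hy2
    obtain ⟨hv1, hv2⟩ := run_findValue hp hq he f1 hc hy2
    set τ2 := (findValue (e + 1)).run p τ1 with hτ2
    have m2 : τ2.mem = τ1.mem := by
      ext a : 1; exact Cmd.run_mem _ _ _ (by simp [findValue, Cmd.Puts])
    have q2 : τ2.reg 5 = q := by
      rw [hτ2, Cmd.run_reg _ _ _ (by simp [findValue, Cmd.Sets]), f1.reg]
    have y2 : τ2.reg 6 = τ1.reg 6 := Cmd.run_reg _ _ _ (by simp [findValue, Cmd.Sets])
    set y := τ1.reg 6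
    set v := τ2.reg 7 with hv
    set A := τ1.mem 6 with hA
    have hlt := Nat.mod_lt (A y + v) hq1
    have hrun : setMem τ2 6 (X.eval p (.reg 6) τ2)
        (min (X.eval p (X.mod (.get 6 (.reg 6) + .reg 7) (.reg 5)) τ2) p.W) =
        setMem τ2 6 y ((A y + v) % q) := by
      simp only [X.eval_mod, X.eval_add, X.eval_reg, X.eval_get, y2, q2, m2, ← hA, ← hv]
      rw [min_eq_left (by omega)]
    rw [hrun]
    set τ3 := setMem τ2 6 y ((A y + v) % q) with hτ3
    have m3 : ((correctSyndromes k).run p τ3).mem 6 = Function.update A y ((A y + v) % q) := by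
      rw [Cmd.run_mem _ _ _ (by simp [correctSyndromes, Cmd.Puts]), hτ3, setMem_mem, if_pos rfl, m2]
    have herr : errorVec q T (Function.update A y ((A y + v) % q)) =
        correct (errorVec q T A) y (errorVec q T A y) := by
      ext z
      rw [← hv2, errorVec, correct, errorVec, Function.update_apply]
      by_cases hz : z = (y : ZMod q)
      · have : z.val = y := by rw [hz, ZMod.val_cast_of_lt hy1]
        rw [this, if_pos rfl, if_pos hz, ZMod.natCast_mod]
        push_cast
        ring
      · have : z.val ≠ y := fun h => hz (by rw [← h]; simp)
        simp [this, hz]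
    refine ⟨?_, ?_, ?_, ?_⟩
    · rw [Cmd.run_reg _ _ _ (by simp [correctSyndromes, Cmd.Sets])]
      exact q2
    · rw [m3]
      intro j hj
      rw [Function.update_apply]
      split_ifs
      · exact hlt
      · exact f1.lt j hj
    · rw [m3, herr]
      intro r hr
      rw [run_correctSyndromes (hq.trans hp) (show τ3.reg 5 = q from q2) r hr, syndrome_correct, ← hv2]
      have e1 : τ3.mem 10 r = τ1.mem 10 r := by rw [hτ3, setMem_mem, if_neg (by norm_num), m2]
      have e2 : τ3.reg 6 = y := y2
      have e3 : τ3.reg 7 = v := rfl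
      rw [e1, e2, e3, f1.syn r hr]
    · rw [m3, herr, errors_correct _ hy2, card_erase_of_mem hy2]
      omega
  · have hdz := h0.1 (by omega)
    refine ⟨hσ.reg, hσ.lt, hσ.syn, ?_⟩
    by_contra hcard
    exact hdet_ne_zero _ (le_antisymm hσ.card (by omega)) hdz

noncomputable def fixErrors (k : ℕ) : Cmd := .rep k fun i => fixError k (k - i)

/-- The bound on the number of errors descends from `k` to `0`. Congruence modulo `q` then becomes
equality, as all entries are below `q`. -/
theorem Fixing.run_fixErrors {p : Lims} {k q : ℕ} [Fact q.Prime] {T : ℕ → ℕ} {σ : State}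
    (hp : p.N ≤ p.W) (hq : q ≤ p.N) (hσ : Fixing k q T k σ) (hT : ∀ j < q, T j < q) :
    ∀ j < q, ((fixErrors k).run p σ).mem 6 j = T j := by
  have key := rep_induct p k (fun i => fixError k (k - i)) (fun i τ => Fixing k q T (k - i) τ)
    (σ := σ) hσ fun i hi τ hτ => by
      obtain ⟨e, rfl⟩ : ∃ e, k = e + 1 + i := ⟨k - i - 1, by omega⟩
      rw [show e + 1 + i - i = e + 1 by omega] at hτ ⊢
      rw [show e + 1 + i - (i + 1) = e by omega]
      exact hτ.run_fixError hp hq (by omega)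
  intro j hj
  have h1 := key.card
  rw [Nat.sub_self, Nat.le_zero, card_eq_zero] at h1
  have h2 : (j : ZMod q) ∉ errors (errorVec q T (((fixErrors k).run p σ).mem 6)) := by
    rw [fixErrors, h1]; simp
  rw [mem_errors, not_not, errorVec, ZMod.val_cast_of_lt hj, sub_eq_zero,
    ZMod.natCast_eq_natCast_iff', Nat.mod_eq_of_lt (hT j hj), 
    Nat.mod_eq_of_lt (show ((fixErrors k).run p σ).mem 6 j < q from key.lt j hj)] at h2
  exact h2.symm

end Codec

/-! ### Decoding with one clean pattern -/

namespace Codec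

open BLoop RAM Finset Split Hankel

/-! ### The original string from the hashes of its segments -/

/-- The syndromes of the differences between the hashes of the segments of the original string,
which are given by the array `1`, and those in the array `6`. -/
def loadSyndromes (a : Par) (P : ℕ) : Cmd :=
  .rep (2 * a.k + 1) fun r => .put 10 (.const r) (X.mod (.sum 3 .L (.get 7 (.reg 3) *
    .get 1 (.const (P * (2 * a.k + 1) + r) * .lim .L + .reg 3)) +
      (.reg 5 - 1) * powerSumX r) (.reg 5))

/-- The starts of the segments of the original string are stored in the array `12`, and the segments
of its positions in the array `13`. -/
def positions (a : Par) : Cmd :=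
  .seq (.put 12 0 0) <|
  .seq (.loop 2 .N (.put 12 (.reg 2 + 1) (.get 12 (.reg 2) + X.lt (.reg 2) (.reg 5) *
    X.mod (.get 6 (.reg 2)) (maxLenX a)))) <|
  .seq (.put 13 0 0) <|
  .loop 2 .N (.put 13 (.reg 2 + 1) (.get 13 (.reg 2) +
    X.lt (.reg 2 + 1) (.lim .N / 2) * X.eq (.reg 2 + 1) (.get 12 (.get 13 (.reg 2) + 1))))

/-- The offset of a position in its segment. -/
def offsetX : X := .reg 2 - .get 12 (.get 13 (.reg 2))

/-- The code of the block of a position. -/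
def blockX (a : Par) : X :=
  X.lookup (fun e => a.ψ (e / 2 ^ a.B) (e % 2 ^ a.B)) (a.nc * 2 ^ a.B)
    (X.mod (.get 6 (.get 13 (.reg 2)) / maxLenX a / .get 8 (offsetX / .const a.B)) (.const a.nc) *
      .const (2 ^ a.B) + codeX a (a.B - a.k) (.get 13 (.reg 2)) (offsetX / .const a.B))

def bitX (a : Par) : X :=
  X.csum a.B fun u => X.eq (X.mod offsetX (.const a.B)) (.const u) *
    X.mod (blockX a / .const (2 ^ u)) 2

/-- The bits that are found by means of the pattern `P` are added to the array `14`. -/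
noncomputable def vote (a : Par) (P : ℕ) : Cmd :=
  .seq (segments a P) <| .seq (loadSyndromes a P) <| .seq (fixErrors a.k) <|
    .seq (positions a) (.loop 2 .N (.put 14 (.reg 2) (.get 14 (.reg 2) + bitX a)))

structure Deleted (a : Par) (n n' : ℕ) (x x' f : ℕ → ℕ) : Prop where
  emb : Emb n n' x x' f
  le : n - n' ≤ a.k
  lt_two : ∀ i, x i < 2
  segLen_le : ∀ P < 2 ^ a.m, ∀ j, segLen a.m P n x j ≤ Params.maxLen a.k a.B (limsOf n).L

theorem Deleted.segHash_lt {a : Par} {n n' : ℕ} {x x' f : ℕ → ℕ} (h : Deleted a n n' x x' f)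
    (ha : a.Ok n) {P : ℕ} (hP : P < 2 ^ a.m) (j : ℕ) :
    segHash a (limsOf n).L P n x j < bigPrime n := by
  have h1 := Codec.segHash_lt ha (h.segLen_le P hP j)
  have h2 := (bigPrime_spec ha.n_pos).2.1
  omega

/-- Segments without a deletion are the same in both strings and have equal hashes, and at most `k`
segments contain a deletion. -/
theorem Deleted.card_errors_le {a : Par} {n n' : ℕ} {x x' f : ℕ → ℕ} [Fact (bigPrime n).Prime]
    (h : Deleted a n n' x x' f) (ha : a.Ok n) {P : ℕ} (hc : Clean a.m P n n' x x' f) {A : ℕ → ℕ}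
    (hA : ∀ j < bigPrime n, A j = segHash a (limsOf n).L P n' x' j % bigPrime n) :
    (errors (errorVec (bigPrime n) (segHash a (limsOf n).L P n x) A)).card ≤ a.k := by
  refine le_trans ?_ ((card_loss_ne_zero_le (m := a.m) (P := P) h.emb
    (range (bigPrime n))).trans h.le)
  refine (card_le_card (t := ((range (bigPrime n)).filter fun j =>
    loss a.m P n n' x f j ≠ 0).image fun j : ℕ => (j : ZMod (bigPrime n))) ?_).trans card_image_le
  intro z hz
  refine mem_image.2 ⟨z.val, mem_filter.2 ⟨mem_range.2 z.val_lt, fun h0 => ?_⟩, by simp⟩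
  rw [mem_errors] at hz
  refine hz ?_
  obtain ⟨h1, h2⟩ := hc.seg_eq_of_loss h.emb ha.m_pos h0
  have : segHash a (limsOf n).L P n' x' z.val = segHash a (limsOf n).L P n x z.val := by
    simp only [segHash, h1, blockCode, h2]
  rw [errorVec, hA _ z.val_lt, this, ZMod.natCast_mod, sub_self]

/-- A syndrome is less than `q ≤ 2n < 2^L`, so its `L` published bits determine it. -/
theorem sum_hashBit {a : Par} {n : ℕ} (hn : 1 ≤ n) (x : ℕ → ℕ) (P : ℕ) {r : ℕ} (hr : r ≤ 2 * a.k) :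
    ∑ t ∈ range (limsOf n).L, 2 ^ t *
      hashBit a n x ((P * (2 * a.k + 1) + r) * (limsOf n).L + t) = segSyndrome a n n x P r := by
  have hL := two_le_L hn
  have h1 : segSyndrome a n n x P r < 2 ^ (limsOf n).L := by
    have h1 := segSyndrome_lt hn a n x P r
    have h2 := (bigPrime_spec hn).2.2
    have h3 : 2 * n + 1 ≤ 2 ^ (limsOf n).L := N_le_two_pow n
    omega
  rw [← Block.sum_div_mod (b := 2) (by norm_num) h1]
  refine sum_congr rfl fun t ht => ?_
  rw [mem_range] at ht
  have e1 : ((P * (2 * a.k + 1) + r) * (limsOf n).L + t) / (limsOf n).L = P * (2 * a.k + 1) + r := by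
    rw [mul_comm, Nat.mul_add_div (by omega), Nat.div_eq_of_lt ht, add_zero]
  have e2 : ((P * (2 * a.k + 1) + r) * (limsOf n).L + t) % (limsOf n).L = t := by
    rw [mul_comm, Nat.mul_add_mod, Nat.mod_eq_of_lt ht]
  have e3 : (P * (2 * a.k + 1) + r) / (2 * a.k + 1) = P := by
    rw [mul_comm, Nat.mul_add_div (by omega), Nat.div_eq_of_lt (by omega), add_zero]
  have e4 : (P * (2 * a.k + 1) + r) % (2 * a.k + 1) = r := by
    rw [mul_comm, Nat.mul_add_mod, Nat.mod_eq_of_lt (by omega)]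
  rw [hashBit, e1, e2, e3, e4]

/-- Syndromes are linear in the vector, so those of the difference are obtained from the published
ones and those of the hashes computed from the received string. -/
theorem run_loadSyndromes {a : Par} {n n' : ℕ} {x x' : ℕ → ℕ} [Fact (bigPrime n).Prime]
    (ha : a.Ok n) {P : ℕ} (hP : P < 2 ^ a.m) {σ : State} (hσ : Ready a n n' x' σ)
    (h1 : ∀ i < 2 ^ a.m * (2 * a.k + 1) * (limsOf n).L, σ.mem 1 i = hashBit a n x i) :
    ∀ r ≤ 2 * a.k, (((loadSyndromes a P).run (limsOf n) σ).mem 10 r : ZMod (bigPrime n)) =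
      syndrome (errorVec (bigPrime n) (segHash a (limsOf n).L P n x) (σ.mem 6)) r := by
  obtain ⟨hq1, hq2, hq3⟩ := bigPrime_spec ha.n_pos
  have hW := four_mul_le n
  set q := bigPrime n with hq
  have key := rep_induct (limsOf n) (2 * a.k + 1) (fun r => .put 10 (.const r) (X.mod (.sum 3 .L
      (.get 7 (.reg 3) * .get 1 (.const (P * (2 * a.k + 1) + r) * .lim .L + .reg 3)) +
      (.reg 5 - 1) * powerSumX r) (.reg 5)))
    (fun i τ => τ.reg = σ.reg ∧ (∀ b, b ≠ 10 → τ.mem b = σ.mem b) ∧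
      ∀ r < i, (τ.mem 10 r : ZMod q) =
        syndrome (errorVec q (segHash a (limsOf n).L P n x) (σ.mem 6)) r)
    (σ := σ) ⟨rfl, fun _ _ => rfl, by simp⟩ ?_
  · exact fun r hr => key.2.2 r (by omega)
  · rintro r hr τ ⟨g1, g2, g3⟩
    refine ⟨g1, fun b hb => by simp [Cmd.run, hb, g2 b hb], fun r' hr' => ?_⟩
    rcases Nat.lt_succ_iff_lt_or_eq.1 hr' with h | rfl
    · have : r' ≠ r := by omega
      simpa [Cmd.run, this] using g3 r' h
    · have hsum : X.eval (limsOf n) (.sum 3 .L (.get 7 (.reg 3) *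
          .get 1 (.const (P * (2 * a.k + 1) + r') * .lim .L + .reg 3))) τ =
          segSyndrome a n n x P r' := by
        rw [← sum_hashBit ha.n_pos x P (by omega), X.eval_sum]
        refine sum_congr rfl fun t ht => ?_
        have ht' : t < (limsOf n).L := mem_range.1 ht
        have hlt : (P * (2 * a.k + 1) + r') * (limsOf n).L + t <
            2 ^ a.m * (2 * a.k + 1) * (limsOf n).L := by
          have e1 : P * (2 * a.k + 1) + r' + 1 ≤ 2 ^ a.m * (2 * a.k + 1) := by
            have := Nat.mul_le_mul_right (2 * a.k + 1) (Nat.succ_le_of_lt hP)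
            rw [Nat.succ_mul] at this
            omega
          have e2 := Nat.mul_le_mul_right (limsOf n).L e1
          rw [Nat.succ_mul] at e2
          omega
        simp [g2, hσ.pow t ht'.le, ← h1 _ hlt, Lim.val]
      have hpow : (powerSumX r').eval (limsOf n) τ = ∑ j ∈ range q, σ.mem 6 j * j ^ r' :=
        eval_powerSumX ha.n_pos r' (by rw [g1, hσ.q]) fun j _ => by rw [g2 6 (by norm_num)]
      have hlt := Nat.mod_lt (X.eval (limsOf n) (.sum 3 .L (.get 7 (.reg 3) *
        .get 1 (.const (P * (2 * a.k + 1) + r') * .lim .L + .reg 3)) +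
        (.reg 5 - 1) * powerSumX r') τ) hq1.pos
      simp only [Cmd.run, X.eval_mod, X.eval_reg, g1, hσ.q, X.eval_const, ← hq]
      rw [min_eq_left (by omega)]
      simp only [setMem_mem, if_true, Function.update_self, ZMod.natCast_mod]
      rw [X.eval_add, X.eval_mul, X.eval_sub, hsum, hpow, syndrome_errorVec, X.eval_reg, g1, hσ.q,
        X.eval_ofNat, segSyndrome, ← hq, Nat.cast_add, ZMod.natCast_mod, Nat.cast_mul,
        Nat.cast_sub hq1.one_le]
      have : ((∑ j ∈ range q, segHash a (limsOf n).L P n x j % q * j ^ r' : ℕ) : ZMod q) =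
          ((∑ j ∈ range q, segHash a (limsOf n).L P n x j * j ^ r' : ℕ) : ZMod q) := by
        push_cast [ZMod.natCast_mod]
        rfl
      rw [this]
      simp
      ring

theorem run_positions {a : Par} {n n' : ℕ} {x x' f : ℕ → ℕ} (ha : a.Ok n)
    (h : Deleted a n n' x x' f) {P : ℕ} (hP : P < 2 ^ a.m) {σ : State}
    (h5 : σ.reg 5 = bigPrime n)
    (h6 : ∀ j < bigPrime n, σ.mem 6 j = segHash a (limsOf n).L P n x j) :
    (∀ j ≤ (limsOf n).N, ((positions a).run (limsOf n) σ).mem 12 j = segStart a.m P n x j) ∧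
      ∀ i < n, ((positions a).run (limsOf n) σ).mem 13 i = lab a.m P n x i := by
  have hp := limsOf_good ha.n_pos
  have hNW := hp.N_le
  have hnN : (limsOf n).N = 2 * n + 1 := rfl
  obtain ⟨hq1, hq2, hq3⟩ := bigPrime_spec ha.n_pos
  set p := limsOf n with hpdef
  set σ1 := (Cmd.put 12 0 0).run p σ with e1
  set σ2 := (Cmd.loop 2 .N (.put 12 (.reg 2 + 1) (.get 12 (.reg 2) + X.lt (.reg 2) (.reg 5) *
    X.mod (.get 6 (.reg 2)) (maxLenX a)))).run p σ1 with e2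
  set σ3 := (Cmd.put 13 0 0).run p σ2 with e3
  have e : (positions a).run p σ = (Cmd.loop 2 .N (.put 13 (.reg 2 + 1) (.get 13 (.reg 2) +
    X.lt (.reg 2 + 1) (.lim .N / 2) * X.eq (.reg 2 + 1) (.get 12 (.get 13 (.reg 2) + 1))))).run p
      σ3 := rfl
  have hstart : ∀ j ≤ p.N, σ2.mem 12 j = segStart a.m P n x j := by
    refine loop_recurrence p 2 .N 12 _ _ ?_ ?_
    · simp [e1, Cmd.run, segStart]
    · intro i hi A hA
      have g1 := hA i le_rfl
      have g2 := segStart_le a.m P n x (i + 1)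
      have g3 : σ1.mem 6 = σ.mem 6 := by rw [e1, Cmd.run_mem _ _ _ (by simp [Cmd.Puts])]
      have g4 : σ1.reg 5 = bigPrime n := h5
      rw [segStart_succ] at g2 ⊢
      simp only [X.eval_add, X.eval_get, X.eval_reg, withRegMem_reg, withRegMem_mem, if_true, g1,
        X.eval_mul, X.eval_lt, X.eval_mod, eval_maxLenX]
      rw [if_neg (by norm_num : ¬ 5 = 2), if_neg (by norm_num : ¬ 6 = 12), g3, g4]
      by_cases hiq : i < bigPrime n
      · have g5 : segHash a p.L P n x i % (Params.maxLen a.k a.B p.L + 1) = segLen a.m P n x i := by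
          rw [segHash, Nat.add_mul_mod_self_left, Nat.mod_eq_of_lt]
          exact Nat.lt_succ_of_le (h.segLen_le P hP i)
        rw [if_pos hiq, h6 i hiq, g5, one_mul, min_eq_left (by omega)]
      -- The array `6` is corrected below `q` only; from `q > n` on all segments are empty.
      · rw [if_neg hiq, zero_mul, segLen_eq_zero _ _ _ _ (by omega), add_zero,
          min_eq_left (by omega)]
  have hstart3 : ∀ j ≤ p.N, σ3.mem 12 j = segStart a.m P n x j := fun j hj => by
    rw [e3, Cmd.run_mem _ _ _ (by simp [Cmd.Puts]), hstart j hj]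
  -- The recurrence for the labels is valid below `n` only, so the loop keeps the label constant
  -- from the last position on.
  have hlab : ∀ i ≤ p.N, ((positions a).run p σ).mem 13 i = lab a.m P n x (min i (n - 1)) := by
    rw [e]
    refine loop_recurrence p 2 .N 13 _ (fun i => lab a.m P n x (min i (n - 1))) ?_ ?_
    · simp [e3, Cmd.run, lab]
    · intro i hi A hA
      have hi' : i < p.N := hi
      have g1 := hA i le_rfl
      have g2 := lab_le a.m P n x (i + 1)
      have g3 : lab a.m P n x (min i (n - 1)) ≤ min i (n - 1) := lab_le a.m P n x _
      have g4 : p.N / 2 = n := by rw [hnN]; omega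
      simp only [X.eval_add, X.eval_get, X.eval_reg, withRegMem_reg, withRegMem_mem, if_true, g1,
        X.eval_mul, X.eval_lt, X.eval_eq, X.eval_ofNat, X.eval_div, X.eval_lim, Lim.val, g4]
      rw [if_neg (by norm_num : ¬ 12 = 13), hstart3 _ (by omega)]
      by_cases hin : i + 1 < n
      · rw [if_pos hin, one_mul, min_eq_left (by omega : i ≤ n - 1),
          min_eq_left (by omega : i + 1 ≤ n - 1), ← lab_succ_eq _ _ _ _ hin,
          min_eq_left (by omega)]
      · rw [if_neg hin, zero_mul, add_zero, min_eq_right (by omega : n - 1 ≤ i),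
          min_eq_right (by omega : n - 1 ≤ i + 1), min_eq_left]
        have := lab_le a.m P n x (n - 1)
        omega
  refine ⟨fun j hj => ?_, fun i hi => ?_⟩
  · rw [e, Cmd.run_mem _ _ _ (by simp [Cmd.Puts]), hstart3 j hj]
  · rw [hlab i (by omega), min_eq_left (by omega)]

/-- This holds in any state whatsoever, which limits the influence of a spoiled pattern to one vote.
-/
theorem eval_bitX_le {a : Par} (p : Lims) (σ : State) : (bitX a).eval p σ ≤ 1 := by
  simp only [bitX, X.eval_csum, X.eval_mul, X.eval_eq, X.eval_mod, X.eval_const, ite_mul, one_mul,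
    zero_mul, sum_ite_eq]
  split_ifs
  · exact Nat.le_of_lt_succ (Nat.mod_lt _ (by simp))
  · exact Nat.zero_le _

theorem digits_sum {B : ℕ} {u : ℕ → ℕ} (hu : ∀ t, u t < 2) {t : ℕ} (ht : t < B) :
    Block.digits (∑ t ∈ range B, 2 ^ t * u t) t = u t :=
  Block.sum_digits_div_mod (by norm_num) (fun i _ => hu i) ht

/-- The position `i` of the original string determines its segment, its offset and its block. The
colour is a digit of the corrected segment hash, the window is read from the received string at the
same offset in the corresponding segment, and the table `ψ` returns the block. -/
theorem eval_bitX {a : Par} {n n' : ℕ} {x x' f : ℕ → ℕ} (ha : a.Ok n) (hx' : ∀ i, x' i < 2)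
    (h : Deleted a n n' x x' f) {P : ℕ} (hP : P < 2 ^ a.m) (hc : Clean a.m P n n' x x' f)
    {σ : State} {i : ℕ} (hi : i < n) (h2 : σ.reg 2 = i) (hstr : σ.mem 2 = x')
    (hlen : ∀ j < (limsOf n).N, σ.mem 4 j = segLen a.m P n' x' j)
    (hstart : ∀ j < (limsOf n).N, σ.mem 5 j = segStart a.m P n' x' j)
    (h6 : ∀ j < bigPrime n, σ.mem 6 j = segHash a (limsOf n).L P n x j)
    (hcpow : ∀ i ≤ Params.blocks a.k a.B (limsOf n).L, σ.mem 8 i = a.nc ^ i)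
    (h12 : ∀ j < n, σ.mem 12 j = segStart a.m P n x j)
    (h13 : σ.mem 13 i = lab a.m P n x i) :
    (bitX a).eval (limsOf n) σ = x i := by
  set p := limsOf n with hpdef
  have hnN : p.N = 2 * n + 1 := rfl
  obtain ⟨hq1, hq2, hq3⟩ := bigPrime_spec ha.n_pos
  set j := lab a.m P n x i with hj
  have hjn : j < n := lt_of_le_of_lt (lab_le _ _ _ _ _) hi
  obtain ⟨hs1, hs2⟩ := (lab_eq_iff a.m P n x hi j).1 rfl
  rw [segStart_succ] at hs2
  set o := i - segStart a.m P n x j with ho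
  set b := o / a.B with hb
  have hol : o < segLen a.m P n x j := by omega
  have hob : b < Params.blocks a.k a.B p.L := by
    rw [hb, Nat.div_lt_iff_lt_mul ha.B_pos]
    exact hol.trans_le (h.segLen_le P hP j)
  have eoff : offsetX.eval p σ = o := by
    simp only [offsetX, X.eval_sub, X.eval_reg, h2, X.eval_get, h13, h12 j hjn, ho]
  have eb : (offsetX / .const a.B).eval p σ = b := by
    rw [X.eval_div, eoff, X.eval_const, hb]
  have ej : (X.get 13 (.reg 2)).eval p σ = j := by
    simp only [X.eval_get, X.eval_reg, h2, h13]
  set c := blockCode a P n x j b with hcdef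
  set w := ∑ t ∈ range (a.B - a.k), 2 ^ t * seg a.m P n' x' j (b * a.B + t) with hw
  have ecol : (X.mod (.get 6 (.get 13 (.reg 2)) / maxLenX a / .get 8 (offsetX / .const a.B))
      (.const a.nc)).eval p σ = a.φ c := by
    rw [X.eval_mod, X.eval_div, X.eval_div, X.eval_get, ej, X.eval_get, eb, X.eval_const,
      eval_maxLenX, h6 j (by omega), hcpow b hob.le, segHash,
      Nat.add_mul_div_left _ _ (Nat.succ_pos _), Nat.div_eq_of_lt
        (Nat.lt_succ_of_le (h.segLen_le P hP j)), zero_add]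
    exact Block.sum_digits_div_mod a.nc_pos (fun i _ => ha.φ_lt _) hob
  have ewin : (codeX a (a.B - a.k) (.get 13 (.reg 2)) (offsetX / .const a.B)).eval p σ = w := by
    rw [eval_codeX (P := P) (n' := n') (x := x') _ hstr (by rw [ej]; exact hlen j (by omega))
      (by rw [ej]; exact hstart j (by omega)), ej, eb]
  have hwlt : w < 2 ^ a.B := by
    refine (Block.sum_digits_lt (by norm_num) fun t _ => seg_lt_two hx' _ _).trans_le ?_
    exact Nat.pow_le_pow_right (by norm_num) (Nat.sub_le _ _)
  have hclt : c < 2 ^ a.B := Block.sum_digits_lt (by norm_num) fun t _ => seg_lt_two h.lt_two _ _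
  have hcol : a.φ c < a.nc := ha.φ_lt c
  -- The pair of the colour and the window is packed into one index, so that a table with one
  -- argument suffices.
  have eidx : a.φ c * 2 ^ a.B + w < a.nc * 2 ^ a.B := by
    have := Nat.mul_le_mul_right (2 ^ a.B) (Nat.succ_le_of_lt hcol)
    rw [Nat.succ_mul] at this
    omega
  have hsub : (Block.bitList (a.B - a.k) (Block.digits w)).Sublist
      (Block.bitList a.B (Block.digits c)) := by
    have e1 : Block.bitList (a.B - a.k) (Block.digits w) =
        Block.bitList (a.B - a.k) fun t => seg a.m P n' x' j (b * a.B + t) :=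
      Block.bitList_congr fun t ht => digits_sum
        (u := fun t => seg a.m P n' x' j (b * a.B + t)) (fun _ => seg_lt_two hx' _ _) ht
    have e2 : Block.bitList a.B (Block.digits c) =
        Block.bitList a.B fun t => seg a.m P n x j (b * a.B + t) :=
      Block.bitList_congr fun t ht => digits_sum
        (u := fun t => seg a.m P n x j (b * a.B + t)) (fun _ => seg_lt_two h.lt_two _ _) ht
    rw [e1, e2]
    exact hc.sublist_block h.emb ha.m_pos h.le ha.k_le j (b * a.B)
  have ecode : (blockX a).eval p σ = c := by
    have e1 : (X.mod (.get 6 (.get 13 (.reg 2)) / maxLenX a / .get 8 (offsetX / .const a.B))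
        (.const a.nc) * .const (2 ^ a.B) + codeX a (a.B - a.k) (.get 13 (.reg 2))
        (offsetX / .const a.B)).eval p σ = a.φ c * 2 ^ a.B + w := by
      rw [X.eval_add, X.eval_mul, ecol, ewin, X.eval_const]
    rw [blockX, X.eval_lookup _ _ _ _ _ (by rw [e1]; exact eidx), e1]
    have e2 : (a.φ c * 2 ^ a.B + w) / 2 ^ a.B = a.φ c := by
      rw [mul_comm, Nat.mul_add_div (by positivity), Nat.div_eq_of_lt hwlt, add_zero]
    have e3 : (a.φ c * 2 ^ a.B + w) % 2 ^ a.B = w := by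
      rw [mul_comm, Nat.mul_add_mod, Nat.mod_eq_of_lt hwlt]
    simp only [e2, e3]
    exact ha.ψ_eq c hclt w hsub
  have hmod : o % a.B < a.B := Nat.mod_lt _ ha.B_pos
  simp only [bitX, X.eval_csum, X.eval_mul, X.eval_eq, X.eval_mod, X.eval_div, X.eval_const, ite_mul,
    one_mul, zero_mul, sum_ite_eq, eoff, ecode, mem_range, hmod, if_true, X.eval_ofNat]
  have e4 : c / 2 ^ (o % a.B) % 2 = seg a.m P n x j (b * a.B + o % a.B) :=
    digits_sum (u := fun t => seg a.m P n x j (b * a.B + t)) (fun _ => seg_lt_two h.lt_two _ _) hmod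
  rw [e4, hb, mul_comm, Nat.div_add_mod, seg, if_pos hol]
  congr 1
  omega

end Codec

namespace BLoop

/-- A loop that adds values to the cells of an array. -/
theorem loop_add {p : Lims} {a : ℕ} {E : X} {σ : RAM.State}
    (hE : ∀ i < p.N, ∀ A, σ.mem a i + E.eval p (withRegMem σ 2 i a A) ≤ p.W) (j : ℕ) :
    if j < p.N then
      ∃ A, ((Cmd.loop 2 .N (.put a (.reg 2) (.get a (.reg 2) + E))).run p σ).mem a j =
        σ.mem a j + E.eval p (withRegMem σ 2 j a A)
    else ((Cmd.loop 2 .N (.put a (.reg 2) (.get a (.reg 2) + E))).run p σ).mem a j = σ.mem a j := by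
  refine loop_put_induct p 2 .N a (.reg 2) (.get a (.reg 2) + E) (fun i B => ∀ j,
    if j < i then ∃ A, B j = σ.mem a j + E.eval p (withRegMem σ 2 j a A) else B j = σ.mem a j)
    (σ := σ) (fun j => by simp) ?_ j
  intro i hi B hB j
  have h1 := hB i
  rw [if_neg (lt_irrefl i)] at h1
  have h2 : (X.get a (.reg 2) + E).eval p (withRegMem σ 2 i a B) =
      σ.mem a i + E.eval p (withRegMem σ 2 i a B) := by simp [h1]
  rw [h2, min_eq_left (hE i hi B)]
  simp only [X.eval_reg, withRegMem_reg, if_true, Function.update_apply]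
  by_cases hj : j = i
  · subst hj
    rw [if_pos (Nat.lt_succ_self _)]
    exact ⟨B, by simp⟩
  · have : j < i + 1 ↔ j < i := by omega
    simpa only [hj, if_false, this] using hB j

end BLoop

/-! ### Majority decoding -/

namespace Codec

open BLoop RAM Finset Split Hankel

/-! ### The majority over all patterns -/

theorem vote_frame (a : Par) (P : ℕ) :
    (∀ r, r = 1 ∨ r = 5 → ¬ (vote a P).Sets r) ∧
      ∀ b, b = 1 ∨ b = 2 ∨ b = 7 ∨ b = 8 → ¬ (vote a P).Puts b := by
  constructor
  · rintro r (rfl | rfl) <;> simp [vote, segments, loadSyndromes, fixErrors, fixError, findPosition,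
      findValue, correctSyndromes, positions, Cmd.Sets]
  · rintro b (rfl | rfl | rfl | rfl) <;> simp [vote, segments, loadSyndromes, fixErrors, fixError,
      findPosition, findValue, correctSyndromes, positions, Cmd.Puts]

theorem Ready.vote {a : Par} {n n' : ℕ} {x : ℕ → ℕ} {σ : State} (h : Ready a n n' x σ) (P : ℕ) :
    Ready a n n' x ((vote a P).run (limsOf n) σ) := by
  obtain ⟨h1, h2⟩ := vote_frame a P
  exact h.of_frame _ (h1 1 (by simp)) (h1 5 (by simp)) (h2 2 (by simp)) (h2 7 (by simp))
    (h2 8 (by simp))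

/-- The command `vote` without its last loop. -/
noncomputable def prepareVote (a : Par) (P : ℕ) : Cmd :=
  .seq (segments a P) <| .seq (loadSyndromes a P) <| .seq (fixErrors a.k) (positions a)

theorem run_vote (a : Par) (P : ℕ) (p : Lims) (σ : State) : (vote a P).run p σ =
    (Cmd.loop 2 .N (.put 14 (.reg 2) (.get 14 (.reg 2) + bitX a))).run p
      ((prepareVote a P).run p σ) := rfl

theorem prepareVote_mem (a : Par) (P : ℕ) (p : Lims) (σ : State) :
    ((prepareVote a P).run p σ).mem 14 = σ.mem 14 :=
  Cmd.run_mem _ _ _ (by simp [prepareVote, segments, loadSyndromes, fixErrors, fixError,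
    findPosition, findValue, correctSyndromes, positions, Cmd.Puts])

theorem run_vote_bounds {a : Par} {P : ℕ} {p : Lims} {σ : State} (hσ : ∀ i, σ.mem 14 i + 1 ≤ p.W)
    (i : ℕ) : σ.mem 14 i ≤ ((vote a P).run p σ).mem 14 i ∧
      ((vote a P).run p σ).mem 14 i ≤ σ.mem 14 i + 1 := by
  have h := loop_add (p := p) (a := 14) (E := bitX a) (σ := (prepareVote a P).run p σ)
    (fun i _ A => by
      rw [prepareVote_mem]
      exact (Nat.add_le_add_left (eval_bitX_le p _) _).trans (hσ i)) i
  rw [← run_vote, prepareVote_mem] at h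
  split_ifs at h
  · obtain ⟨A, hA⟩ := h
    have := eval_bitX_le (a := a) p (withRegMem ((prepareVote a P).run p σ) 2 i 14 A)
    omega
  · omega

/-- With a clean pattern every stage works as intended, and the vote for each position is the
correct bit. -/
theorem run_vote_of_clean {a : Par} {n n' : ℕ} {x x' f : ℕ → ℕ} (ha : a.Ok n)
    (hx' : ∀ i, x' i < 2) (hn : n' ≤ n) (h : Deleted a n n' x x' f) {P : ℕ} (hP : P < 2 ^ a.m)
    (hc : Clean a.m P n n' x x' f) {σ : State} (hσ : Ready a n n' x' σ)
    (h1 : ∀ i < 2 ^ a.m * (2 * a.k + 1) * (limsOf n).L, σ.mem 1 i = hashBit a n x i)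
    (hW : ∀ i, σ.mem 14 i + 1 ≤ (limsOf n).W) {i : ℕ} (hi : i < n) :
    ((vote a P).run (limsOf n) σ).mem 14 i = σ.mem 14 i + x i := by
  have hp := limsOf_good ha.n_pos
  have hnN : (limsOf n).N = 2 * n + 1 := rfl
  have hspec := bigPrime_spec ha.n_pos
  have : Fact (bigPrime n).Prime := ⟨hspec.1⟩
  set p := limsOf n with hpdef
  set σ1 := (segments a P).run p σ with e1
  set σ2 := (loadSyndromes a P).run p σ1 with e2
  set σ3 := (fixErrors a.k).run p σ2 with e3
  set σ4 := (positions a).run p σ3 with e4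
  have s1 : Segmented a P n n' x' σ1 := run_segments ha hx' hn hσ
  have r1 : Ready a n n' x' σ1 := hσ.of_frame _ (by simp [segments, Cmd.Sets])
    (by simp [segments, Cmd.Sets]) (by simp [segments, Cmd.Puts]) (by simp [segments, Cmd.Puts])
    (by simp [segments, Cmd.Puts])
  have hsyn := run_loadSyndromes (x := x) ha hP r1 (by
    rw [e1, Cmd.run_mem _ _ _ (by simp [segments, Cmd.Puts])]; exact h1)
  have m6 : σ2.mem 6 = σ1.mem 6 := Cmd.run_mem _ _ _ (by simp [loadSyndromes, Cmd.Puts])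
  have r2 : Ready a n n' x' σ2 := r1.of_frame _ (by simp [loadSyndromes, Cmd.Sets])
    (by simp [loadSyndromes, Cmd.Sets]) (by simp [loadSyndromes, Cmd.Puts])
    (by simp [loadSyndromes, Cmd.Puts]) (by simp [loadSyndromes, Cmd.Puts])
  have hfix : Fixing a.k (bigPrime n) (segHash a p.L P n x) a.k σ2 := by
    have hhash : ∀ j < bigPrime n, σ1.mem 6 j = segHash a p.L P n' x' j % bigPrime n :=
      fun j hj => s1.hash j (by change j < p.N; omega)
    refine ⟨r2.q, ?_, ?_, ?_⟩
    · intro j hj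
      rw [m6, hhash j hj]
      exact Nat.mod_lt _ hspec.1.pos
    · rw [m6]; exact hsyn
    · rw [m6]; exact h.card_errors_le ha hc hhash
  have h6 : ∀ j < bigPrime n, σ3.mem 6 j = segHash a p.L P n x j :=
    hfix.run_fixErrors hp.N_le (by omega) fun j _ => h.segHash_lt ha hP j
  have r3 : Ready a n n' x' σ3 := by
    refine r2.of_frame _ ?_ ?_ ?_ ?_ ?_ <;> simp [fixErrors, fixError, findPosition, findValue,
      correctSyndromes, Cmd.Puts, Cmd.Sets]
  obtain ⟨h12, h13⟩ := run_positions ha h hP r3.q h6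
  have r4 : Ready a n n' x' σ4 := by
    refine r3.of_frame _ ?_ ?_ ?_ ?_ ?_ <;> simp [positions, Cmd.Puts, Cmd.Sets]
  have k4 : σ4.mem 4 = σ1.mem 4 := by
    rw [e4, Cmd.run_mem _ _ _ (by simp [positions, Cmd.Puts]), e3, Cmd.run_mem _ _ _ (by
      simp [fixErrors, fixError, findPosition, findValue, correctSyndromes, Cmd.Puts]), e2,
      Cmd.run_mem _ _ _ (by simp [loadSyndromes, Cmd.Puts])]
  have k5 : σ4.mem 5 = σ1.mem 5 := by
    rw [e4, Cmd.run_mem _ _ _ (by simp [positions, Cmd.Puts]), e3, Cmd.run_mem _ _ _ (by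
      simp [fixErrors, fixError, findPosition, findValue, correctSyndromes, Cmd.Puts]), e2,
      Cmd.run_mem _ _ _ (by simp [loadSyndromes, Cmd.Puts])]
  have k6 : σ4.mem 6 = σ3.mem 6 := Cmd.run_mem _ _ _ (by simp [positions, Cmd.Puts])
  have e : (prepareVote a P).run p σ = σ4 := rfl
  have key := loop_add (p := p) (a := 14) (E := bitX a) (σ := (prepareVote a P).run p σ)
    (fun i _ A => by
      rw [prepareVote_mem]
      exact (Nat.add_le_add_left (eval_bitX_le p _) _).trans (hW i)) i
  rw [← run_vote, prepareVote_mem, if_pos (by omega), e] at key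
  obtain ⟨A, hA⟩ := key
  rw [hA, eval_bitX ha hx' h hP hc hi]
  · simp
  · simpa using r4.str
  · simpa [k4] using s1.len
  · simpa [k5] using fun j (hj : j < p.N) => s1.start j hj.le
  · simpa [k6] using h6
  · simpa using r4.cpow
  · simpa using fun j (hj : j < n) => h12 j (by change j ≤ p.N; omega)
  · simpa using h13 i hi

noncomputable def decodeCmd (a : Par) : Cmd :=
  .seq (setup a) <|
  .seq (.rep (2 ^ a.m) (vote a)) <|
  .seq (.loop 2 .N (.put 0 (.reg 2 + 1) (X.lt (.const (2 ^ a.m)) (2 * .get 14 (.reg 2))))) <|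
  .seq (.put 0 0 1) (.set 0 (.lim .N / 2 + 1))

/-- The state in which `decodeCmd` has counted the votes. -/
noncomputable def votes (a : Par) (p : Lims) (σ : State) : State :=
  (Cmd.rep (2 ^ a.m) (vote a)).run p ((setup a).run p σ)

theorem run_decodeCmd {a : Par} {n : ℕ} (hn : 1 ≤ n) (σ : State) :
    ((decodeCmd a).run (limsOf n) σ).reg 0 = n + 1 ∧
      ((decodeCmd a).run (limsOf n) σ).mem 0 0 = 1 ∧
      ∀ i < n, ((decodeCmd a).run (limsOf n) σ).mem 0 (i + 1) =
        if 2 ^ a.m < 2 * (votes a (limsOf n) σ).mem 14 i then 1 else 0 := by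
  have hp := limsOf_good hn
  have hNW := hp.N_le
  have hnN : (limsOf n).N = 2 * n + 1 := rfl
  set p := limsOf n with hpdef
  have hdiv : p.N / 2 = n := by omega
  set τ := votes a p σ with hτ
  set τ1 := (Cmd.loop 2 .N (.put 0 (.reg 2 + 1) (X.lt (.const (2 ^ a.m))
    (2 * .get 14 (.reg 2))))).run p τ with e1
  have e : (decodeCmd a).run p σ =
    (Cmd.seq (.put 0 0 1) (.set 0 (.lim .N / 2 + 1))).run p τ1 := rfl
  rw [e]
  refine ⟨?_, ?_, fun i hi => ?_⟩
  · simp only [Cmd.run, setReg_reg, if_true, X.eval_add, X.eval_div, X.eval_lim, Lim.val,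
      X.eval_ofNat, hdiv]
    exact min_eq_left (by omega)
  · have : min 1 p.W = 1 := min_eq_left (by omega)
    simp [Cmd.run, this]
  · have key := loop_put_induct p 2 .N 0 (.reg 2 + 1) (X.lt (.const (2 ^ a.m))
      (2 * .get 14 (.reg 2))) (fun i A => ∀ j < i, A (j + 1) =
        if 2 ^ a.m < 2 * τ.mem 14 j then 1 else 0) (σ := τ) (by simp) (by
      intro i hi A hA j hj
      have h1 : (if 2 ^ a.m < 2 * τ.mem 14 i then 1 else 0) ≤ p.W := by split_ifs <;> omega
      have h2 : X.eval p (X.lt (.const (2 ^ a.m)) (2 * .get 14 (.reg 2)))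
          (withRegMem τ 2 i 0 A) = if 2 ^ a.m < 2 * τ.mem 14 i then 1 else 0 := by simp
      rw [h2, min_eq_left h1]
      simp only [X.eval_add, X.eval_reg, withRegMem_reg, if_true, X.eval_ofNat,
        Function.update_apply]
      by_cases hji : j = i
      · subst hji; simp
      · rw [if_neg (by omega), hA j (by omega)])
    have := key i (by change i < p.N; omega)
    have g : ((Cmd.seq (.put 0 0 1) (.set 0 (.lim .N / 2 + 1))).run p τ1).mem 0 (i + 1) =
        τ1.mem 0 (i + 1) := by simp [Cmd.run]
    rw [g]
    exact this

open scoped Classical in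
-- A clean pattern always votes correctly, and a spoiled one contributes `0` or `1`. So a bit `1`
-- collects at least the clean votes and a bit `0` at most the spoiled ones.
theorem votes_spec {a : Par} {n n' : ℕ} {x x' f : ℕ → ℕ} (ha : a.Ok n)
    (hx' : ∀ i, x' i < 2) (hn : n' ≤ n) (h : Deleted a n n' x x' f) {τ : State}
    (hτ : Ready a n n' x' τ) (h14 : ∀ i, τ.mem 14 i = 0)
    (h1 : ∀ i < 2 ^ a.m * (2 * a.k + 1) * (limsOf n).L, τ.mem 1 i = hashBit a n x i)
    {i : ℕ} (hi : i < n) :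
    (x i = 1 → ((range (2 ^ a.m)).filter fun P => Clean a.m P n n' x x' f).card ≤
      ((Cmd.rep (2 ^ a.m) (vote a)).run (limsOf n) τ).mem 14 i) ∧
    (x i = 0 → ((Cmd.rep (2 ^ a.m) (vote a)).run (limsOf n) τ).mem 14 i ≤
      ((range (2 ^ a.m)).filter fun P => ¬ Clean a.m P n n' x x' f).card) := by
  have hW : 2 ^ a.m ≤ n := (Nat.le_mul_of_pos_right _ (by omega)).trans ha.large
  have hW2 := four_mul_le n
  have hpos := ha.n_pos
  have key := rep_induct (limsOf n) (2 ^ a.m) (vote a) (fun P υ => Ready a n n' x' υ ∧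
    (∀ i < 2 ^ a.m * (2 * a.k + 1) * (limsOf n).L, υ.mem 1 i = hashBit a n x i) ∧
    (∀ i, υ.mem 14 i ≤ P) ∧
    (x i = 1 → ((range P).filter fun P => Clean a.m P n n' x x' f).card ≤ υ.mem 14 i) ∧
    (x i = 0 → υ.mem 14 i ≤ ((range P).filter fun P => ¬ Clean a.m P n n' x x' f).card))
    (σ := τ) ⟨hτ, h1, fun i => (h14 i).le, by simp, by simp [h14]⟩ ?_
  · exact key.2.2.2
  · rintro P hP υ ⟨g1, g2, g3, g4, g5⟩
    have hυ : ∀ i, υ.mem 14 i + 1 ≤ (limsOf n).W := fun i => by have := g3 i; omega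
    have hb := run_vote_bounds (a := a) (P := P) hυ
    refine ⟨g1.vote P, ?_, fun i => ?_, fun hxi => ?_, fun hxi => ?_⟩
    · rw [Cmd.run_mem _ _ _ ((vote_frame a P).2 1 (by simp))]; exact g2
    · have := hb i; have := g3 i; omega
    · rw [range_add_one, filter_insert]
      split_ifs with hc
      · rw [card_insert_of_notMem (by simp), run_vote_of_clean ha hx' hn h hP hc g1 g2 hυ hi, hxi]
        exact Nat.add_le_add_right (g4 hxi) 1
      · exact (g4 hxi).trans (hb i).1
    · rw [range_add_one, filter_insert]
      split_ifs with hc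
      · rw [run_vote_of_clean ha hx' hn h hP hc g1 g2 hυ hi, hxi]
        exact g5 hxi
      · rw [card_insert_of_notMem (by simp)]
        exact (hb i).2.trans (Nat.add_le_add_right (g5 hxi) 1)

/-- At most `2mk` patterns are spoiled, and `2 (2mk) < 2^m`; hence the comparison of twice the votes
with `2^m` gives the right bit. -/
theorem run_decodeCmd_eq {a : Par} {n n' : ℕ} {x x' f : ℕ → ℕ} (ha : a.Ok n)
    (hm : 4 * a.k * a.m < 2 ^ a.m) (hx' : ∀ i, x' i < 2) (hn : n' ≤ n)
    (h : Deleted a n n' x x' f) {σ : State} (hσ : Bdd (limsOf n).W σ) (hr0 : σ.reg 0 = n')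
    (hm0 : σ.mem 0 = x') (h0 : ∀ i, (limsOf n).N ≤ i → x' i = 0)
    (hz : ∀ b, b = 2 ∨ b = 9 ∨ b = 14 → ∀ i, σ.mem b i = 0)
    (h1 : ∀ i < 2 ^ a.m * (2 * a.k + 1) * (limsOf n).L, σ.mem 1 i = hashBit a n x i)
    {i : ℕ} (hi : i < n) :
    ((decodeCmd a).run (limsOf n) σ).mem 0 (i + 1) = x i := by
  classical
  have r := run_setup ha hσ (by rw [hm0]; exact h0) (hz 2 (by simp)) (hz 9 (by simp))
  rw [hr0, hm0] at r
  obtain ⟨v1, v2⟩ := votes_spec ha hx' hn h r (by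
      rw [Cmd.run_mem _ _ _ (by simp [setup, powers, sieve, findPrime, Cmd.Puts])]
      exact hz 14 (by simp)) (by
      rw [Cmd.run_mem _ _ _ (by simp [setup, powers, sieve, findPrime, Cmd.Puts])]
      exact h1) hi
  have hbad : ((range (2 ^ a.m)).filter fun P => ¬ Clean a.m P n n' x x' f).card ≤
      2 * a.m * a.k := by
    have h2 := card_not_clean_le (V := range (2 ^ a.m)) h.emb ha.m_pos
    rw [h.emb.card_del] at h2
    convert h2.trans (Nat.mul_le_mul_left _ h.le)
  have hsum := card_filter_add_card_filter_not (s := range (2 ^ a.m))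
    (fun P => Clean a.m P n n' x x' f)
  rw [card_range] at hsum
  have hcomm : 4 * a.k * a.m = 2 * (2 * a.m * a.k) := by ring
  rw [(run_decodeCmd ha.n_pos σ).2.2 i hi]
  change (if 2 ^ a.m < 2 * ((Cmd.rep (2 ^ a.m) (vote a)).run (limsOf n)
    ((setup a).run (limsOf n) σ)).mem 14 i then 1 else 0) = x i
  have hx := h.lt_two i
  interval_cases hxi : x i
  · have := v2 rfl
    rw [if_neg (by omega)]
  · have := v1 rfl
    rw [if_pos (by omega)]

theorem fits_decodeCmd (a : Par) : (decodeCmd a).Fits true true := by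
  have hh : ∀ r (f : ℕ → X) (n l : Bool), (∀ i, (f i).Fits n l) → (modHankelX r f).Fits n l :=
    fun r f n l h => by simp [modHankelX, X.fits_hankel, h]
  have hv : ∀ P, (vote a P).Fits true true := fun P => by
    simp [vote, Cmd.Fits, fits_segments, loadSyndromes, powerSumX, X.fits_pow, fixErrors, fixError,
      findPosition, findValue, correctSyndromes, positions, maxLenX, blocksX, bitX, blockX, codeX,
      offsetX, X.fits_lookup, hh]
  simp [decodeCmd, Cmd.Fits, fits_setup, hv]

end Codec

/-! ### Choice of the parameters and the main theorem -/

open BLoop RAM Split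

theorem exists_par {k : ℕ} (hk : 2 ≤ k) : ∃ (a : Codec.Par) (n₀ : ℕ), a.k = k ∧
    a.m = patternLength k ∧ ∀ n ≥ n₀, 2 ≤ n ∧ k ≤ n ∧ a.Ok n ∧
      windowLength k n ≤ Params.maxLen k a.B (limsOf n).L := by
  obtain ⟨B, h1, h2, h3⟩ := Params.exists_blockLength k (20000 * k ^ 3)
  obtain ⟨φ, ψ, h4, h5⟩ := Block.exists_tables h1
  obtain ⟨L₀, h6⟩ := Params.exists_hash_bound k B
  have h7 : 0 < 2 ^ L₀ := by positivity
  -- The first summand forces `L₀ ≤ L`, as `n < 2^L`; the second one gives the condition `large`,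
  -- which keeps the length of the hash below `W`.
  refine ⟨⟨k, patternLength k, B, φ, ψ⟩, 2 ^ L₀ + 2 ^ patternLength k * (2 * k + 1) + k + 2, rfl,
    rfl, fun n hn => ⟨by omega, by omega, ?_, Params.windowLength_le hk (by omega) h3⟩⟩
  have hL : L₀ ≤ (limsOf n).L := by
    rw [← Nat.pow_le_pow_iff_right (a := 2) (by norm_num)]
    have h8 : 2 * n + 1 ≤ 2 ^ (limsOf n).L := Codec.N_le_two_pow n
    omega
  exact ⟨by omega, Params.one_le_patternLength hk, h1, h2, h4, h5,
    (h6 _ hL).trans (Params.two_pow_clog_le (by omega)), by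
      change 2 ^ patternLength k * (2 * k + 1) ≤ n; omega⟩

theorem bdd_start {W : ℕ} {xs : List (List Bool)} (hW : 1 ≤ W) (h0 : (xs.getD 0 []).length ≤ W)
    (h2 : xs.length ≤ 2) : Bdd W (start xs) := by
  refine ⟨fun r => ?_, fun a i => (Bool.toNat_le _).trans hW⟩
  rcases Nat.eq_zero_or_pos r with rfl | hr
  · exact h0
  · have : (xs.getD (2 * r) []) = [] := List.getD_eq_default _ _ (by omega)
    change (xs.getD (2 * r) []).length ≤ W
    rw [this]
    exact Nat.zero_le _

theorem bits_of_length_le {s : List Bool} {i : ℕ} (h : s.length ≤ i) : bits s i = 0 := by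
  simp [bits, List.getElem?_eq_none h]

theorem toNat_decide_eq_one {u : ℕ} (h : u < 2) : (decide (u = 1)).toNat = u := by
  interval_cases u <;> rfl

theorem hasOutput_of_sim {p : Lims} {σ ρ : State} (h : Sim p σ ρ) {y : List Bool}
    (h0 : σ.reg 0 = y.length) (h1 : ∀ i, (hi : i < y.length) → σ.mem 0 i = (y[i]).toNat) :
    ρ.HasOutput y :=
  ⟨(h.reg 0).trans h0, fun i hi => by rw [h.mem, h1 i hi]⟩

theorem decide_bits_eq_one {s : List Bool} {i : ℕ} (hi : i < s.length) :
    decide (bits s i = 1) = s[i] := by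
  rw [bits, List.getD_eq_getElem _ _ hi]
  cases s[i] <;> rfl

theorem theorem2 :
    ∃ C : ℝ, ∀ k : ℕ, 2 ≤ k →
      ∃ (progH progG : RAM.Prog) (K : ℝ) (n₀ : ℕ), ∀ n : ℕ, n₀ ≤ n →
        ∃ b : ℕ, (b : ℝ) ≤ C * (k : ℝ) ^ 2 * Real.logb 2 k * Real.logb 2 n ∧
          ∃ (H : mixedStrings k n → List.Vector Bool b)
            (G : List.Vector Bool (n - k) → List.Vector Bool b → Option (List.Vector Bool n)),
            (∀ s : mixedStrings k n,
              progH.ComputesWithin [s.1.toList] (H s).toList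
                (K * n * Real.logb 2 n ^ 4)) ∧
            (∀ (s' : List.Vector Bool (n - k)) (h : List.Vector Bool b),
              progG.ComputesWithin [s'.toList, h.toList] (encodeOrFail (G s' h))
                (K * n * Real.logb 2 n ^ 4)) ∧
            ∀ s : mixedStrings k n, ∀ s' ∈ deletions k s.1, G s' (H s) = some s.1 := by
  refine ⟨1536, fun k hk => ?_⟩
  obtain ⟨a, n₀, hak, ham, hn₀⟩ := exists_par hk
  -- The number added to the length of the first input to get `n` is `0` for the hash, whose input
  -- is `s`, and `k` for the decoder, whose first input is `s'`.
  obtain ⟨C₁, hC₁⟩ := Cmd.exists_exec_prog 0 (Codec.hashCmd a) (Codec.fits_hashCmd a)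
  obtain ⟨C₂, hC₂⟩ := Cmd.exists_exec_prog k (Codec.decodeCmd a) (Codec.fits_decodeCmd a)
  refine ⟨(Codec.hashCmd a).prog 0, (Codec.decodeCmd a).prog k, 192 * ((C₁ + C₂ : ℕ) : ℝ), n₀,
    fun n hn => ?_⟩
  obtain ⟨hn2, hkn, ha, hwin⟩ := hn₀ n hn
  have hp := limsOf_good ha.n_pos
  have hW4 := Codec.four_mul_le n
  have htime : ∀ {t c : ℕ}, c ≤ C₁ + C₂ →
      t ≤ c * ((limsOf n).N * (limsOf n).L * len (limsOf n).W) →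
      (t : ℝ) ≤ 192 * ((C₁ + C₂ : ℕ) : ℝ) * n * Real.logb 2 n ^ 4 := fun hc ht =>
    (Nat.cast_le.2 (ht.trans (Nat.mul_le_mul_right _ hc))).trans (Params.time_le hn2 _)
  have hb : Params.hashLength k n = 2 ^ a.m * (2 * a.k + 1) * (limsOf n).L := by
    rw [hak, ham]; rfl
  have hzero : ∀ {l : ℕ} {s : List Bool}, s.length = l → l ≤ n → ∀ i, (limsOf n).N ≤ i →
      bits s i = 0 := fun hs hl i hi =>
    bits_of_length_le (by have : (limsOf n).N = 2 * n + 1 := rfl; omega)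
  let dec : List.Vector Bool (n - k) → List.Vector Bool (Params.hashLength k n) → State :=
    fun s' h => (Codec.decodeCmd a).run (limsOf n) (start [s'.toList, h.toList])
  let H : mixedStrings k n → List.Vector Bool (Params.hashLength k n) := fun s =>
    ⟨(List.range (Params.hashLength k n)).map fun i =>
      decide (Codec.hashBit a n (bits s.1.toList) i = 1), by simp⟩
  -- The decoder is defined by what its program writes, for arbitrary arguments, and never fails.
  -- For true hashes its value is identified below.
  let G : List.Vector Bool (n - k) → List.Vector Bool (Params.hashLength k n) →
      List.Vector Bool n := fun s' h =>
    ⟨(List.range n).map fun i => decide ((dec s' h).mem 0 (i + 1) = 1), by simp⟩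
  have hbit : ∀ (x : ℕ → ℕ) i, Codec.hashBit a n x i < 2 := fun x i => Nat.mod_lt _ (by norm_num)
  refine ⟨_, Params.hashLength_le hk hn2, H, fun s' h => some (G s' h), fun s => ?_,
    fun s' h => ?_, fun s s' hs' => ?_⟩
  · have hbdd : Bdd (limsOf n).W (start [s.1.toList]) :=
      bdd_start (by omega) (by simp; omega) (by simp)
    obtain ⟨t, ρ, h1, h2, h3⟩ := hC₁ [s.1.toList] n ha.n_pos (by simp [State.init]) hbdd
    refine ⟨t, ρ, h1, ?_, htime (by omega) h2⟩
    obtain ⟨g1, g2⟩ := Codec.run_hashCmd ha hbdd (by simp [start, State.init])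
      (bits_lt_two s.1.toList) (hzero s.1.toList_length le_rfl) (fun i => by simp [start, State.init])
      (fun i => by simp [start, State.init])
    refine hasOutput_of_sim h3 (by rw [g1, ← hb]; exact (H s).toList_length.symm) fun i hi => ?_
    rw [g2 i (by rw [← hb]; simpa using hi)]
    simp only [H, List.Vector.toList_mk, List.getElem_map, List.getElem_range]
    exact (toNat_decide_eq_one (hbit _ _)).symm
  · have hbdd : Bdd (limsOf n).W (start [s'.toList, h.toList]) :=
      bdd_start (by omega) (by simp; omega) (by simp)
    obtain ⟨t, ρ, h1, h2, h3⟩ := hC₂ [s'.toList, h.toList] n ha.n_pos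
      (by simp [State.init]; omega) hbdd
    refine ⟨t, ρ, h1, ?_, htime (by omega) h2⟩
    obtain ⟨g1, g2, g3⟩ := Codec.run_decodeCmd (a := a) ha.n_pos (start [s'.toList, h.toList])
    refine hasOutput_of_sim h3 (by rw [g1]; simp [encodeOrFail]) fun i hi => ?_
    cases i with
    | zero => rw [g2]; rfl
    | succ i =>
      have hi' : i < n := by simpa [encodeOrFail] using hi
      have hlt : (dec s' h).mem 0 (i + 1) < 2 := by
        change ((Codec.decodeCmd a).run _ _).mem 0 (i + 1) < 2
        rw [g3 i hi']; split_ifs <;> norm_num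
      simp only [encodeOrFail, G, List.Vector.toList_mk, List.getElem_cons_succ, List.getElem_map,
        List.getElem_range]
      exact (toNat_decide_eq_one hlt).symm
  · obtain ⟨f, hf⟩ := exists_emb hs'
    rw [s.1.toList_length, s'.toList_length] at hf
    have hmix : IsMixed k s.1.toList := s.2
    have hdel : Codec.Deleted a n (n - k) (bits s.1.toList) (bits s'.toList) f := by
      refine ⟨hf, by omega, bits_lt_two _, fun P hP j => ?_⟩
      rw [hak]
      refine (segLen_le _ _ _ _ ha.m_pos (fun i hi => ?_) j).trans hwin
      rw [ham] at hP ⊢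
      have := exists_occ_of_isMixed hmix hP (i := i)
      rw [s.1.toList_length] at this
      exact this hi
    refine congrArg some (Subtype.ext (List.ext_getElem
      ((G s' (H s)).toList_length.trans s.1.toList_length.symm) fun i hi hi' => ?_))
    have hin : i < n := by rwa [← s.1.toList_length]
    have key := Codec.run_decodeCmd_eq ha (by rw [hak, ham]; exact Params.four_mul_lt_two_pow hk)
      (bits_lt_two s'.toList) (Nat.sub_le n k) hdel
      (σ := start [s'.toList, (H s).toList]) (bdd_start (by omega) (by simp; omega) (by simp))
      (by simp [start, State.init]) rfl (hzero s'.toList_length (Nat.sub_le n k))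
      (by rintro b (rfl | rfl | rfl) i <;> simp [start, State.init]) (fun i hi => ?_) hin
    · simp only [G, List.getElem_map, List.getElem_range]
      change decide (((Codec.decodeCmd a).run _ _).mem 0 (i + 1) = 1) = _
      rw [key]
      exact decide_bits_eq_one _
    · rw [← hb] at hi
      change (((H s).toList).getD i false).toNat = _
      rw [← toNat_decide_eq_one (hbit (bits s.1.toList) i)]
      simp [H, hi]
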